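/- Let $p>0$ be a prime. All schemes below are Noetherian, normal, integral, of characteristic $p$, and $F$-finite (the absolute Frobenius morphism $F$ is finite). **Conventions.** Let $X$ be such a scheme, with function field $K(X)$. A canonical divisor $K_X$ is a Weil divisor such that $\omega_X := \mathcal{O}_X(K_X)$ is a canonical sheaf, i.e. at each point $x$ the stalk $\omega_{X,x}$ is isomorphic to the lowest nonvanishing cohomology module of a dualizing complex of $\mathcal{O}_{X,x}$. Condition $(!)$ says that $F^!\omega_X = \mathcal{H}om_{\mathcal{O}_X}(F_*\mathcal{O}_X,\omega_X)\simeq\omega_X$ (as $F_*\mathcal{O}_X$-modules). A $\mathbb{Q}$-divisor $D$ is $\mathbb{Q}$-Cartier if $mD$ is (integral and) Cartier for some integer $m>0$; the least such $m$ is its index. For a $\mathbb{Q}$-divisor $\Delta\ge 0$ on $X$, a nonzero (quasi-coherent) ideal sheaf $\mathfrak{a}$ on $X$ and a real number $t\ge 0$, the triple $(X,\Delta,\mathfrak{a}^t)$ is *sharply $F$-pure* if for every closed point $x\in X$, writing $R=\mathcal{O}_{X,x}$, there are an integer $e>0$ and a map $\phi$ in the image of $$\operatorname{Hom}_R\big(F^e_*R(\lceil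 (p^e-1)\Delta\rceil),R\big)\to\operatorname{Hom}_R(F^e_*R,R)$$ such that $1\in\phi\big(F^e_*\,\mathfrak{a}_x^{\lceil t(p^e-1)\rceil}\big)$. Let $\pi\colon Y\to X$ be a finite surjective morphism such that $K(Y)/K(X)$ is separable. The ramification divisor $\mathrm{Ram}_\pi$ has coefficient $\operatorname{length}_{\mathcal{O}_{Y,C}}(\Omega_{Y/X,C})$ along each prime divisor $C$ of $Y$. For a $\mathbb{Q}$-divisor $\Delta$ on $X$, the coefficient of $\pi^*\Delta$ along $C$ is $a\cdot\operatorname{ord}_C(\tau)$, where $a$ is the coefficient of $\Delta$ along $\pi(C)$ and $\tau$ is a uniformizer of $\mathcal{O}_{X,\pi(C)}$. Let $\mathrm{Tr}\colon\pi_*\mathcal{O}_Y\to\mathcal{O}_X$ be the map induced by the field trace of $K(Y)/K(X)$. **Theorem.** Let $\pi\colon Y\to X$ be a finite surjective separable morphism as above, let $K_X$ be a canonical divisor on $X$ satisfying $(!)$, let $\Delta_X$ be a $\mathbb{Q}$-divisor on $X$, $\mathfrak{a}\ne 0$ an ideal sheaf on $X$, and $t\ge 0$ a real number. Set $\Delta_Y=\pi^*\Delta_X-\mathrm{Ram}_\pi$.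 Assume that $\Delta_X$ and $\Delta_Y$ are effective, that $K_X+\Delta_X$ is $\mathbb{Q}$-Cartier with index not divisible by $p$, and that $\mathrm{Tr}\colon\pi_*\mathcal{O}_Y\to\mathcal{O}_X$ is surjective. Then $(X,\Delta_X,\mathfrak{a}^t)$ is sharply $F$-pure if and only if $(Y,\Delta_Y,(\mathfrak{a}\cdot\mathcal{O}_Y)^t)$ is sharply $F$-pure. -/

import Mathlib

open AlgebraicGeometry CategoryTheory Order

universe u

noncomputable section

namespace FPure

/-! ### `p^{-e}`-linear maps -/

/-- The group of `p^{-e}`-linear maps `M → N`, that is `Hom_R(F^e_* M, N)`: the additive maps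
`φ` with `φ (r ^ (p ^ e) • x) = r • φ x`. -/
def pInvLinearMaps (p e : ℕ) (R M N : Type*) [CommRing R] [AddCommGroup M] [Module R M]
    [AddCommGroup N] [Module R N] : AddSubgroup (M →+ N) where
  carrier := {φ | ∀ (r : R) (x : M), φ (r ^ (p ^ e) • x) = r • φ x}
  add_mem' := by
    intro φ ψ hφ hψ r x
    simp [hφ r x, hψ r x]
  zero_mem' := by
    intro r x
    simp
  neg_mem' := by
    intro φ hφ r x
    simp [hφ r x]

/-! ### Dualizing complexes and canonical modules of local rings -/

/-- A dualizing complex over a ring `R`, represented by a bounded complex `I` of injective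
modules: its cohomology modules are finitely generated and the homothety map
`R → RHom_R(I, I) = Hom^•(I, I)` is a quasi-isomorphism. -/
structure IsDualizingComplex (R : Type u) [CommRing R]
    (I : CochainComplex (ModuleCat.{u} R) ℤ) : Prop where
  injective : ∀ n, Injective (I.X n)
  bounded : ∃ a b : ℤ, ∀ n, n < a ∨ b < n → Limits.IsZero (I.X n)
  finite_homology : ∀ n, Module.Finite R (I.homology n)
  /-- `R → H^0(Hom^•(I, I))` is bijective. -/
  homothety : ∀ f : I ⟶ I, ∃! r : R, Nonempty (Homotopy f (r • 𝟙 I))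
  /-- `H^n(Hom^•(I, I)) = 0` for `n ≠ 0`. -/
  homotopy_zero : ∀ n : ℤ, n ≠ 0 → ∀ f : I ⟶ I⟦n⟧, Nonempty (Homotopy f 0)

/-- `M` is a canonical module of the local ring `R`: it is isomorphic to the lowest nonvanishing
cohomology module of a dualizing complex of `R`. -/
def IsCanonicalModule (R : Type u) [CommRing R] (M : Type u) [AddCommGroup M] [Module R M] :
    Prop :=
  ∃ I : CochainComplex (ModuleCat.{u} R) ℤ, IsDualizingComplex R I ∧
    ∃ n : ℤ, (∀ m < n, Limits.IsZero (I.homology m)) ∧ ¬ Limits.IsZero (I.homology n) ∧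
      Nonempty (M ≃ₗ[R] I.homology n)

/-! ### Normal and `F`-finite schemes -/

/-- A scheme is normal if all its local rings are integrally closed (integral schemes only). -/
class IsNormalScheme (X : Scheme.{u}) [IsIntegral X] : Prop where
  isIntegrallyClosed_stalk : ∀ x : X, IsIntegrallyClosed (X.presheaf.stalk x)

/-- An integral scheme of characteristic `p` whose absolute Frobenius morphism is finite. -/
class IsFFinite (p : ℕ) (X : Scheme.{u}) [IsIntegral X] : Prop where
  charP : CharP X.functionField p
  finite_frobenius : ∀ U : X.affineOpens,
    ∃ F : Γ(X, U) →+* Γ(X, U), (∀ r, F r = r ^ p) ∧ F.Finite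

/-! ### Weil divisors and their divisorial sheaves -/

/-- Weil divisors on `X` with coefficients in `A`: algebraic cycles supported on points of
codimension one. A prime divisor is identified with its generic point. -/
structure WeilDivisor (X : Scheme.{u}) (A : Type*) [Zero A] where
  cycle : AlgebraicCycle X A
  coheight_eq_one : ∀ x, cycle x ≠ 0 → coheight x = 1

instance (X : Scheme.{u}) (A : Type*) [Zero A] : CoeFun (WeilDivisor X A) (fun _ => X → A) :=
  ⟨fun D => D.cycle⟩

section Divisors

variable {X : Scheme.{u}} [IsIntegral X] [IsNoetherian X]

lemma isDiscreteValuationRing_stalk [IsNormalScheme X] {x : X} (hx : coheight x = 1) :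
    IsDiscreteValuationRing (X.presheaf.stalk x) := by
  have hdim : ringKrullDim (X.presheaf.stalk x) = 1 := by
    rw [ringKrullDim_stalk_eq_coheight, hx]; rfl
  have hdle : Ring.KrullDimLE 1 (X.presheaf.stalk x) := krullDimLE_of_coheight_le hx.le
  have hic := IsNormalScheme.isIntegrallyClosed_stalk x
  have hnf : ¬ IsField (X.presheaf.stalk x) := by
    intro h
    rw [ringKrullDim_eq_zero_of_isField h] at hdim
    exact zero_ne_one hdim
  have h1 : Ring.DimensionLEOne (X.presheaf.stalk x) :=
    ⟨fun {I} hI hp => (Ring.krullDimLE_one_iff_of_isPrime_bot.mp hdle) I hI hp⟩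
  have hD : IsDedekindDomain (X.presheaf.stalk x) :=
    { toIsDomain := inferInstance, toIsDedekindRing := { __ := hic } }
  exact ((IsDiscreteValuationRing.TFAE (X.presheaf.stalk x) hnf).out 0 2).mpr hD

lemma ord_le_ord_stalk_smul {x E : X} (hE : E ⤳ x) {r : X.presheaf.stalk x} (hr : r ≠ 0)
    (f : X.functionField) : X.ord f E ≤ X.ord (r • f) E := by
  obtain ⟨U, hxU, a, rfl⟩ := X.presheaf.exists_germ_eq r
  have : Nonempty U := ⟨⟨x, hxU⟩⟩
  have ha : a ≠ 0 := by
    rintro rfl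
    exact hr (map_zero _)
  have h := Scheme.ord_le_smul (hE.mem_open U.isOpen hxU) ha f
  rw [Algebra.smul_def] at h ⊢
  rw [Scheme.algebraMap_germ_eq_germToFunctionField]
  exact h

/-- A divisor (given by its coefficients at the points of codimension one) is effective. -/
def IsEffective (D : X → ℚ) : Prop := ∀ E : X, coheight E = 1 → 0 ≤ D E

/-- A `ℚ`-divisor is Cartier if it is integral and locally principal. -/
def IsCartier (D : X → ℚ) : Prop :=
  ∀ x : X, ∃ U : X.Opens, x ∈ U ∧ ∃ f : X.functionField, f ≠ 0 ∧
    ∀ E ∈ U, coheight E = 1 → D E = X.ord f E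

/-- Some positive multiple is Cartier. -/
def IsQCartier (D : X → ℚ) : Prop := ∃ m : ℕ, 0 < m ∧ IsCartier (fun E => m * D E)

/-- The index of a `ℚ`-Cartier `ℚ`-divisor `D`: the least `m > 0` such that `mD` is Cartier. -/
def cartierIndex (D : X → ℚ) : ℕ := sInf {m : ℕ | 0 < m ∧ IsCartier (fun E => m * D E)}

variable [IsNormalScheme X]

/-- The sections over the open set `U` of the sheaf `𝒪_X(D)`, a subsheaf of the constant sheaf
of rational functions. -/
def divisorialSections (D : X → ℤ) (U : X.Opens) [Nonempty U] :
    Submodule Γ(X, U) X.functionField where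
  carrier := {f | f ≠ 0 → ∀ E ∈ U, coheight E = 1 → 0 ≤ X.ord f E + D E}
  add_mem' := by
    intro f g hf hg hfg E hEU hE
    have := isDiscreteValuationRing_stalk hE
    by_cases hf0 : f = 0
    · subst hf0
      rw [zero_add] at hfg ⊢
      exact hg hfg E hEU hE
    by_cases hg0 : g = 0
    · subst hg0
      rw [add_zero] at hfg ⊢
      exact hf hfg E hEU hE
    have h := Scheme.ord_add (x := E) hfg
    have h1 := hf hf0 E hEU hE
    have h2 := hg hg0 E hEU hE
    rcases min_le_iff.mp h with h | h <;> linarith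
  zero_mem' := fun h => absurd rfl h
  smul_mem' := by
    intro r f hf hrf E hEU hE
    have hr : r ≠ 0 := by
      rintro rfl
      exact hrf (zero_smul _ _)
    have hf0 : f ≠ 0 := by
      rintro rfl
      exact hrf (smul_zero _)
    have h1 := hf hf0 E hEU hE
    have h2 := Scheme.ord_le_smul hEU hr f
    linarith

/-- The stalk of `𝒪_X(D)` at `x`; for `R = 𝒪_{X,x}` this is the module `R(D|_{Spec R})`. -/
def divisorialStalk (D : X → ℤ) (x : X) :
    Submodule (X.presheaf.stalk x) X.functionField where
  carrier := {f | f ≠ 0 → ∀ E : X, E ⤳ x → coheight E = 1 → 0 ≤ X.ord f E + D E}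
  add_mem' := by
    intro f g hf hg hfg E hEU hE
    have := isDiscreteValuationRing_stalk hE
    by_cases hf0 : f = 0
    · subst hf0
      rw [zero_add] at hfg ⊢
      exact hg hfg E hEU hE
    by_cases hg0 : g = 0
    · subst hg0
      rw [add_zero] at hfg ⊢
      exact hf hfg E hEU hE
    have h := Scheme.ord_add (x := E) hfg
    have h1 := hf hf0 E hEU hE
    have h2 := hg hg0 E hEU hE
    rcases min_le_iff.mp h with h | h <;> linarith
  zero_mem' := fun h => absurd rfl h
  smul_mem' := by
    intro r f hf hrf E hEU hE
    have hr : r ≠ 0 := by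
      rintro rfl
      exact hrf (zero_smul _ _)
    have hf0 : f ≠ 0 := by
      rintro rfl
      exact hrf (smul_zero _)
    have h1 := hf hf0 E hEU hE
    have h2 := ord_le_ord_stalk_smul hEU hr f
    linarith

/-- `D` is a canonical divisor: `𝒪_X(D)` is a canonical sheaf, that is its stalks are canonical
modules of the local rings of `X`. -/
def IsCanonicalDivisor (D : X → ℤ) : Prop :=
  ∀ x : X, IsCanonicalModule (X.presheaf.stalk x) (divisorialStalk D x)

/-- The sheaf `ω = 𝒪_X(D)` satisfies `F^! ω = Hom_{𝒪_X}(F_* 𝒪_X, ω) ≃ ω`. An isomorphism of sheaves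
is given on the nonempty affine open sets; it is linear over `F_* 𝒪_X` and compatible with
restriction. -/
def FrobeniusShriekIso (p : ℕ) (D : X → ℤ) : Prop :=
  ∃ θ : ∀ (U : X.affineOpens) [Nonempty U.1], divisorialSections D U.1 ≃+
      pInvLinearMaps p 1 Γ(X, U) Γ(X, U) (divisorialSections D U.1),
    (∀ (U : X.affineOpens) [Nonempty U.1] (r a : Γ(X, U)) (s : divisorialSections D U.1),
      (θ U (r • s)).1 a = (θ U s).1 (r * a)) ∧
    (∀ (U V : X.affineOpens) [Nonempty U.1] [Nonempty V.1] (h : V.1 ≤ U.1) (a : Γ(X, U))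
      (s : divisorialSections D U.1) (s' : divisorialSections D V.1),
      (s : X.functionField) = s' →
        ((θ V s').1 (X.presheaf.map (homOfLE h).op a) : X.functionField) = (θ U s).1 a)

/-! ### Sharp `F`-purity -/

/-- The stalk at `x` of an ideal sheaf. -/
def idealStalk {X : Scheme.{u}} (𝔞 : X.IdealSheafData) (x : X) : Ideal (X.presheaf.stalk x) :=
  ⨆ (U : X.affineOpens) (hx : x ∈ U.1), (𝔞.ideal U).map (X.presheaf.germ U.1 x hx).hom

/-- The set `I_{Δ,e}` for the local ring `R = 𝒪_{X,x}` and an effective `ℚ`-divisor `Δ`: the image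
of `Hom_R(F^e_* R(⌈(p^e - 1)Δ⌉), R) → Hom_R(F^e_* R, R)`. -/
def mapsAlong (p : ℕ) (Δ : X → ℚ) (e : ℕ) (x : X) :
    Set (X.presheaf.stalk x →+ X.presheaf.stalk x) :=
  {φ | φ ∈ pInvLinearMaps p e (X.presheaf.stalk x) (X.presheaf.stalk x) (X.presheaf.stalk x) ∧
    ∃ ψ ∈ pInvLinearMaps p e (X.presheaf.stalk x)
        (divisorialStalk (fun E => ⌈((p : ℚ) ^ e - 1) * Δ E⌉) x) (X.presheaf.stalk x),
      ∀ r : X.presheaf.stalk x,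
        ∃ hr : algebraMap _ X.functionField r ∈
          divisorialStalk (fun E => ⌈((p : ℚ) ^ e - 1) * Δ E⌉) x, φ r = ψ ⟨_, hr⟩}

/-- The triple associated to the stalk `𝒪_{X,x}` is sharply `F`-pure. -/
def IsSharplyFPureAt (p : ℕ) (Δ : X → ℚ) (𝔞 : X.IdealSheafData) (t : ℝ) (x : X) : Prop :=
  ∃ e : ℕ, 0 < e ∧ ∃ φ ∈ mapsAlong p Δ e x,
    ∃ a ∈ idealStalk 𝔞 x ^ ⌈t * ((p : ℝ) ^ e - 1)⌉₊, φ a = 1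

/-- The triple `(X, Δ, 𝔞^t)`, where `Δ` is effective, is sharply `F`-pure. -/
def IsSharplyFPure (p : ℕ) (Δ : X → ℚ) (𝔞 : X.IdealSheafData) (t : ℝ) : Prop :=
  ∀ x : X, IsClosed {x} → IsSharplyFPureAt p Δ 𝔞 t x

end Divisors

/-! ### Finite separable morphisms -/

section Morphisms

lemma map_genericPoint_specializes {X Y : Scheme.{u}} [IsIntegral Y] (π : Y ⟶ X)
    [IsDominant π] (x : X) : π (genericPoint Y) ⤳ x := by
  rw [specializes_iff_mem_closure]
  have h := (genericPoint_spec Y).image π.continuous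
  rw [isGenericPoint_def] at h
  rw [h, Set.image_univ, π.denseRange.closure_range]
  trivial

variable {X Y : Scheme.{u}} [IsIntegral X] [IsIntegral Y] (π : Y ⟶ X)

/-- The inclusion `K(X) → K(Y)` of function fields given by a dominant morphism `Y → X`. -/
def functionFieldMap [IsDominant π] : X.functionField →+* Y.functionField :=
  (X.presheaf.stalkSpecializes (map_genericPoint_specializes π (genericPoint X)) ≫
    π.stalkMap (genericPoint Y)).hom

/-- The extension of function fields `K(Y)/K(X)` is separable. -/
def IsSeparableMorphism [IsDominant π] : Prop :=
  letI := (functionFieldMap π).toAlgebra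
  Algebra.IsSeparable X.functionField Y.functionField

/-- The trace map `K(Y) → K(X)`. -/
def traceMap [IsDominant π] : Y.functionField → X.functionField :=
  letI := (functionFieldMap π).toAlgebra
  Algebra.trace X.functionField Y.functionField

/-- The trace map of sheaves `π_* 𝒪_Y → 𝒪_X` is surjective: every section of `𝒪_X` is locally
the trace of a section of `π_* 𝒪_Y`. -/
def IsTraceSurjective [IsDominant π] : Prop :=
  ∀ (U : X.Opens) (r : Γ(X, U)) (x : X) (_ : x ∈ U), ∃ (V : X.Opens) (hVU : V ≤ U) (_ : x ∈ V)
    (_ : Nonempty V) (_ : Nonempty (π ⁻¹ᵁ V : Y.Opens)) (s : Γ(Y, π ⁻¹ᵁ V)),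
      traceMap π (Y.germToFunctionField (π ⁻¹ᵁ V) s) =
        X.germToFunctionField V (X.presheaf.map (homOfLE hVU).op r)

variable [IsNoetherian X] [IsNoetherian Y]

open Classical in
/-- The ramification index of `π` along the prime divisor `C` of `Y`: the order along `C` of a
uniformizer of `X` at `π C`. -/
def ramificationIndex [IsDominant π] (C : Y) : ℤ :=
  if h : ∃ t : X.functionField, X.ord t (π C) = 1 then Y.ord (functionFieldMap π h.choose) C
  else 0

/-- The coefficient along `C` of the ramification divisor of `π`: the length of the stalk
`Ω_{Y/X,C}` of the sheaf of relative differentials. -/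
def ramificationCoeff (C : Y) : ℕ :=
  letI := (π.stalkMap C).hom.toAlgebra
  (Module.length (Y.presheaf.stalk C)
    (KaehlerDifferential (X.presheaf.stalk (π C)) (Y.presheaf.stalk C))).toNat

/-- The coefficients, at the points of codimension one, of `π^* Δ - Ram_π`. -/
def pullbackSubRam [IsDominant π] (Δ : X → ℚ) (C : Y) : ℚ :=
  ramificationIndex π C * Δ (π C) - ramificationCoeff π C

end Morphisms

end FPure

end

open FPure

set_option linter.unusedSectionVars false

noncomputable section

/-! Write `K` and `L` for the function fields of `X` and `Y`. Everything is transported to additive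
maps on function fields. A `p^{-e}`-linear map on a local ring extends to the fraction field, and
because the schemes are normal, the condition of factoring through `⌈(p^e - 1)Δ⌉` is a condition
along each prime divisor `E` through the point. A nonzero `Φ : K →+ K` has an integer divisor `d`
along `E` (`HasDivisor`, `HasDivisorAt`), and the condition reads `(p^e - 1) * Δ E ≤ d`.

The core is a ramification formula. As `L/K` is finite separable, `Φ` extends uniquely to a
`p^{-e}`-linear `Ψ` on `L`, and `Ψ` is compatible with the traces (`exists_extension`,
`extension_unique`). By `hasDivisor_extension`, `div Ψ = π^* div Φ - (p^e - 1) Ram`, with no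
tameness assumption and no assumption on residue fields. Its proof uses `p`-bases. A `p`-basis `x`
gives the operator `theta`, the coefficient of `∏ xᵢ ^ (p - 1)`, which is the Cartier operator in
the coordinates `x`. Its iterates generate all `p^{-e}`-linear maps, and they have divisor `0` if
`x` is a `p`-basis of the discrete valuation ring. Under a change of `p`-basis, `theta` is twisted
by the Jacobian determinant (`theta_mul_det_jacobian`); over an extension `V → W` the order of this
determinant is the length of the differentials of `W` over `V`.

Ascent: extend a witness `Φ` to `Ψ`. The formula gives the inequality for `Δ_Y`, and `Ψ` still takes
the value `1` on the pulled back ideal.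

Descent: condition `(!)` makes `K_X` visible as a map with divisor `(1 - p)K_X`. As the index is
prime to `p`, twisting an iterate of it by a local equation gives, near `x`, a map `Φ` with divisor
exactly `(p^e - 1)Δ_X` (`exists_hasDivisorAt_eq`). Its extension `Ψ` then has divisor exactly `(p^e
- 1)Δ_Y`, so every witness at a point `y` over `x` is `Ψ` precomposed with multiplication by a
function regular at `y`. The values of `Ψ` on the relevant power of the pulled back ideal thus form
an ideal contained in no prime over `x`, and by lying over this ideal contains some `r` from the
base not vanishing at `x`, say `r = Ψ c`. If `b` has trace `1`, then `Φ (Tr (b ^ p ^ e * c)) = Tr (Ψ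
(b ^ p ^ e * c)) = Tr (b * r) = r`, a unit at `x` (`isFPureWith_of_comap`). -/

namespace FPure

/-! ### `p`-bases -/

section PBasis

variable {A : Type*} [CommRing A] {ι : Type*} [Fintype ι]

/-- The monomial `∏ xᵢ ^ nᵢ`. -/
def pMonomial (x : ι → A) (n : ι → ℕ) : A := ∏ i, x i ^ n i

lemma pMonomial_add (x : ι → A) (m n : ι → ℕ) :
    pMonomial x (m + n) = pMonomial x m * pMonomial x n := by
  simp [pMonomial, pow_add, Finset.prod_mul_distrib]

lemma pMonomial_smul (x : ι → A) (k : ℕ) (n : ι → ℕ) :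
    pMonomial x (k • n) = pMonomial x n ^ k := by
  simp [pMonomial, ← Finset.prod_pow, ← pow_mul, mul_comm]

@[simp]
lemma pMonomial_zero (x : ι → A) : pMonomial x 0 = 1 := by simp [pMonomial]

lemma pMonomial_single [DecidableEq ι] (x : ι → A) (j : ι) (k : ℕ) :
    pMonomial x (Pi.single j k) = x j ^ k := by
  rw [pMonomial, Finset.prod_eq_single j]
  · simp
  · intro i _ hi
    simp [hi]
  · simp

lemma map_pMonomial {B : Type*} [CommRing B] (f : A →+* B) (x : ι → A) (n : ι → ℕ) :
    f (pMonomial x n) = pMonomial (fun i => f (x i)) n := by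
  simp [pMonomial]

variable (p : ℕ) [Fact p.Prime] [CharP A p]

/-- The map `c ↦ ∑ c_α ^ p x ^ α`, the sum being over the reduced exponents. -/
def pComb (x : ι → A) : ((ι → Fin p) → A) →+ A := by
  classical
  exact
  { toFun := fun c => ∑ α, c α ^ p * pMonomial x (fun i => α i)
    map_zero' := by simp [(Fact.out : p.Prime).ne_zero]
    map_add' := by
      intro c d
      simp [add_pow_char, add_mul, Finset.sum_add_distrib] }

lemma pComb_apply [DecidableEq ι] (x : ι → A) (c : (ι → Fin p) → A) :
    pComb p x c = ∑ α, c α ^ p * pMonomial x (fun i => α i) := by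
  unfold pComb
  simp only [AddMonoidHom.coe_mk, ZeroHom.coe_mk]
  congr!

/-- `x` is a `p`-basis of `A`: the monomials `x ^ α` with exponents less than `p` form a basis of
`A` over its subring of `p`-th powers. -/
def IsPBasis (x : ι → A) : Prop := Function.Bijective (pComb p x)

/-- The reduced exponent `n mod p`. -/
def redExp (n : ι → ℕ) : ι → Fin p :=
  fun i => ⟨n i % p, Nat.mod_lt _ (Fact.out : p.Prime).pos⟩

/-- The reduced exponent all of whose entries are `p - 1`. -/
def topExp : ι → Fin p := fun _ => ⟨p - 1, Nat.sub_lt (Fact.out : p.Prime).pos one_pos⟩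

lemma redExp_decomp (n : ι → ℕ) :
    n = (fun i => (redExp p n i : ℕ)) + p • (fun i => n i / p) := by
  ext i
  simp [redExp, Nat.mod_add_div]

variable {p}

namespace IsPBasis

variable {x : ι → A} (h : IsPBasis p x)

/-- The coefficients of an element with respect to a `p`-basis. -/
def coeff : A →+ ((ι → Fin p) → A) := (AddEquiv.ofBijective (pComb p x) h).symm

lemma coeff_pComb (c : (ι → Fin p) → A) : h.coeff (pComb p x c) = c :=
  (AddEquiv.ofBijective (pComb p x) h).symm_apply_apply c

lemma pComb_coeff (f : A) : pComb p x (h.coeff f) = f :=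
  (AddEquiv.ofBijective (pComb p x) h).apply_symm_apply f

/-- The exponents in `mono` are not required to be reduced, so the generators are closed under
multiplication; this is what makes the Leibniz rule checkable on them. -/
lemma induction (h : IsPBasis p x) {P : A → Prop} (zero : P 0)
    (add : ∀ f g, P f → P g → P (f + g)) (mono : ∀ (c : A) (n : ι → ℕ), P (c ^ p * pMonomial x n)) (f : A) : P f := by
  classical
  rw [← h.pComb_coeff f, pComb_apply]
  exact Finset.sum_induction _ P add zero fun α _ => mono _ _

/-- Division of each exponent by `p` with remainder moves the quotients into the coefficient. -/
lemma coeff_pow_mul_pMonomial [DecidableEq ι] (c : A) (n : ι → ℕ) :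
    h.coeff (c ^ p * pMonomial x n) =
      Pi.single (redExp p n) (c * pMonomial x (fun i => n i / p)) := by
  have : c ^ p * pMonomial x n =
      pComb p x (Pi.single (redExp p n) (c * pMonomial x (fun i => n i / p))) := by
    rw [pComb_apply, Finset.sum_eq_single (redExp p n)]
    · conv_lhs => rw [redExp_decomp p n, pMonomial_add, pMonomial_smul]
      simp only [Pi.single_eq_same]
      ring
    · intro α _ hα
      simp [hα, (Fact.out : p.Prime).ne_zero]
    · simp
  rw [this, h.coeff_pComb]

lemma coeff_pow_mul (r f : A) (α : ι → Fin p) : h.coeff (r ^ p * f) α = r * h.coeff f α := by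
  classical
  induction f using h.induction with
  | zero => simp
  | add f g hf hg => simp [mul_add, hf, hg]
  | mono c n =>
    rw [← mul_assoc, ← mul_pow, coeff_pow_mul_pMonomial, coeff_pow_mul_pMonomial]
    by_cases hα : α = redExp p n
    · subst hα; simp [mul_assoc]
    · simp [hα]

/-- The coefficient of the monomial with all exponents `p - 1`. -/
def theta : A →+ A := (Pi.evalAddMonoidHom (fun _ : ι → Fin p => A) (topExp p)).comp h.coeff

lemma theta_pow_mul (r f : A) : h.theta (r ^ p * f) = r * h.theta f := h.coeff_pow_mul r f _

lemma theta_pow_mul_pMonomial (c : A) (n : ι → ℕ) (hn : ∀ i, n i % p = p - 1) :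
    h.theta (c ^ p * pMonomial x n) = c * pMonomial x (fun i => n i / p) := by
  classical
  have : redExp p n = topExp p := by
    ext i; simp [redExp, topExp, hn]
  simp [theta, coeff_pow_mul_pMonomial, this]

lemma theta_pow_mul_pMonomial_of_ne (c : A) (n : ι → ℕ) (j : ι) (hj : n j % p ≠ p - 1) :
    h.theta (c ^ p * pMonomial x n) = 0 := by
  classical
  have : topExp p ≠ redExp p n := by
    intro e
    have := congrArg Fin.val (congrFun e j)
    simp only [redExp, topExp] at this
    exact hj this.symm
  simp [theta, coeff_pow_mul_pMonomial, this]

/-- The coefficients are recovered from `theta`. -/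
lemma theta_mul_compl (f : A) (α : ι → Fin p) :
    h.theta (f * pMonomial x (fun i => p - 1 - α i)) = h.coeff f α := by
  classical
  have hp := (Fact.out : p.Prime).pos
  conv_lhs => rw [← h.pComb_coeff f, pComb_apply, Finset.sum_mul, map_sum]
  -- The exponents `β i + (p - 1 - α i)` are all congruent to `p - 1` modulo `p` only for `β = α`.
  rw [Finset.sum_eq_single α]
  · rw [mul_assoc, ← pMonomial_add, h.theta_pow_mul_pMonomial]
    · have : (fun i => ((fun i => (α i : ℕ)) + fun i => p - 1 - (α i : ℕ)) i / p) = 0 := by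
        ext i
        have := (α i).2
        simp only [Pi.add_apply, Pi.zero_apply]
        exact Nat.div_eq_of_lt (by omega)
      rw [this]; simp
    · intro i
      have := (α i).2
      simp only [Pi.add_apply]
      rw [Nat.mod_eq_of_lt (by omega)]; omega
  · intro β _ hβ
    obtain ⟨j, hj⟩ := Function.ne_iff.mp hβ
    rw [mul_assoc, ← pMonomial_add]
    refine h.theta_pow_mul_pMonomial_of_ne _ _ j ?_
    have h1 := (α j).2
    have h2 := (β j).2
    have h3 : (β j : ℕ) ≠ α j := fun e => hj (Fin.ext e)
    simp only [Pi.add_apply]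
    by_cases hlt : (β j : ℕ) < α j
    · rw [Nat.mod_eq_of_lt (by omega)]; omega
    · have : (β j : ℕ) + (p - 1 - α j) = (β j - α j - 1) + p := by omega
      rw [this, Nat.add_mod_right, Nat.mod_eq_of_lt (by omega)]; omega
  · simp

end IsPBasis

/-! ### The derivations dual to a `p`-basis -/

/-- The exponent `n` with the `j`-th entry lowered by one. -/
def lowerExp [DecidableEq ι] (j : ι) (n : ι → ℕ) : ι → ℕ := Function.update n j (n j - 1)

lemma lowerExp_add_left [DecidableEq ι] {j : ι} {m : ι → ℕ} (n : ι → ℕ) (hm : m j ≠ 0) :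
    lowerExp j (m + n) = lowerExp j m + n := by
  ext i
  by_cases hi : i = j
  · subst hi; simp [lowerExp]; omega
  · simp [lowerExp, hi]

lemma lowerExp_add_right [DecidableEq ι] {j : ι} (m : ι → ℕ) {n : ι → ℕ} (hn : n j ≠ 0) :
    lowerExp j (m + n) = m + lowerExp j n := by
  rw [add_comm, lowerExp_add_left _ hn, add_comm]

namespace IsPBasis

variable [DecidableEq ι] {x : ι → A} (h : IsPBasis p x)

/-- The partial derivative, as an additive map. -/
def pderivAux (j : ι) : A →+ A where
  toFun f := ∑ α, h.coeff f α ^ p * ((α j : ℕ) * pMonomial x (lowerExp j (fun i => α i)))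
  map_zero' := by simp [(Fact.out : p.Prime).ne_zero]
  map_add' f g := by simp [add_pow_char, add_mul, Finset.sum_add_distrib]

lemma pderivAux_pow_mul_pMonomial (j : ι) (c : A) (n : ι → ℕ) :
    h.pderivAux j (c ^ p * pMonomial x n) =
      c ^ p * ((n j : A) * pMonomial x (lowerExp j n)) := by
  have hp := (Fact.out : p.Prime).ne_zero
  simp only [pderivAux, AddMonoidHom.coe_mk, ZeroHom.coe_mk]
  rw [Finset.sum_eq_single (redExp p n)]
  · rw [h.coeff_pow_mul_pMonomial, Pi.single_eq_same]
    have hcast : ((n j : ℕ) : A) = ((redExp p n j : ℕ) : A) := by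
      conv_lhs => rw [redExp_decomp p n]
      simp
    -- Lowering a multiple of `p` would borrow from the quotient part, but then the factor `n j` is
    -- zero in `A`.
    by_cases h0 : (redExp p n j : ℕ) = 0
    · rw [hcast, h0]; simp
    · have : lowerExp j n =
          lowerExp j (fun i => (redExp p n i : ℕ)) + p • (fun i => n i / p) := by
        conv_lhs => rw [redExp_decomp p n]
        rw [lowerExp_add_left (m := fun i => (redExp p n i : ℕ)) _ h0]
      rw [this, pMonomial_add, pMonomial_smul, hcast]
      ring
  · intro α _ hα
    rw [h.coeff_pow_mul_pMonomial]
    simp [hα, hp]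
  · simp

/-- The derivation `∂ / ∂ xⱼ`. -/
def pderiv (j : ι) : Derivation ℤ A A :=
  Derivation.mk' (h.pderivAux j).toIntLinearMap <| by
    intro f g
    simp only [AddMonoidHom.coe_toIntLinearMap, smul_eq_mul]
    induction f using h.induction with
    | zero => simp
    | add f₁ f₂ h₁ h₂ => rw [add_mul, map_add, h₁, h₂, map_add]; ring
    | mono c m =>
      induction g using h.induction with
      | zero => simp
      | add f₁ f₂ h₁ h₂ => rw [mul_add, map_add, h₁, h₂, map_add]; ring
      | mono d n =>
        have : c ^ p * pMonomial x m * (d ^ p * pMonomial x n) =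
            (c * d) ^ p * pMonomial x (m + n) := by rw [pMonomial_add]; ring
        rw [this]
        simp only [pderivAux_pow_mul_pMonomial]
        have e1 : ((m j : ℕ) : A) * pMonomial x (lowerExp j (m + n)) =
            (m j : A) * (pMonomial x (lowerExp j m) * pMonomial x n) := by
          by_cases h0 : m j = 0
          · simp [h0]
          · rw [lowerExp_add_left _ h0, pMonomial_add]
        have e2 : ((n j : ℕ) : A) * pMonomial x (lowerExp j (m + n)) =
            (n j : A) * (pMonomial x m * pMonomial x (lowerExp j n)) := by
          by_cases h0 : n j = 0
          · simp [h0]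
          · rw [lowerExp_add_right _ h0, pMonomial_add]
        simp only [Pi.add_apply, Nat.cast_add, add_mul, e1, e2]
        ring

lemma pderiv_pow_mul_pMonomial (j : ι) (c : A) (n : ι → ℕ) :
    h.pderiv j (c ^ p * pMonomial x n) = c ^ p * ((n j : A) * pMonomial x (lowerExp j n)) :=
  h.pderivAux_pow_mul_pMonomial j c n

lemma pderiv_self (j : ι) : h.pderiv j (x j) = 1 := by
  have := h.pderiv_pow_mul_pMonomial j 1 (Pi.single j 1)
  rw [pMonomial_single] at this
  have e : lowerExp j (Pi.single j 1) = 0 := by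
    ext i; by_cases hi : i = j
    · subst hi; simp [lowerExp]
    · simp [lowerExp, hi]
  simpa [e] using this

lemma pderiv_of_ne {i j : ι} (hij : i ≠ j) : h.pderiv j (x i) = 0 := by
  have := h.pderiv_pow_mul_pMonomial j 1 (Pi.single i 1)
  rw [pMonomial_single] at this
  simpa [Pi.single_apply, hij.symm] using this

/-- The Cartier operator kills exact forms: an exponent `n j - 1` congruent to `p - 1` forces `p ∣ n
j`, and then the derivative of the monomial is already zero. -/
lemma theta_pderiv (j : ι) (f : A) : h.theta (h.pderiv j f) = 0 := by
  have hp := (Fact.out : p.Prime)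
  induction f using h.induction with
  | zero => simp
  | add f g hf hg => simp [hf, hg]
  | mono c n =>
    rw [pderiv_pow_mul_pMonomial]
    by_cases h0 : (n j : A) = 0
    · simp [h0]
    have hn : ¬ p ∣ n j := fun hd => h0 ((CharP.cast_eq_zero_iff A p _).mpr hd)
    have : c ^ p * ((n j : A) * pMonomial x (lowerExp j n)) =
        n j • (c ^ p * pMonomial x (lowerExp j n)) := by
      rw [nsmul_eq_mul]; ring
    rw [this, map_nsmul, h.theta_pow_mul_pMonomial_of_ne _ _ j, smul_zero]
    simp only [lowerExp, Function.update_self]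
    intro e
    apply hn
    have h1 : n j ≠ 0 := fun e => hn (e ▸ dvd_zero p)
    have h2 := Nat.mod_add_div (n j - 1) p
    rw [e] at h2
    have := hp.pos
    exact ⟨(n j - 1) / p + 1, by rw [mul_add]; omega⟩

end IsPBasis

lemma derivation_pow_char {M : Type*} [AddCommGroup M] [Module A M] (D : Derivation ℤ A M)
    (c : A) : D (c ^ p) = 0 := by
  rw [Derivation.leibniz_pow, ← Nat.cast_smul_eq_nsmul A, CharP.cast_eq_zero, zero_smul]

lemma derivation_pMonomial [DecidableEq ι] {M : Type*} [AddCommGroup M] [Module A M]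
    (D : Derivation ℤ A M) (x : ι → A) (n : ι → ℕ) :
    D (pMonomial x n) = ∑ j, ((n j : A) * pMonomial x (lowerExp j n)) • D (x j) := by
  suffices ∀ s : Finset ι, D (∏ i ∈ s, x i ^ n i) =
      ∑ j ∈ s, ((n j : A) * ∏ i ∈ s, x i ^ lowerExp j n i) • D (x j) from this Finset.univ
  intro s
  induction s using Finset.induction_on with
  | empty => simp
  | insert a s ha ih =>
    rw [Finset.prod_insert ha, Derivation.leibniz, ih, Finset.sum_insert ha,
      Derivation.leibniz_pow, Finset.smul_sum, add_comm, Finset.prod_insert ha]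
    congr 1
    · have : ∏ i ∈ s, x i ^ lowerExp a n i = ∏ i ∈ s, x i ^ n i := by
        refine Finset.prod_congr rfl fun i hi => ?_
        have : i ≠ a := fun e => ha (e ▸ hi)
        simp [lowerExp, this]
      rw [this, ← Nat.cast_smul_eq_nsmul A, smul_smul, smul_smul]
      congr 1
      simp [lowerExp]; ring
    · refine Finset.sum_congr rfl fun j hj => ?_
      have : a ≠ j := fun e => ha (e ▸ hj)
      rw [smul_smul, Finset.prod_insert ha]
      congr 1
      simp [lowerExp, this]; ring

/-- The chain rule for a `p`-basis. -/
lemma IsPBasis.derivation_eq_sum [DecidableEq ι] {x : ι → A} (h : IsPBasis p x) {M : Type*}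
    [AddCommGroup M] [Module A M] (D : Derivation ℤ A M) (f : A) :
    D f = ∑ j, h.pderiv j f • D (x j) := by
  induction f using h.induction with
  | zero => simp
  | add f g hf hg => simp [hf, hg, add_smul, Finset.sum_add_distrib]
  | mono c n =>
    rw [Derivation.leibniz, derivation_pow_char (p := p), smul_zero, add_zero,
      derivation_pMonomial, Finset.smul_sum]
    refine Finset.sum_congr rfl fun j _ => ?_
    rw [h.pderiv_pow_mul_pMonomial, smul_smul]

end PBasis

/-! ### Change of `p`-basis -/

section ChangePBasis

variable {A : Type*} [CommRing A] {ι : Type*} [Fintype ι] [DecidableEq ι]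
variable {p : ℕ} [Fact p.Prime]

/-- The Witt polynomial `((z + w) ^ p - z ^ p - w ^ p) / p`. -/
def wittSum (p : ℕ) (z w : A) : A :=
  ∑ k ∈ Finset.range (p - 1), ((p.choose (k + 1) / p : ℕ) : A) * (z ^ (k + 1) * w ^ (p - 1 - k))

/-- Formally, this is `D` applied to `(z + w) ^ p = z ^ p + w ^ p + p * wittSum p z w` and divided
by `p`. Division by `p` makes no sense in `A`, so the identity is checked on binomial coefficients.
-/
lemma derivation_wittSum (D : Derivation ℤ A A) (z w : A) :
    (z + w) ^ (p - 1) * D (z + w) =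
      z ^ (p - 1) * D z + w ^ (p - 1) * D w + D (wittSum p z w) := by
  have hp := (Fact.out : p.Prime)
  obtain ⟨q, rfl⟩ : ∃ q, p = q + 1 := ⟨p - 1, (Nat.sub_add_cancel hp.pos).symm⟩
  have c1 : ∀ k < q, (q + 1).choose (k + 1) / (q + 1) * (k + 1) = q.choose k := by
    intro k hk
    obtain ⟨a, ha⟩ := hp.dvd_choose_self (Nat.succ_ne_zero k) (by omega)
    have h1 := Nat.add_one_mul_choose_eq q k
    rw [ha, Nat.mul_div_cancel_left _ (Nat.succ_pos q)]
    rw [ha, mul_assoc] at h1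
    exact (Nat.eq_of_mul_eq_mul_left (Nat.succ_pos q) h1).symm
  have c2 : ∀ k < q, (q + 1).choose (k + 1) / (q + 1) * (q - k) = q.choose (k + 1) := by
    intro k hk
    obtain ⟨a, ha⟩ := hp.dvd_choose_self (Nat.succ_ne_zero k) (by omega)
    have h1 := Nat.choose_mul_succ_eq q (k + 1)
    rw [ha, Nat.mul_div_cancel_left _ (Nat.succ_pos q)]
    rw [ha, mul_assoc, mul_comm] at h1
    have := Nat.eq_of_mul_eq_mul_left (Nat.succ_pos q) h1
    rw [this]; congr 1; omega
  simp only [Nat.add_sub_cancel, wittSum, map_sum, map_add]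
  have key : ∀ k ∈ Finset.range q,
      D ((((q + 1).choose (k + 1) / (q + 1) : ℕ) : A) * (z ^ (k + 1) * w ^ (q - k))) =
        z ^ k * w ^ (q - k) * (q.choose k : A) * D z +
          z ^ (k + 1) * w ^ (q - (k + 1)) * (q.choose (k + 1) : A) * D w := by
    intro k hk
    have hk := Finset.mem_range.mp hk
    rw [← c1 k hk, ← c2 k hk, Derivation.leibniz, Derivation.map_natCast, Derivation.leibniz,
      Derivation.leibniz_pow, Derivation.leibniz_pow]
    have : q - k - 1 = q - (k + 1) := by omega
    simp only [smul_eq_mul, nsmul_eq_mul, Nat.add_sub_cancel, this, Nat.cast_mul]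
    ring
  rw [Finset.sum_congr rfl key, Finset.sum_add_distrib, ← Finset.sum_mul, ← Finset.sum_mul,
    mul_add, add_pow]
  -- The sum multiplying `D z` lacks only its last term `z ^ q`, the sum multiplying `D w` only its
  -- first term `w ^ q`; these are the two extra summands.
  conv_lhs =>
    enter [1]
    rw [Finset.sum_range_succ]
  conv_lhs =>
    enter [2]
    rw [Finset.sum_range_succ']
  simp
  ring

variable [CharP A p]

/-- Modulo the image of `∂ⱼ`, the form `f ^ (p - 1) df` is `xⱼ ^ (p - 1) (∂ⱼ f) ^ p dxⱼ`. -/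
lemma IsPBasis.exists_pow_mul_pderiv_eq {x : ι → A} (h : IsPBasis p x) (j : ι) (f : A) :
    ∃ g, f ^ (p - 1) * h.pderiv j f = x j ^ (p - 1) * h.pderiv j f ^ p + h.pderiv j g := by
  have hp := (Fact.out : p.Prime)
  induction f using h.induction with
  | zero => exact ⟨0, by simp [hp.ne_zero]⟩
  | add f₁ f₂ h₁ h₂ =>
    obtain ⟨g₁, h₁⟩ := h₁
    obtain ⟨g₂, h₂⟩ := h₂
    -- The expression `f ^ (p - 1) * ∂ⱼ f` is additive up to `∂ⱼ` of the Witt polynomial.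
    refine ⟨g₁ + g₂ + wittSum p f₁ f₂, ?_⟩
    rw [derivation_wittSum, h₁, h₂]
    simp only [map_add, add_pow_char]
    ring
  | mono c n =>
    -- On monomials the identity is exact, since `n j ^ p = n j` in characteristic `p`.
    refine ⟨0, ?_⟩
    rw [map_zero, add_zero, h.pderiv_pow_mul_pMonomial]
    by_cases h0 : n j = 0
    · simp [h0, hp.ne_zero]
    have hn : n = Pi.single j 1 + lowerExp j n := by
      ext i
      by_cases hi : i = j
      · subst hi; simp [lowerExp]; omega
      · simp [lowerExp, hi]
    have hc : ((n j : ℕ) : A) ^ p = n j := by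
      have := map_natCast (frobenius A p) (n j)
      rwa [frobenius_def] at this
    have hm : pMonomial x n = x j * pMonomial x (lowerExp j n) := by
      conv_lhs => rw [hn, pMonomial_add, pMonomial_single, pow_one]
    rw [hm]
    simp only [mul_pow, hc]
    have : ∀ a : A, a ^ p = a ^ (p - 1) * a := fun a => by
      rw [← pow_succ, Nat.sub_add_cancel hp.pos]
    rw [this (pMonomial x _), this (c ^ p)]
    ring

lemma pMonomial_update (x : ι → A) (j : ι) (w : A) (n : ι → ℕ) :
    pMonomial (Function.update x j w) n = w ^ n j * pMonomial x (Function.update n j 0) := by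
  simp only [pMonomial]
  rw [← Finset.mul_prod_erase _ _ (Finset.mem_univ j),
    ← Finset.mul_prod_erase (a := j) (f := fun i => x i ^ _) _ (Finset.mem_univ j)]
  simp only [Function.update_self, pow_zero, one_mul]
  congr 1
  refine Finset.prod_congr rfl fun i hi => ?_
  have := Finset.ne_of_mem_erase hi
  simp [this]

variable {L : Type*} [Field L] [CharP L p]

namespace IsPBasis

variable {x : ι → L} (h : IsPBasis p x)

lemma pderiv_pMonomial_update_zero (j : ι) (n : ι → ℕ) :
    h.pderiv j (pMonomial x (Function.update n j 0)) = 0 := by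
  have := h.pderiv_pow_mul_pMonomial j 1 (Function.update n j 0)
  simpa using this

/-- With `w ^ n j = w ^ (p - 1) * (w ^ (n j / p)) ^ p`, every factor other than `w ^ (p - 1) * ∂ⱼ w`
is a constant for `∂ⱼ`, so `exists_pow_mul_pderiv_eq` for `w` can be multiplied by it. -/
lemma exists_pderiv_mul_update_eq (j : ι) (w c : L) (n : ι → ℕ) (hj : n j % p = p - 1) :
    ∃ g, h.pderiv j w * (c ^ p * pMonomial (Function.update x j w) n) =
      (c * w ^ (n j / p) * h.pderiv j w) ^ p * pMonomial x (Function.update n j (p - 1)) +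
        (c * w ^ (n j / p)) ^ p * h.pderiv j g := by
  set m := pMonomial x (Function.update n j 0) with hm
  have hm0 : h.pderiv j m = 0 := h.pderiv_pMonomial_update_zero j n
  obtain ⟨g, hg⟩ := h.exists_pow_mul_pderiv_eq j w
  have hnj : n j = p - 1 + p * (n j / p) := by
    rw [← hj]; exact (Nat.mod_add_div _ _).symm
  refine ⟨m * g, ?_⟩
  have e1 : pMonomial x (Function.update n j (p - 1)) = x j ^ (p - 1) * m := by
    have := pMonomial_update x j (x j) (Function.update n j (p - 1))
    simpa using this
  rw [pMonomial_update, ← hm, Derivation.leibniz, hm0, e1]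
  conv_lhs => rw [hnj, pow_add, pow_mul]
  have : h.pderiv j w * (c ^ p * (w ^ (p - 1) * (w ^ p) ^ (n j / p) * m)) =
    (w ^ (p - 1) * h.pderiv j w) * (c ^ p * (w ^ p) ^ (n j / p) * m) := by ring
  rw [this, hg]
  simp only [smul_eq_mul, mul_zero, add_zero]
  ring

/-- If the exponent of `w` is not `p - 1` modulo `p`, then `n j + 1` is invertible and `w ^ n j * ∂ⱼ
w` is `∂ⱼ` of `w ^ (n j + 1) / (n j + 1)`. Otherwise the previous formula leaves, up to an exact
term, a monomial in `x` with another exponent not congruent to `p - 1`. -/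
lemma theta_pderiv_mul_update_of_ne (j : ι) (w c : L) (n : ι → ℕ)
    (hn : ∃ i, n i % p ≠ p - 1) :
    h.theta (h.pderiv j w * (c ^ p * pMonomial (Function.update x j w) n)) = 0 := by
  have hp := (Fact.out : p.Prime)
  set m := pMonomial x (Function.update n j 0) with hm
  have hm0 : h.pderiv j m = 0 := h.pderiv_pMonomial_update_zero j n
  by_cases hj : n j % p = p - 1
  · obtain ⟨i, hi⟩ := hn
    have hij : i ≠ j := fun e => hi (e ▸ hj)
    obtain ⟨g, e⟩ := h.exists_pderiv_mul_update_eq j w c n hj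
    rw [e, map_add, h.theta_pow_mul _ (h.pderiv j g), h.theta_pderiv, mul_zero, add_zero]
    exact h.theta_pow_mul_pMonomial_of_ne _ _ i (by simpa [hij] using hi)
  · have hne : ((n j + 1 : ℕ) : L) ≠ 0 := by
      intro e
      have hd := (CharP.cast_eq_zero_iff L p _).mp e
      apply hj
      have : (n j + 1) % p = 0 := Nat.mod_eq_zero_of_dvd hd
      have h1 := Nat.mod_add_div (n j) p
      have h2 := Nat.mod_lt (n j) hp.pos
      have h3 : n j % p + 1 = p := by
        obtain ⟨k, hk⟩ := hd
        have : p ∣ n j % p + 1 := by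
          have : n j % p + 1 = (n j + 1) - p * (n j / p) := by omega
          rw [this, hk]; exact Nat.dvd_sub (dvd_mul_right _ _) (dvd_mul_right _ _)
        have := Nat.le_of_dvd (Nat.succ_pos _) this
        omega
      omega
    have e : h.pderiv j w * (c ^ p * pMonomial (Function.update x j w) n) =
        (c ^ p) * h.pderiv j (((n j + 1 : ℕ) : L)⁻¹ * (m * w ^ (n j + 1))) := by
      have hz : h.pderiv j (((n j + 1 : ℕ) : L)⁻¹) = 0 := by
        rw [Derivation.leibniz_inv, Derivation.map_natCast, smul_zero]
      rw [pMonomial_update, ← hm, Derivation.leibniz, hz, Derivation.leibniz, hm0,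
        Derivation.leibniz_pow]
      simp only [smul_eq_mul, nsmul_eq_mul, Nat.add_sub_cancel, mul_zero, add_zero]
      field_simp
    rw [e, h.theta_pow_mul, h.theta_pderiv, mul_zero]

/-- Together with the vanishing case, this shows that `f ↦ h.theta (∂ⱼ w * f)` acts on monomials of
the modified family as its own `theta` should, up to the factor `∂ⱼ w`. It is proved before the
modified family is known to be a `p`-basis. -/
lemma theta_pderiv_mul_update (j : ι) (w c : L) (n : ι → ℕ) (hn : ∀ i, n i % p = p - 1) :
    h.theta (h.pderiv j w * (c ^ p * pMonomial (Function.update x j w) n)) =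
      h.pderiv j w * (c * pMonomial (Function.update x j w) (fun i => n i / p)) := by
  have hp := (Fact.out : p.Prime)
  obtain ⟨g, e⟩ := h.exists_pderiv_mul_update_eq j w c n (hn j)
  rw [e, map_add, h.theta_pow_mul _ (h.pderiv j _), h.theta_pderiv, mul_zero, add_zero,
    h.theta_pow_mul_pMonomial, pMonomial_update]
  · have : (fun i => Function.update n j (p - 1) i / p) =
        Function.update (fun i => n i / p) j 0 := by
      ext i
      by_cases hi : i = j
      · subst hi
        simp only [Function.update_self]
        exact Nat.div_eq_of_lt (Nat.sub_lt hp.pos one_pos)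
      · simp [hi]
    rw [this]; ring
  · intro i
    by_cases hi : i = j
    · subst hi
      simp only [Function.update_self]
      exact Nat.mod_eq_of_lt (Nat.sub_lt hp.pos one_pos)
    · simpa [hi] using hn i

/-- A family as large as a `p`-basis is a `p`-basis once its monomials are independent. -/
lemma of_injective (h : IsPBasis p x) {z : ι → L} (hz : Function.Injective (pComb p z)) : IsPBasis p z := by
  -- `pComb` raises scalars to the power `p` and `coeff` takes the root again, so the composite is
  -- linear and a dimension count applies.
  let T : ((ι → Fin p) → L) →ₗ[L] ((ι → Fin p) → L) :=
    { toFun := fun c => h.coeff (pComb p z c)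
      map_add' := by simp
      map_smul' := by
        intro r c
        ext α
        have : pComb p z (r • c) = r ^ p * pComb p z c := by
          simp [pComb_apply, Finset.mul_sum, mul_pow, mul_assoc]
        simp [this, h.coeff_pow_mul] }
  have hc : Function.Bijective h.coeff := (AddEquiv.ofBijective (pComb p x) h).symm.bijective
  have hT : Function.Injective T := hc.1.comp hz
  have hT' : Function.Surjective T := LinearMap.injective_iff_surjective.mp hT
  refine ⟨hz, fun f => ?_⟩
  obtain ⟨c, hcT⟩ := hT' (h.coeff f)
  exact ⟨c, hc.1 hcT⟩

/-- Exchanging one element of a `p`-basis. -/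
lemma update (j : ι) (w : L) (hw : h.pderiv j w ≠ 0) : IsPBasis p (Function.update x j w) := by
  refine h.of_injective ((injective_iff_map_eq_zero _).mpr fun c hc => ?_)
  ext β
  have hp := (Fact.out : p.Prime)
  -- Multiplication by the monomial complementary to `β` isolates the coefficient `c β` of the
  -- relation.
  have h1 : h.theta (h.pderiv j w * (pComb p (Function.update x j w) c *
      pMonomial (Function.update x j w) (fun i => p - 1 - β i))) = 0 := by
    rw [hc]; simp
  rw [pComb_apply, Finset.sum_mul, Finset.mul_sum, map_sum, Finset.sum_eq_single β] at h1
  · rw [mul_assoc, ← pMonomial_add, theta_pderiv_mul_update] at h1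
    · have e : (fun i => ((fun i => (β i : ℕ)) + fun i => p - 1 - (β i : ℕ)) i / p) = 0 := by
        ext i
        have := (β i).2
        simp only [Pi.add_apply, Pi.zero_apply]
        exact Nat.div_eq_of_lt (by omega)
      rw [e] at h1
      simpa [hw] using h1
    · intro i
      have := (β i).2
      simp only [Pi.add_apply]
      rw [Nat.mod_eq_of_lt (by omega)]; omega
  · intro α _ hα
    obtain ⟨i, hi⟩ := Function.ne_iff.mp hα
    rw [mul_assoc, ← pMonomial_add]
    refine h.theta_pderiv_mul_update_of_ne _ _ _ _ ⟨i, ?_⟩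
    have h1 := (α i).2
    have h2 := (β i).2
    have h3 : (α i : ℕ) ≠ β i := fun e => hi (Fin.ext e)
    simp only [Pi.add_apply]
    by_cases hlt : (α i : ℕ) < β i
    · rw [Nat.mod_eq_of_lt (by omega)]; omega
    · have : (α i : ℕ) + (p - 1 - β i) = (α i - β i - 1) + p := by omega
      rw [this, Nat.add_mod_right, Nat.mod_eq_of_lt (by omega)]; omega
  · simp

/-- Change of variables for the exchange of one element, whose Jacobian determinant is `∂ⱼ w`. -/
lemma theta_update_mul (j : ι) (w : L) (h' : IsPBasis p (Function.update x j w)) (f : L) :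
    h'.theta f * h.pderiv j w = h.theta (h.pderiv j w * f) := by
  induction f using h'.induction with
  | zero => simp
  | add f g hf hg => simp [add_mul, mul_add, hf, hg]
  | mono c n =>
    by_cases hn : ∀ i, n i % p = p - 1
    · rw [h'.theta_pow_mul_pMonomial _ _ hn, h.theta_pderiv_mul_update _ _ _ _ hn, mul_comm]
    · push Not at hn
      rw [h.theta_pderiv_mul_update_of_ne _ _ _ _ hn]
      obtain ⟨i, hi⟩ := hn
      rw [h'.theta_pow_mul_pMonomial_of_ne _ _ i hi, zero_mul]

/-- The Jacobian matrix of a family with respect to a `p`-basis. -/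
def jacobian (z : ι → L) : Matrix ι ι L := Matrix.of fun i j => h.pderiv j (z i)

/-- The chain rule; on determinants it makes Jacobians multiplicative along successive exchanges. -/
lemma jacobian_mul {z : ι → L} (hz : IsPBasis p z) (w : ι → L) :
    hz.jacobian w * h.jacobian z = h.jacobian w := by
  ext i j
  simp only [Matrix.mul_apply, jacobian, Matrix.of_apply]
  exact (hz.derivation_eq_sum (h.pderiv j) (w i)).symm

lemma jacobian_self : h.jacobian x = 1 := by
  ext i j
  by_cases hij : i = j
  · subst hij; simp [jacobian, h.pderiv_self]
  · simp [jacobian, h.pderiv_of_ne hij, hij]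

lemma det_jacobian_ne_zero {z : ι → L} (hz : IsPBasis p z) : (h.jacobian z).det ≠ 0 := by
  have := congrArg Matrix.det (h.jacobian_mul hz x)
  rw [Matrix.det_mul, h.jacobian_self, Matrix.det_one] at this
  exact right_ne_zero_of_mul_eq_one this

lemma det_jacobian_update (j : ι) (w : L) :
    (h.jacobian (Function.update x j w)).det = h.pderiv j w := by
  have e : h.jacobian (Function.update x j w) =
      (1 : Matrix ι ι L).updateRow j (fun k => h.pderiv k w) := by
    ext a b
    by_cases ha : a = j
    · subst ha; simp [jacobian]
    · rw [Matrix.updateRow_ne ha, ← h.jacobian_self]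
      simp [jacobian, ha]
  have e2 : (fun k => h.pderiv k w) =
      ∑ k, h.pderiv k w • (1 : Matrix ι ι L) k := by
    ext b
    simp [Matrix.one_apply]
  rw [e, e2, Matrix.det_updateRow_sum]
  simp

lemma injective (h : IsPBasis p x) : Function.Injective x := by
  intro i j hij
  by_contra hne
  have h1 := h.pderiv_self i
  rw [hij, h.pderiv_of_ne (fun e => hne e.symm)] at h1
  exact zero_ne_one h1

/-- The change of variables formula for the Cartier operator. -/
theorem theta_mul_det_jacobian {z : ι → L} (hz : IsPBasis p z) (f : L) :
    hz.theta f * (h.jacobian z).det = h.theta ((h.jacobian z).det * f) := by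
  classical
  -- Induction on the number of elements of `z` foreign to `x`; an exchange removes one of them.
  induction hm : (Finset.univ.filter fun i => z i ∉ Set.range x).card using Nat.strong_induction_on
    generalizing z f with
  | _ m ih =>
  by_cases hall : ∀ i, z i ∈ Set.range x
  -- Here `z` is a permutation of `x`: `theta` is unchanged and the Jacobian determinant is a sign.
  · choose σ hσ using hall
    have hσi : Function.Injective σ := by
      intro a b hab
      apply hz.injective
      rw [← hσ a, ← hσ b, hab]
    let τ : Equiv.Perm ι := Equiv.ofBijective σ (Finite.injective_iff_bijective.mp hσi)
    have hzx : z = fun i => x (τ i) := by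
      ext i; exact (hσ i).symm
    subst hzx
    have hdet : (h.jacobian fun i => x (τ i)).det = ((Equiv.Perm.sign τ : ℤ) : L) := by
      have : (h.jacobian fun i => x (τ i)) = (1 : Matrix ι ι L).submatrix τ id := by
        rw [← h.jacobian_self]; rfl
      rw [this, Matrix.det_permute]
      simp
    have hth : hz.theta f = h.theta f := by
      have hmon : ∀ n : ι → ℕ,
          pMonomial (fun i => x (τ i)) n = pMonomial x (fun i => n (τ.symm i)) := by
        intro n
        simp only [pMonomial]
        exact Fintype.prod_equiv τ _ _ (fun i => by simp)
      induction f using hz.induction with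
      | zero => simp
      | add f g hf hg => simp [hf, hg]
      | mono c n =>
        by_cases hn : ∀ i, n i % p = p - 1
        · rw [hz.theta_pow_mul_pMonomial _ _ hn, hmon, hmon,
            h.theta_pow_mul_pMonomial _ _ (fun i => hn _)]
        · push Not at hn
          obtain ⟨i, hi⟩ := hn
          rw [hz.theta_pow_mul_pMonomial_of_ne _ _ i hi, hmon,
            h.theta_pow_mul_pMonomial_of_ne _ _ (τ i) (by simpa using hi)]
    rw [hdet, hth, ← zsmul_eq_mul, map_zsmul, zsmul_eq_mul, mul_comm]
  · push Not at hall
    obtain ⟨i, hi⟩ := hall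
    -- If all of these vanished, the chain rule through `x` would give `hz.pderiv i (z i) = 0`.
    obtain ⟨k, hk⟩ : ∃ k, hz.pderiv i (x k) ≠ 0 := by
      by_contra! hcon
      have h1 := hz.pderiv_self i
      rw [h.derivation_eq_sum (hz.pderiv i)] at h1
      simp [hcon] at h1
    have hz' := hz.update i (x k) hk
    have hlt : (Finset.univ.filter fun a => Function.update z i (x k) a ∉ Set.range x).card < m := by
      rw [← hm]
      apply Finset.card_lt_card
      rw [Finset.ssubset_iff_of_subset]
      · exact ⟨i, by simpa using hi, by simp⟩
      · intro a ha
        by_cases hai : a = i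
        · subst hai; simpa using hi
        · simpa [hai] using ha
    -- The inverse factor absorbs the Jacobian of the single exchange.
    have h1 := ih _ hlt hz' ((hz.pderiv i (x k))⁻¹ * f) rfl
    have h2 := hz.theta_update_mul i (x k) hz' ((hz.pderiv i (x k))⁻¹ * f)
    have h3 : (h.jacobian (Function.update z i (x k))).det =
        hz.pderiv i (x k) * (h.jacobian z).det := by
      rw [← h.jacobian_mul hz, Matrix.det_mul, hz.det_jacobian_update]
    rw [h3, ← mul_assoc, h2, mul_inv_cancel_left₀ hk] at h1
    rw [h1]
    congr 1
    field_simp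

end IsPBasis

end ChangePBasis

/-! ### Existence of `p`-bases -/

section Existence

variable {p : ℕ} [Fact p.Prime]

/-- `A` is finite over its subring of `p`-th powers. -/
def FrobeniusFinite (p : ℕ) (A : Type*) [CommRing A] : Prop :=
  ∃ (n : ℕ) (γ : Fin n → A), ∀ a, ∃ c : Fin n → A, a = ∑ i, c i ^ p * γ i

lemma FrobeniusFinite.of_surjective {A B : Type*} [CommRing A] [CommRing B]
    (h : FrobeniusFinite p A) (f : A →+* B) (hf : Function.Surjective f) :
    FrobeniusFinite p B := by
  obtain ⟨n, γ, h⟩ := h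
  refine ⟨n, fun i => f (γ i), fun b => ?_⟩
  obtain ⟨a, rfl⟩ := hf b
  obtain ⟨c, hc⟩ := h a
  refine ⟨fun i => f (c i), ?_⟩
  conv_lhs => rw [hc]
  simp

lemma FrobeniusFinite.of_isLocalization {A B : Type*} [CommRing A] [CommRing B] [Algebra A B]
    (M : Submonoid A) [IsLocalization M B] (h : FrobeniusFinite p A) : FrobeniusFinite p B := by
  have hp := (Fact.out : p.Prime)
  obtain ⟨n, γ, h⟩ := h
  refine ⟨n, fun i => algebraMap A B (γ i), fun b => ?_⟩
  obtain ⟨a, s, rfl⟩ := IsLocalization.exists_mk'_eq M b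
  -- The fraction is rewritten as `a / s = (a * s ^ (p - 1)) / s ^ p`, whose denominator is a `p`-th
  -- power.
  obtain ⟨c, hc⟩ := h (a * s ^ (p - 1))
  refine ⟨fun i => IsLocalization.mk' B (c i) s, ?_⟩
  rw [IsLocalization.mk'_eq_iff_eq_mul]
  have hu : IsUnit (algebraMap A B (s : A) ^ (p - 1)) :=
    (IsLocalization.map_units B s).pow _
  apply hu.mul_right_cancel
  rw [← map_pow, ← map_mul, hc, map_sum, map_pow, mul_assoc, ← pow_succ',
    Nat.sub_add_cancel hp.pos, Finset.sum_mul]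
  refine Finset.sum_congr rfl fun i _ => ?_
  rw [map_mul, map_pow, ← IsLocalization.mk'_spec B (c i) s]
  ring

lemma IsPBasis.reindex {A : Type*} [CommRing A] [CharP A p] {ι κ : Type*} [Fintype ι] [Fintype κ]
    {x : ι → A} (h : IsPBasis p x) (e : κ ≃ ι) : IsPBasis p (fun i => x (e i)) := by
  classical
  have : (pComb p fun i => x (e i) : ((κ → Fin p) → A) → A) =
      pComb p x ∘ (Equiv.arrowCongr (Equiv.arrowCongr e (Equiv.refl (Fin p))) (Equiv.refl A)) := by
    ext c
    simp only [Function.comp_apply, pComb_apply]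
    refine Fintype.sum_equiv (Equiv.arrowCongr e (Equiv.refl (Fin p))) _ _ fun α => ?_
    congr 1
    · simp [Equiv.arrowCongr, Function.comp_def]
    · simp only [pMonomial]
      exact Fintype.prod_equiv e _ _ fun i => by simp [Equiv.arrowCongr]
  rw [IsPBasis, this]
  exact h.comp (Equiv.bijective _)

lemma pMonomial_option {A : Type*} [CommRing A] {ι : Type*} [Fintype ι] (x : Option ι → A)
    (n : Option ι → ℕ) :
    pMonomial x n = x none ^ n none * pMonomial (fun i => x (some i)) (fun i => n (some i)) := by
  simp [pMonomial, Fintype.prod_option]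

/-- A finite purely inseparable field extension of exponent one has a basis of reduced
monomials. -/
lemma exists_basis_pMonomial {k : Type u} [Field k] [CharP k p] (m : ℕ) :
    ∀ (F : Type u) [Field F] [Algebra F k] [FiniteDimensional F k]
      (_ : ∀ a : k, ∃ b : F, algebraMap F k b = a ^ p) (_ : Module.finrank F k = m),
    ∃ (ι : Type) (_ : Fintype ι) (w : ι → k) (b : Module.Basis (ι → Fin p) F k),
      ∀ α, b α = pMonomial w (fun i => α i) := by
  have hp := (Fact.out : p.Prime)
  induction m using Nat.strong_induction_on with
  | _ m ih =>
  intro F _ _ _ hF hm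
  by_cases htop : Function.Surjective (algebraMap F k)
  · let e : F ≃ₗ[F] k := LinearEquiv.ofBijective (Algebra.linearMap F k)
      ⟨(algebraMap F k).injective, htop⟩
    refine ⟨Empty, inferInstance, Empty.elim,
      (Module.Basis.singleton (Empty → Fin p) F).map e, fun α => ?_⟩
    have : e 1 = 1 := map_one (algebraMap F k)
    simp [this, pMonomial]
  · rw [Function.Surjective] at htop
    push Not at htop
    obtain ⟨w, hw⟩ := htop
    obtain ⟨a, ha⟩ := hF w
    -- Thus `w` has degree `p` over `F`, its powers below `p` form a basis of `F(w)`, and the tower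
    -- basis over the induction hypothesis for `F(w)` adds `w` as one more variable.
    have hirr : Irreducible (Polynomial.X ^ p - Polynomial.C a : Polynomial F) := by
      rw [X_pow_sub_C_irreducible_iff_of_prime hp]
      intro b hb
      apply hw b
      apply frobenius_inj k p
      rw [frobenius_def, frobenius_def, ← map_pow, hb, ha]
    have hIntegral : IsIntegral F w := Algebra.IsIntegral.isIntegral w
    have hmin : minpoly F w = Polynomial.X ^ p - Polynomial.C a := by
      refine (minpoly.eq_of_irreducible_of_monic hirr ?_
        (Polynomial.monic_X_pow_sub_C a hp.ne_zero)).symm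
      simp [ha]
    let F' := IntermediateField.adjoin F {w}
    let pb := IntermediateField.adjoin.powerBasis hIntegral
    have hdim : pb.dim = p := by
      rw [IntermediateField.adjoin.powerBasis_dim, hmin, Polynomial.natDegree_X_pow_sub_C]
    have hmul : p * Module.finrank F' k = m := by
      rw [← hm, ← Module.finrank_mul_finrank F F' k, ← hdim, pb.finrank]
    have hpos : 0 < Module.finrank F' k := Module.finrank_pos
    have hlt : Module.finrank F' k < m := by
      rw [← hmul]
      nlinarith [hp.two_le]
    obtain ⟨ι, _, v, b, hb⟩ := ih _ hlt F' (fun x => by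
      obtain ⟨y, hy⟩ := hF x
      exact ⟨algebraMap F F' y, by rw [← hy]; rfl⟩) rfl
    let b0 : Module.Basis (Fin p) F F' := pb.basis.reindex (finCongr hdim)
    refine ⟨Option ι, inferInstance, fun o => o.elim w v,
      (b0.smulTower b).reindex (Equiv.piOptionEquivProd (β := fun _ => Fin p)).symm, fun α => ?_⟩
    rw [Module.Basis.reindex_apply, Module.Basis.smulTower_apply, hb, pMonomial_option,
      IntermediateField.smul_def]
    simp [b0, pb, Equiv.piOptionEquivProd]

/-- The monomial basis is taken over the subfield of `p`-th powers, whose elements have unique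
`p`-th roots in `k`. -/
lemma exists_isPBasis_of_field {k : Type u} [Field k] [CharP k p] (hk : FrobeniusFinite p k) :
    ∃ (ι : Type) (_ : Fintype ι) (w : ι → k), IsPBasis p w := by
  classical
  have hp := (Fact.out : p.Prime)
  let F := (frobenius k p).fieldRange
  have hfd : FiniteDimensional F k := by
    obtain ⟨n, γ, h⟩ := hk
    refine ⟨⟨Finset.univ.image γ, ?_⟩⟩
    rw [eq_top_iff]
    rintro a -
    obtain ⟨c, hc⟩ := h a
    rw [hc]
    refine Submodule.sum_mem _ fun i _ => ?_
    have : c i ^ p * γ i = (⟨c i ^ p, ⟨c i, rfl⟩⟩ : F) • γ i := rfl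
    rw [this]
    exact Submodule.smul_mem _ _ (Submodule.subset_span (by simp))
  obtain ⟨ι, _, w, b, hb⟩ := exists_basis_pMonomial (p := p) (k := k) _ F
    (fun a => ⟨⟨a ^ p, ⟨a, rfl⟩⟩, rfl⟩) rfl
  refine ⟨ι, inferInstance, w, (injective_iff_map_eq_zero _).mpr fun c hc => ?_, fun f => ?_⟩
  · rw [pComb_apply] at hc
    have h1 : ∑ α, (⟨c α ^ p, ⟨c α, rfl⟩⟩ : F) • b α = 0 := by
      rw [← hc]
      exact Finset.sum_congr rfl fun α _ => by rw [hb]; rfl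
    have h2 := Fintype.linearIndependent_iff.mp b.linearIndependent _ h1
    ext α
    have h3 := congrArg Subtype.val (h2 α)
    exact pow_eq_zero_iff hp.ne_zero |>.mp h3
  · choose c hc using fun α => (b.repr f α).2
    refine ⟨c, ?_⟩
    rw [pComb_apply]
    conv_rhs => rw [← b.sum_repr f]
    refine Finset.sum_congr rfl fun α _ => ?_
    rw [hb, Subfield.smul_def, smul_eq_mul, ← hc]
    rfl

/-- A common denominator `s` of the coefficients leaves `pComb` as the factor `s ^ p`, and each
fraction can be given a `p`-th power as denominator. -/
lemma IsPBasis.isFractionRing {A K : Type*} [CommRing A] [IsDomain A] [Field K] [Algebra A K]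
    [IsFractionRing A K] [CharP A p] [CharP K p] {ι : Type*} [Fintype ι] {x : ι → A}
    (h : IsPBasis p x) : IsPBasis p (fun i => algebraMap A K (x i)) := by
  classical
  have hp := (Fact.out : p.Prime)
  have hmap : ∀ c : (ι → Fin p) → A,
      algebraMap A K (pComb p x c) =
        pComb p (fun i => algebraMap A K (x i)) (fun α => algebraMap A K (c α)) := by
    intro c
    simp [pComb_apply, map_pMonomial]
  have hsmul : ∀ (s : K) (c : (ι → Fin p) → K),
      pComb p (fun i => algebraMap A K (x i)) (fun α => s * c α) =
        s ^ p * pComb p (fun i => algebraMap A K (x i)) c := by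
    intro s c
    simp [pComb_apply, Finset.mul_sum, mul_pow, mul_assoc]
  refine ⟨(injective_iff_map_eq_zero _).mpr fun c hc => ?_, fun f => ?_⟩
  · obtain ⟨s, hs⟩ := IsLocalization.exist_integer_multiples_of_finite (nonZeroDivisors A) c
    choose a ha using hs
    have hs0 : algebraMap A K s ≠ 0 := by
      simp
    have ha' : ∀ α, algebraMap A K (a α) = algebraMap A K s * c α := by
      intro α; rw [ha, Algebra.smul_def]
    have h1 : algebraMap A K (pComb p x a) = 0 := by
      rw [hmap]; simp_rw [ha']; rw [hsmul, hc, mul_zero]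
    have h2 : pComb p x a = pComb p x 0 := by
      rw [map_zero]; exact (map_eq_zero_iff _ (IsFractionRing.injective A K)).mp h1
    have h3 := h.1 h2
    ext α
    have h4 := ha' α
    rw [h3] at h4
    simpa [hs0] using h4.symm
  · obtain ⟨a, s, hs, rfl⟩ := IsFractionRing.div_surjective (A := A) f
    have hs0 : algebraMap A K s ≠ 0 := by
      simpa using nonZeroDivisors.ne_zero hs
    obtain ⟨c, hc⟩ := h.2 (a * s ^ (p - 1))
    refine ⟨fun α => (algebraMap A K s)⁻¹ * algebraMap A K (c α), ?_⟩
    rw [hsmul, ← hmap, hc]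
    have : algebraMap A K s ^ p = algebraMap A K s ^ (p - 1) * algebraMap A K s := by
      rw [← pow_succ, Nat.sub_add_cancel hp.pos]
    rw [inv_pow, this]
    simp only [map_mul, map_pow]
    field_simp

/-- By separability the `p`-th powers of a `K`-basis of `L` again form a `K`-basis. In coordinates
with respect to the two bases, `pComb` over `L` becomes copies of `pComb` over `K`. -/
lemma IsPBasis.of_isSeparable {K L : Type*} [Field K] [Field L] [Algebra K L]
    [FiniteDimensional K L] [Algebra.IsSeparable K L] [CharP K p] [CharP L p] {ι : Type*}
    [Fintype ι] {x : ι → K} (h : IsPBasis p x) : IsPBasis p (fun i => algebraMap K L (x i)) := by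
  classical
  have hp := (Fact.out : p.Prime)
  have : ExpChar K p := ExpChar.prime hp
  let b := Module.finBasis K L
  let b' := b.mapPowExpCharPowOfIsSeparable p 1
  have hb' : ∀ i, b' i = b i ^ p := by
    intro i; simp [b', Module.Basis.mapPowExpCharPowOfIsSeparable]
  have key : ∀ c : Fin (Module.finrank K L) → (ι → Fin p) → K,
      pComb p (fun i => algebraMap K L (x i)) (fun α => ∑ j, c j α • b j) =
        ∑ j, pComb p x (c j) • b' j := by
    intro c
    simp only [pComb_apply, sum_pow_char, Finset.sum_mul, Finset.sum_smul, hb']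
    rw [Finset.sum_comm]
    refine Finset.sum_congr rfl fun j _ => Finset.sum_congr rfl fun α _ => ?_
    simp only [Algebra.smul_def, map_mul, map_pow, map_pMonomial]
    ring
  refine ⟨(injective_iff_map_eq_zero _).mpr fun c hc => ?_, fun f => ?_⟩
  · have h1 := key (fun j α => b.repr (c α) j)
    simp only [b.sum_repr] at h1
    rw [hc] at h1
    have h2 := Fintype.linearIndependent_iff.mp b'.linearIndependent _ h1.symm
    ext α
    rw [Pi.zero_apply, ← b.sum_repr (c α)]
    refine Finset.sum_eq_zero fun j _ => ?_
    have h3 := (injective_iff_map_eq_zero _).mp h.1 _ (h2 j)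
    rw [show b.repr (c α) j = 0 from congrFun h3 α, zero_smul]
  · choose c hc using fun j => h.2 (b'.repr f j)
    refine ⟨fun α => ∑ j, c j α • b j, ?_⟩
    rw [key]
    simp only [hc]
    exact b'.sum_repr f

end Existence

/-! ### The order function of a discrete valuation ring -/

section Vord

variable (V : Type*) [CommRing V] [IsDomain V] [IsDiscreteValuationRing V]
variable {K : Type*} [Field K] [Algebra V K] [IsFractionRing V K]

/-- The order of an element of the fraction field of a discrete valuation ring; zero has
order `0`. -/
def vord (f : K) : ℤ := Multiplicative.toAdd ((Ring.ordFrac V f).unzeroD 1)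

variable {V}

lemma ordFrac_eq_exp_vord {f : K} (hf : f ≠ 0) : Ring.ordFrac V f = WithZero.exp (vord V f) := by
  have h0 : Ring.ordFrac V f ≠ 0 := (map_ne_zero _).mpr hf
  rw [vord, WithZero.unzeroD_eq_unzero h0, WithZero.exp_eq_coe_ofAdd, ofAdd_toAdd,
    WithZero.coe_unzero]

lemma vord_eq_iff {f : K} (hf : f ≠ 0) {n : ℤ} :
    vord V f = n ↔ Ring.ordFrac V f = WithZero.exp n := by
  rw [ordFrac_eq_exp_vord hf, WithZero.exp_inj]

lemma vord_mul {f g : K} (hf : f ≠ 0) (hg : g ≠ 0) :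
    vord V (f * g) = vord V f + vord V g := by
  rw [vord_eq_iff (mul_ne_zero hf hg), map_mul, ordFrac_eq_exp_vord hf, ordFrac_eq_exp_vord hg,
    WithZero.exp_add]

lemma vord_algebraMap_of_isUnit {v : V} (hv : IsUnit v) : vord V (algebraMap V K v) = 0 := by
  rw [vord_eq_iff, Ring.ordFrac_of_isUnit hv, WithZero.exp_zero]
  exact (hv.map _).ne_zero

@[simp]
lemma vord_one : vord V (1 : K) = 0 := by
  simpa using vord_algebraMap_of_isUnit (K := K) (isUnit_one (M := V))

lemma vord_uniformizer {ϖ : V} (hϖ : Irreducible ϖ) : vord V (algebraMap V K ϖ) = 1 := by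
  rw [vord_eq_iff, Ring.ordFrac_irreducible hϖ]
  simpa using hϖ.ne_zero

lemma vord_inv {f : K} (hf : f ≠ 0) : vord V f⁻¹ = - vord V f := by
  have := vord_mul (V := V) hf (inv_ne_zero hf)
  rw [mul_inv_cancel₀ hf, vord_one] at this
  linarith

lemma vord_pow {f : K} (hf : f ≠ 0) (n : ℕ) : vord V (f ^ n) = n * vord V f := by
  induction n with
  | zero => simp
  | succ n ih => rw [pow_succ, vord_mul (pow_ne_zero _ hf) hf, ih]; push_cast; ring

lemma vord_zpow {f : K} (hf : f ≠ 0) (n : ℤ) : vord V (f ^ n) = n * vord V f := by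
  cases n with
  | ofNat n => simpa using vord_pow hf n
  | negSucc n =>
    rw [zpow_negSucc, vord_inv (pow_ne_zero _ hf), vord_pow hf, Int.negSucc_eq]
    push_cast; ring

lemma exists_unit_mul_zpow {ϖ : V} (hϖ : Irreducible ϖ) {f : K} (hf : f ≠ 0) :
    ∃ v : Vˣ, f = algebraMap V K v * algebraMap V K ϖ ^ vord V f := by
  have hϖ0 : algebraMap V K ϖ ≠ 0 := by simpa using hϖ.ne_zero
  obtain ⟨v, hv⟩ := Ring.associated_of_ordFrac_eq (R := V) (algebraMap V K ϖ ^ vord V f) f (by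
    rw [ordFrac_eq_exp_vord hf, ordFrac_eq_exp_vord (zpow_ne_zero _ hϖ0), vord_zpow hϖ0,
      vord_uniformizer hϖ, mul_one])
  exact ⟨v, by rw [Units.smul_def, Algebra.smul_def] at hv; exact hv.symm⟩

lemma vord_algebraMap_nonneg (v : V) : 0 ≤ vord V (algebraMap V K v) := by
  by_cases hv : v = 0
  · simp [hv, vord, WithZero.unzeroD]
  obtain ⟨ϖ, hϖ⟩ := IsDiscreteValuationRing.exists_irreducible V
  obtain ⟨n, w, rfl⟩ := IsDiscreteValuationRing.eq_unit_mul_pow_irreducible hv hϖ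
  have hϖ0 : algebraMap V K ϖ ≠ 0 := by simpa using hϖ.ne_zero
  rw [map_mul, map_pow, vord_mul (w.isUnit.map _).ne_zero (pow_ne_zero _ hϖ0),
    vord_algebraMap_of_isUnit w.isUnit, vord_pow hϖ0, vord_uniformizer hϖ]
  simp

lemma vord_nonneg_iff {f : K} (hf : f ≠ 0) : 0 ≤ vord V f ↔ ∃ v : V, algebraMap V K v = f := by
  constructor
  · intro h
    obtain ⟨ϖ, hϖ⟩ := IsDiscreteValuationRing.exists_irreducible V
    obtain ⟨v, hv⟩ := exists_unit_mul_zpow hϖ hf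
    lift vord V f to ℕ using h with n
    exact ⟨v * ϖ ^ n, by rw [hv]; simp⟩
  · rintro ⟨v, rfl⟩
    exact vord_algebraMap_nonneg v

/-- For a nonzero element of the ring, the order is the length of the quotient. -/
lemma length_quotient_span_singleton {v : V} (hv : v ≠ 0) :
    ∃ n : ℕ, Module.length V (V ⧸ Ideal.span {v}) = n ∧ vord V (algebraMap V K v) = n := by
  obtain ⟨ϖ, hϖ⟩ := IsDiscreteValuationRing.exists_irreducible V
  obtain ⟨n, w, rfl⟩ := IsDiscreteValuationRing.eq_unit_mul_pow_irreducible hv hϖ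
  have hϖ0 : algebraMap V K ϖ ≠ 0 := by simpa using hϖ.ne_zero
  refine ⟨n, ?_, ?_⟩
  · have := Ring.ord_eq_addVal (R := V) (w * ϖ ^ n)
    rw [Ring.ord] at this
    rw [this, IsDiscreteValuationRing.addVal_def' w hϖ n]
  · rw [map_mul, map_pow, vord_mul (w.isUnit.map _).ne_zero (pow_ne_zero _ hϖ0),
      vord_algebraMap_of_isUnit w.isUnit, vord_pow hϖ0, vord_uniformizer hϖ]
    simp

/-- The length of the cokernel of a square matrix is the order of its determinant. -/
lemma length_quotient_span_range {ι : Type*} [Fintype ι] [DecidableEq ι] (M : Matrix ι ι V)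
    (hM : M.det ≠ 0) :
    ∃ n : ℕ, Module.length V ((ι → V) ⧸ Submodule.span V (Set.range M.row)) = n ∧
      vord V (algebraMap V K M.det) = n := by
  set N := Submodule.span V (Set.range M.row) with hN
  have hli : LinearIndependent V M.row :=
    Matrix.linearIndependent_rows_of_det_ne_zero hM
  let bM : Module.Basis ι V N := Module.Basis.span hli
  have hrank : Module.finrank V N = Module.finrank V (ι → V) := by
    rw [Module.finrank_eq_card_basis bM, Module.finrank_fintype_fun_eq_card]
  let b := Pi.basisFun V ι
  -- By the Smith normal form, `M` is diagonal up to invertible factors, and both the length and the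
  -- order of the determinant become sums over the diagonal entries.
  let bN := Submodule.smithNormalFormBotBasis b hrank
  let bT := Submodule.smithNormalFormTopBasis b hrank
  let a := Submodule.smithNormalFormCoeffs b hrank
  have ha : ∀ i, a i ≠ 0 := Submodule.smithNormalFormCoeffs_ne_zero b hrank
  have hab : ∀ i, (bN i : ι → V) = a i • bT i := Submodule.smithNormalFormBotBasis_def b hrank
  have hfac : M = (bN.toMatrix bM).transpose * (Matrix.diagonal a * (b.toMatrix bT).transpose) := by
    ext i j
    have h1 : (bM i : ι → V) = ∑ k, bN.toMatrix bM k i • (bN k : ι → V) := by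
      conv_lhs => rw [← bN.sum_repr (bM i)]
      rw [Submodule.coe_sum]
      rfl
    have h2 : (bM i : ι → V) = M i := by
      rw [Module.Basis.span_apply hli i]; rfl
    rw [h2] at h1
    rw [h1, Matrix.mul_apply, Finset.sum_apply]
    refine Finset.sum_congr rfl fun k _ => ?_
    rw [hab, Matrix.diagonal_mul]
    simp [Module.Basis.toMatrix_apply, b]
  have hdet : Associated M.det (∏ i, a i) := by
    have u1 : IsUnit (bN.toMatrix bM).det := by
      rw [← Module.Basis.det_apply]; exact bN.isUnit_det bM
    have u2 : IsUnit (b.toMatrix bT).det := by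
      rw [← Module.Basis.det_apply]; exact b.isUnit_det bT
    rw [hfac, Matrix.det_mul, Matrix.det_mul, Matrix.det_transpose, Matrix.det_transpose,
      Matrix.det_diagonal]
    refine Associated.symm ⟨(u1.mul u2).unit, ?_⟩
    rw [IsUnit.unit_spec]
    ring
  choose n hn1 hn2 using fun i => length_quotient_span_singleton (K := K) (ha i)
  refine ⟨∑ i, n i, ?_, ?_⟩
  · rw [(Submodule.quotientEquivPiSpan N b hrank).length_eq, Module.length_pi_of_fintype]
    push_cast
    exact Finset.sum_congr rfl fun i _ => hn1 i
  · obtain ⟨w, hw⟩ := hdet.symm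
    have hprod : ∀ s : Finset ι, vord V (algebraMap V K (∏ i ∈ s, a i)) = ∑ i ∈ s, (n i : ℤ) := by
      intro s
      induction s using Finset.induction_on with
      | empty => simp
      | insert j s hj ih =>
        rw [Finset.prod_insert hj, Finset.sum_insert hj, map_mul, vord_mul, ih, hn2]
        · simpa using ha j
        · simpa [Finset.prod_eq_zero_iff] using fun i _ => ha i
    rw [← hw, map_mul, vord_mul, hprod, vord_algebraMap_of_isUnit w.isUnit, add_zero]
    · push_cast; rfl
    · simpa [Finset.prod_eq_zero_iff] using ha
    · exact (w.isUnit.map _).ne_zero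

end Vord

/-! ### `p`-bases of discrete valuation rings -/

section PBasisDVR

variable {p : ℕ} [Fact p.Prime]

/-- A copy of `A`, over which `A` is an algebra by the Frobenius map. -/
def FrobeniusSource (_ : ℕ) (A : Type*) : Type _ := A

instance (A : Type*) [CommRing A] : CommRing (FrobeniusSource p A) := inferInstanceAs (CommRing A)

instance (A : Type*) [CommRing A] [IsLocalRing A] : IsLocalRing (FrobeniusSource p A) :=
  inferInstanceAs (IsLocalRing A)

instance (A : Type*) [CommRing A] [CharP A p] : Algebra (FrobeniusSource p A) A :=
  (frobenius A p).toAlgebra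

/-- The identity map to the source of the Frobenius map. -/
def toFrobeniusSource (p : ℕ) {A : Type*} (a : A) : FrobeniusSource p A := a

lemma toFrobeniusSource_smul {A : Type*} [CommRing A] [CharP A p] (r a : A) :
    toFrobeniusSource p r • a = r ^ p * a := rfl

/-- Nakayama's lemma for the module of `p`-th powers. -/
lemma eq_top_of_frobeniusFinite {A : Type*} [CommRing A] [IsLocalRing A] [CharP A p]
    (hA : FrobeniusFinite p A) (N : AddSubgroup A) (hN : ∀ r : A, ∀ a ∈ N, r ^ p * a ∈ N)
    (t : A) (ht : t ∈ IsLocalRing.maximalIdeal A)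
    (h : ∀ a, ∃ b ∈ N, ∃ c, a = b + t ^ p * c) (a : A) : a ∈ N := by
  let N' : Submodule (FrobeniusSource p A) A :=
    { N with smul_mem' := fun r a ha => hN r a ha }
  have hfin : Module.Finite (FrobeniusSource p A) A := by
    classical
    obtain ⟨n, γ, h⟩ := hA
    refine ⟨⟨Finset.univ.image γ, ?_⟩⟩
    rw [eq_top_iff]
    rintro a -
    obtain ⟨c, hc⟩ := h a
    rw [hc]
    refine Submodule.sum_mem _ fun i _ => ?_
    rw [← toFrobeniusSource_smul]
    exact Submodule.smul_mem _ _ (Submodule.subset_span (by simp))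
  have : (⊤ : Submodule (FrobeniusSource p A) A) ≤ N' := by
    refine Submodule.le_of_le_smul_of_le_jacobson_bot
      (I := IsLocalRing.maximalIdeal (FrobeniusSource p A)) hfin.1
      (IsLocalRing.maximalIdeal_le_jacobson _) ?_
    rintro a -
    obtain ⟨b, hb, c, rfl⟩ := h a
    have h1 : toFrobeniusSource p t ∈ IsLocalRing.maximalIdeal (FrobeniusSource p A) := ht
    have h2 := Submodule.smul_mem_smul h1 (Submodule.mem_top (R := FrobeniusSource p A) (x := c))
    rw [toFrobeniusSource_smul] at h2
    exact Submodule.add_mem_sup hb h2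
  exact this (Submodule.mem_top (x := a))

/-- Sorting by the exponent of `t` prepares for `t`-adic arguments when `t` is a uniformizer. -/
lemma pComb_option {A : Type*} [CommRing A] [CharP A p] {ι : Type*} [Fintype ι] (t : A)
    (x : ι → A) (c : (Option ι → Fin p) → A) :
    pComb p (fun o : Option ι => o.elim t x) c = ∑ i : Fin p, t ^ (i : ℕ) *
      pComb p x (fun β => c ((Equiv.piOptionEquivProd (β := fun _ => Fin p)).symm (i, β))) := by
  classical
  simp only [pComb_apply, Finset.mul_sum]
  rw [← Fintype.sum_prod_type'
    (f := fun (i : Fin p) β => t ^ (i : ℕ) *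
      (c ((Equiv.piOptionEquivProd (β := fun _ => Fin p)).symm (i, β)) ^ p *
        pMonomial x (fun i => (β i : ℕ))))]
  refine Fintype.sum_equiv (Equiv.piOptionEquivProd (β := fun _ => Fin p)) _ _ fun α => ?_
  rw [pMonomial_option]
  simp only [Option.elim, Prod.mk.eta, Equiv.symm_apply_apply]
  simp only [Equiv.piOptionEquivProd, Equiv.coe_fn_mk]
  ring

variable {V : Type u} [CommRing V] [IsDomain V] [IsDiscreteValuationRing V] [CharP V p]

open IsLocalRing in
/-- A uniformizer and lifts of a `p`-basis of the residue field form a `p`-basis. -/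
lemma exists_isPBasis_of_dvr (hV : FrobeniusFinite p V) :
    ∃ (ι : Type) (_ : Fintype ι) (x : ι → V), IsPBasis p x := by
  classical
  have hp := (Fact.out : p.Prime)
  have : CharP (ResidueField V) p := by
    have h1 : (p : ResidueField V) = 0 := by
      rw [← map_natCast (residue V), CharP.cast_eq_zero, map_zero]
    exact (CharP.charP_iff_prime_eq_zero hp).mpr h1
  obtain ⟨ι, _, ubar, hu⟩ := exists_isPBasis_of_field
    (hV.of_surjective (residue V) residue_surjective)
  choose x hx using fun i => residue_surjective (ubar i)
  obtain ⟨t, ht⟩ := IsDiscreteValuationRing.exists_irreducible V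
  have htm : maximalIdeal V = Ideal.span {t} := ht.maximalIdeal_eq
  have hmem : ∀ v : V, residue V v = 0 ↔ t ∣ v := by
    intro v
    rw [residue_eq_zero_iff, htm, Ideal.mem_span_singleton]
  have hres : ∀ c : (ι → Fin p) → V, residue V (pComb p x c) =
      pComb p ubar (fun β => residue V (c β)) := by
    intro c
    simp [pComb_apply, map_pMonomial, hx]
  have hsmul : ∀ {κ : Type} [Fintype κ] [DecidableEq κ] (y : κ → V) (r : V)
      (c : (κ → Fin p) → V), pComb p y (fun β => r * c β) = r ^ p * pComb p y c := by
    intro κ _ _ y r c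
    simp [pComb_apply, Finset.mul_sum, mul_pow, mul_assoc]
  refine ⟨Option ι, inferInstance, fun o => o.elim t x,
    (injective_iff_map_eq_zero _).mpr fun c hc => ?_, fun f => ?_⟩
  -- The relation is read modulo `t ^ (k + 1)` for `k < p`. Terms with a smaller power of `t` have
  -- coefficients divisible by `t`, hence contain `t ^ p`; what remains is a relation in the residue
  -- field.
  · have claim : ∀ c : (Option ι → Fin p) → V, pComb p (fun o => o.elim t x) c = 0 →
        ∀ α, t ∣ c α := by
      intro c hc
      rw [pComb_option] at hc
      set e := (Equiv.piOptionEquivProd (α := ι) (β := fun _ => Fin p)).symm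
      have : ∀ (k : ℕ) (hk : k < p) (β : ι → Fin p), t ∣ c (e (⟨k, hk⟩, β)) := by
        intro k
        induction k using Nat.strong_induction_on with
        | _ k ih =>
        intro hk
        have h1 : t ^ (k + 1) ∣ t ^ k * pComb p x (fun β => c (e (⟨k, hk⟩, β))) := by
          rw [← Finset.add_sum_erase _ _ (Finset.mem_univ (⟨k, hk⟩ : Fin p))] at hc
          rw [eq_neg_of_add_eq_zero_left hc, dvd_neg]
          refine Finset.dvd_sum fun j hj => ?_
          by_cases hjk : (j : ℕ) < k
          · choose d hd using ih j hjk j.2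
            have : (fun β => c (e (j, β))) = fun β => t * d β := by
              ext β; exact hd β
            rw [this, hsmul]
            exact dvd_mul_of_dvd_right (dvd_mul_of_dvd_left (pow_dvd_pow t (by omega)) _) _
          · have : (j : ℕ) ≠ k := fun e => Finset.ne_of_mem_erase hj (Fin.ext e)
            exact dvd_mul_of_dvd_left (pow_dvd_pow t (by omega)) _
        rw [pow_succ] at h1
        have h2 := (mul_dvd_mul_iff_left (pow_ne_zero k ht.ne_zero)).mp h1
        rw [← hmem, hres] at h2
        have h3 := (injective_iff_map_eq_zero _).mp hu.1 _ h2
        intro β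
        rw [← hmem]
        exact congrFun h3 β
      intro α
      have := this _ (α none).2 (fun i => α (some i))
      convert this
      ext o
      cases o <;> simp [e, Equiv.piOptionEquivProd]
    -- Dividing all coefficients by `t` gives another relation, so they are divisible by every power
    -- of `t`.
    have hdiv : ∀ (n : ℕ) (c : (Option ι → Fin p) → V),
        pComb p (fun o => o.elim t x) c = 0 → ∀ α, t ^ n ∣ c α := by
      intro n
      induction n with
      | zero => simp
      | succ n ih =>
        intro c hc α
        choose d hd using claim c hc
        have hd' : c = fun α => t * d α := funext hd
        rw [hd', hsmul] at hc
        have := ih d ((mul_eq_zero.mp hc).resolve_left (pow_ne_zero _ ht.ne_zero)) α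
        rw [hd, pow_succ']
        exact mul_dvd_mul_left t this
    ext α
    by_contra hne
    obtain ⟨n, w, hw⟩ := IsDiscreteValuationRing.eq_unit_mul_pow_irreducible hne ht
    have := hdiv (n + 1) c hc α
    rw [hw, Units.dvd_mul_left, pow_succ] at this
    exact ht.not_isUnit (isUnit_of_dvd_one
      ((mul_dvd_mul_iff_left (pow_ne_zero n ht.ne_zero)).mp (by simpa using this)))
  · refine eq_top_of_frobeniusFinite hV (pComb p fun o : Option ι => o.elim t x).range ?_ t
      (by rw [htm]; exact Ideal.mem_span_singleton_self t) ?_ f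
    · rintro r _ ⟨c, rfl⟩
      exact ⟨fun α => r * c α, hsmul _ _ _⟩
    · have step : ∀ a : V, ∃ (c : (ι → Fin p) → V) (b : V), a = pComb p x c + t * b := by
        intro a
        obtain ⟨cbar, hc⟩ := hu.2 (residue V a)
        choose c hc' using fun β => residue_surjective (cbar β)
        have : residue V (a - pComb p x c) = 0 := by
          rw [map_sub, hres, ← hc]
          simp [hc']
        obtain ⟨b, hb⟩ := (hmem _).mp this
        exact ⟨c, b, by rw [← hb]; ring⟩
      -- After `p` approximations the error is a multiple of `t ^ p` and only exponents of `t` below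
      -- `p` have been used, as Nakayama's lemma over the `p`-th powers requires.
      have step2 : ∀ (k : ℕ) (a : V), ∃ (c : ℕ → (ι → Fin p) → V) (b : V),
          a = ∑ i ∈ Finset.range k, t ^ i * pComb p x (c i) + t ^ k * b := by
        intro k
        induction k with
        | zero => exact fun a => ⟨0, a, by simp⟩
        | succ k ih =>
          intro a
          obtain ⟨c, b, h1⟩ := ih a
          obtain ⟨c', b', h2⟩ := step b
          refine ⟨fun i => if i = k then c' else c i, b', ?_⟩
          rw [Finset.sum_range_succ, h1]
          have : ∑ i ∈ Finset.range k, t ^ i * pComb p x (if i = k then c' else c i) =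
              ∑ i ∈ Finset.range k, t ^ i * pComb p x (c i) := by
            refine Finset.sum_congr rfl fun i hi => ?_
            rw [if_neg (Finset.mem_range.mp hi).ne]
          rw [this]
          simp only [if_true]
          rw [h2]
          ring
      intro a
      obtain ⟨c, b, h⟩ := step2 p a
      refine ⟨_, ⟨fun α => c (α none) (fun i => α (some i)), rfl⟩, b, ?_⟩
      rw [h, pComb_option, Finset.sum_range]
      simp [Equiv.piOptionEquivProd]

end PBasisDVR

/-! ### `p^{-e}`-linear maps on fields and their divisors -/

section PInv

variable {p : ℕ} [Fact p.Prime]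

lemma pInv_pow_mul {e : ℕ} {K : Type*} [Field K] {Φ : K →+ K}
    (hΦ : Φ ∈ pInvLinearMaps p e K K K) (r f : K) : Φ (r ^ p ^ e * f) = r * Φ f := hΦ r f

lemma pInv_comp_mulLeft {e : ℕ} {K : Type*} [Field K] {Φ : K →+ K}
    (hΦ : Φ ∈ pInvLinearMaps p e K K K) (g : K) :
    Φ.comp (AddMonoidHom.mulLeft g) ∈ pInvLinearMaps p e K K K := by
  intro r f
  simp only [AddMonoidHom.comp_apply, AddMonoidHom.coe_mulLeft, smul_eq_mul]
  rw [mul_left_comm, pInv_pow_mul hΦ]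

namespace IsPBasis

variable {A : Type*} [CommRing A] [CharP A p] {ι : Type*} [Fintype ι] {x : ι → A}
  (h : IsPBasis p x)

/-- The `e`-th iterate of `theta`. -/
def thetaPow : ℕ → (A →+ A)
  | 0 => AddMonoidHom.id A
  | e + 1 => (thetaPow e).comp h.theta

@[simp]
lemma thetaPow_zero (f : A) : h.thetaPow 0 f = f := rfl

lemma thetaPow_succ (e : ℕ) (f : A) : h.thetaPow (e + 1) f = h.thetaPow e (h.theta f) := rfl

lemma thetaPow_pow_mul (e : ℕ) (r f : A) : h.thetaPow e (r ^ p ^ e * f) = r * h.thetaPow e f := by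
  induction e generalizing f with
  | zero => simp
  | succ e ih => rw [thetaPow_succ, pow_succ, pow_mul, theta_pow_mul, ih, thetaPow_succ]

lemma thetaPow_mem {K : Type*} [Field K] [CharP K p] {x : ι → K} (h : IsPBasis p x) (e : ℕ) :
    h.thetaPow e ∈ pInvLinearMaps p e K K K := fun r f => h.thetaPow_pow_mul e r f

/-- The iterates of `theta` generate all `p^{-e}`-linear maps. -/
lemma exists_eq_thetaPow_mul {K : Type*} [Field K] [CharP K p] {x : ι → K} (h : IsPBasis p x)
    (e : ℕ) (Φ : K →+ K) (hΦ : Φ ∈ pInvLinearMaps p e K K K) :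
    ∃ g, ∀ f, Φ f = h.thetaPow e (g * f) := by
  classical
  have hp := (Fact.out : p.Prime)
  induction e generalizing Φ with
  | zero =>
    refine ⟨Φ 1, fun f => ?_⟩
    have := hΦ f 1
    simp only [pow_zero, pow_one, smul_eq_mul, mul_one] at this
    simp [this, mul_comm]
  | succ e ih =>
    have hα : ∀ α : ι → Fin p, ∃ g, ∀ f, Φ (f ^ p * pMonomial x (fun i => α i)) =
        h.thetaPow e (g * f) := by
      intro α
      let Ψ : K →+ K :=
        { toFun := fun f => Φ (f ^ p * pMonomial x (fun i => α i))
          map_zero' := by simp [hp.ne_zero]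
          map_add' := by intro a b; simp [add_pow_char, add_mul] }
      refine ih Ψ fun r f => ?_
      change Φ ((r ^ p ^ e * f) ^ p * _) = r * Φ (f ^ p * _)
      rw [← pInv_pow_mul hΦ, mul_pow, ← pow_mul, ← pow_succ, mul_assoc]
    choose g hg using hα
    -- `theta` of `f` times the monomial complementary to `α` is the `α`-coefficient of `f`, so this
    -- element reassembles the maps found on the single slices.
    refine ⟨∑ α, g α ^ p * pMonomial x (fun i => p - 1 - α i), fun f => ?_⟩
    rw [thetaPow_succ, Finset.sum_mul, map_sum, map_sum]
    conv_lhs => rw [← h.pComb_coeff f, pComb_apply, map_sum]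
    refine Finset.sum_congr rfl fun α _ => ?_
    rw [hg, mul_assoc, theta_pow_mul, mul_comm (pMonomial x _) f, theta_mul_compl]

/-- The change of variables formula for the iterates of `theta`. -/
lemma thetaPow_mul_det_jacobian [DecidableEq ι] {L : Type*} [Field L] [CharP L p] {x z : ι → L}
    (h : IsPBasis p x) (hz : IsPBasis p z) (e : ℕ) (f : L) :
    hz.thetaPow e f * (h.jacobian z).det = h.thetaPow e ((h.jacobian z).det * f) := by
  induction e generalizing f with
  | zero => simp [mul_comm]
  | succ e ih => rw [thetaPow_succ, ih, thetaPow_succ, ← h.theta_mul_det_jacobian hz, mul_comm]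

lemma thetaPow_map {B : Type*} [CommRing B] [CharP B p] (φ : A →+* B)
    (h' : IsPBasis p (fun i => φ (x i))) (e : ℕ) (f : A) :
    h'.thetaPow e (φ f) = φ (h.thetaPow e f) := by
  induction e generalizing f with
  | zero => rfl
  | succ e ih =>
    rw [thetaPow_succ, thetaPow_succ, ← ih]
    congr 1
    classical
    induction f using h.induction with
    | zero => simp
    | add f g hf hg => simp [hf, hg]
    | mono c n =>
      rw [map_mul, map_pow, map_pMonomial]
      by_cases hn : ∀ i, n i % p = p - 1
      · rw [h.theta_pow_mul_pMonomial _ _ hn, h'.theta_pow_mul_pMonomial _ _ hn, map_mul,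
          map_pMonomial]
      · push Not at hn
        obtain ⟨i, hi⟩ := hn
        rw [h.theta_pow_mul_pMonomial_of_ne _ _ i hi, h'.theta_pow_mul_pMonomial_of_ne _ _ i hi,
          map_zero]

lemma pderiv_map [DecidableEq ι] {B : Type*} [CommRing B] [CharP B p] (φ : A →+* B)
    (h' : IsPBasis p (fun i => φ (x i))) (j : ι) (f : A) :
    h'.pderiv j (φ f) = φ (h.pderiv j f) := by
  induction f using h.induction with
  | zero => simp
  | add f g hf hg => simp [hf, hg]
  | mono c n =>
    rw [map_mul, map_pow, map_pMonomial, pderiv_pow_mul_pMonomial, pderiv_pow_mul_pMonomial]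
    simp [map_pMonomial]

/-- The Frobenius twists cancel in the change of coordinates, giving a linear isomorphism between
spaces of dimensions `p ^ |ι|` and `p ^ |κ|`. -/
lemma card_eq {κ : Type*} [Fintype κ] {L : Type*} [Field L] [CharP L p] {y : ι → L} {z : κ → L}
    (hy : IsPBasis p y) (hz : IsPBasis p z) : Fintype.card ι = Fintype.card κ := by
  classical
  let T : ((ι → Fin p) → L) →ₗ[L] ((κ → Fin p) → L) :=
    { toFun := fun c => hz.coeff (pComb p y c)
      map_add' := by simp
      map_smul' := by
        intro r c
        ext α
        have : pComb p y (r • c) = r ^ p * pComb p y c := by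
          simp [pComb_apply, Finset.mul_sum, mul_pow, mul_assoc]
        simp [this, hz.coeff_pow_mul] }
  have hT : Function.Bijective T :=
    (AddEquiv.ofBijective (pComb p z) hz).symm.bijective.comp hy
  have h := (LinearEquiv.ofBijective T hT).finrank_eq
  rw [Module.finrank_fintype_fun_eq_card, Module.finrank_fintype_fun_eq_card, Fintype.card_fun,
    Fintype.card_fun, Fintype.card_fin] at h
  exact Nat.pow_right_injective (Fact.out : p.Prime).two_le h

end IsPBasis

/-- The module of `p^{-e}`-linear maps is generated by any nonzero element. -/
lemma exists_eq_mul_of_pInv {K : Type u} [Field K] [CharP K p] (hK : FrobeniusFinite p K) {e : ℕ}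
    {Θ Φ : K →+ K} (hΘ : Θ ∈ pInvLinearMaps p e K K K) (hΘ0 : Θ ≠ 0)
    (hΦ : Φ ∈ pInvLinearMaps p e K K K) : ∃ g, ∀ f, Φ f = Θ (g * f) := by
  obtain ⟨ι, _, x, hx⟩ := exists_isPBasis_of_field hK
  obtain ⟨a, ha⟩ := hx.exists_eq_thetaPow_mul e Θ hΘ
  obtain ⟨b, hb⟩ := hx.exists_eq_thetaPow_mul e Φ hΦ
  have ha0 : a ≠ 0 := by
    rintro rfl
    apply hΘ0
    ext f
    simp [ha]
  refine ⟨a⁻¹ * b, fun f => ?_⟩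
  rw [ha, hb, mul_assoc, mul_inv_cancel_left₀ ha0]

/-- A `p^{-e}`-linear map on the fraction field of a discrete valuation ring `V` has divisor `d`:
it maps `V f` into `V` if and only if `f` has a pole of order at most `d`. -/
def HasDivisor (V : Type*) [CommRing V] [IsDomain V] [IsDiscreteValuationRing V] {K : Type*}
    [Field K] [Algebra V K] [IsFractionRing V K] (Φ : K →+ K) (d : ℤ) : Prop :=
  ∀ f : K, f ≠ 0 → ((∀ v : V, ∃ w : V, algebraMap V K w = Φ (algebraMap V K v * f)) ↔
    -d ≤ vord V f)

section HasDivisor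

variable {V : Type*} [CommRing V] [IsDomain V] [IsDiscreteValuationRing V] {K : Type*}
  [Field K] [Algebra V K] [IsFractionRing V K] {Φ Ψ : K →+ K} {d : ℤ}

lemma HasDivisor.comp_mul (h : HasDivisor V Φ d) {g : K} (hg : g ≠ 0)
    (hΨ : ∀ f, Ψ f = Φ (g * f)) : HasDivisor V Ψ (d + vord V g) := by
  intro f hf
  have := h (g * f) (mul_ne_zero hg hf)
  rw [vord_mul hg hf] at this
  simp only [hΨ, mul_left_comm g]
  rw [this]
  constructor <;> intro h <;> linarith

lemma HasDivisor.apply_mem (h : HasDivisor V Φ d) {f : K} (hf : f ≠ 0) (hd : -d ≤ vord V f) :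
    ∃ w : V, algebraMap V K w = Φ f := by
  simpa using (h f hf).mpr hd 1

/-- It suffices to test on the multiples of `ϖ ^ (-n)`. Inequalities between divisors, and in
particular uniqueness of the divisor, are obtained from this. -/
lemma HasDivisor.le (h : HasDivisor V Φ d) {n : ℤ}
    (hn : ∀ f, f ≠ 0 → -n ≤ vord V f → ∃ w : V, algebraMap V K w = Φ f) : n ≤ d := by
  obtain ⟨ϖ, hϖ⟩ := IsDiscreteValuationRing.exists_irreducible V
  have hϖ0 : algebraMap V K ϖ ≠ 0 := by simpa using hϖ.ne_zero
  have h0 : algebraMap V K ϖ ^ (-n) ≠ 0 := zpow_ne_zero _ hϖ0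
  have hv : vord V (algebraMap V K ϖ ^ (-n)) = -n := by
    rw [vord_zpow hϖ0, vord_uniformizer hϖ, mul_one]
  have := (h _ h0).mp fun v => by
    by_cases hv0 : v = 0
    · exact ⟨0, by simp [hv0]⟩
    have hv0' : algebraMap V K v ≠ 0 := by simpa using hv0
    apply hn _ (mul_ne_zero hv0' h0)
    rw [vord_mul hv0' h0, hv]
    linarith [vord_algebraMap_nonneg (K := K) v]
  rw [hv] at this
  linarith

lemma HasDivisor.ne_zero (h : HasDivisor V Φ d) : Φ ≠ 0 := by
  rintro rfl
  have := h.le (n := d + 1) fun f _ _ => ⟨0, by simp⟩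
  linarith

/-- If `theta` maps `V f` into `V`, then the coefficients of `f` lie in `V`, being `theta` of `f`
times monomials, so `f` lies in `V`. In the language of forms, the differentials of a `p`-basis of
`V` trivialize the top differentials. -/
lemma hasDivisor_thetaPow [CharP V p] [CharP K p] {ι : Type*} [Fintype ι] {x : ι → V}
    (h : IsPBasis p x) (hK : IsPBasis p (fun i => algebraMap V K (x i))) (e : ℕ) :
    HasDivisor V (hK.thetaPow e) 0 := by
  classical
  intro f hf
  rw [neg_zero, vord_nonneg_iff hf]
  constructor
  · clear hf
    induction e generalizing f with
    | zero => intro hv; simpa using hv 1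
    | succ e ih =>
      intro hv
      have hθ : ∀ v : V, ∃ w : V, algebraMap V K w = hK.theta (algebraMap V K v * f) := by
        intro v
        apply ih
        intro u
        obtain ⟨w, hw⟩ := hv (u ^ p * v)
        refine ⟨w, ?_⟩
        rw [hw, IsPBasis.thetaPow_succ, map_mul (algebraMap V K), map_pow, mul_assoc, hK.theta_pow_mul]
      choose w hw using fun α : ι → Fin p => hθ (pMonomial x (fun i => p - 1 - α i))
      refine ⟨pComb p x w, ?_⟩
      rw [← hK.pComb_coeff f, pComb_apply, pComb_apply, map_sum]
      refine Finset.sum_congr rfl fun α _ => ?_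
      rw [map_mul, map_pow, hw, map_pMonomial, map_pMonomial, mul_comm _ f, hK.theta_mul_compl]
  · rintro ⟨v, rfl⟩ u
    exact ⟨h.thetaPow e (u * v), by rw [← map_mul, h.thetaPow_map (algebraMap V K) hK]⟩

lemma charP_of_isFractionRing [CharP K p] : CharP V p :=
  (algebraMap V K).charP (IsFractionRing.injective V K) p

/-- In terms of a `p`-basis of `V` the map is `f ↦ thetaPow e (g * f)`, and the order of `g` is its
divisor. -/
lemma exists_hasDivisor {V : Type u} [CommRing V] [IsDomain V] [IsDiscreteValuationRing V]
    {K : Type*} [Field K] [Algebra V K] [IsFractionRing V K] [CharP K p]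
    (hV : FrobeniusFinite p V) {e : ℕ} {Φ : K →+ K} (hΦ : Φ ∈ pInvLinearMaps p e K K K)
    (h0 : Φ ≠ 0) : ∃ d, HasDivisor V Φ d := by
  have : CharP V p := charP_of_isFractionRing (K := K)
  obtain ⟨ι, _, x, hx⟩ := exists_isPBasis_of_dvr hV
  have hK : IsPBasis p (fun i => algebraMap V K (x i)) := hx.isFractionRing
  obtain ⟨g, hg⟩ := hK.exists_eq_thetaPow_mul e Φ hΦ
  have hg0 : g ≠ 0 := by
    rintro rfl
    apply h0
    ext f
    simp [hg]
  exact ⟨_, (hasDivisor_thetaPow hx hK e).comp_mul hg0 hg⟩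

/-- The divisor of a composition of maps. -/
lemma HasDivisor.comp {V : Type u} [CommRing V] [IsDomain V] [IsDiscreteValuationRing V]
    {K : Type*} [Field K] [Algebra V K] [IsFractionRing V K] {Φ Ψ : K →+ K} {d d' : ℤ}
    {e : ℕ} (hΨ : Ψ ∈ pInvLinearMaps p e K K K) (hd : HasDivisor V Φ d)
    (hd' : HasDivisor V Ψ d') : HasDivisor V (Φ.comp Ψ) (d' + p ^ e * d) := by
  obtain ⟨ϖ, hϖ⟩ := IsDiscreteValuationRing.exists_irreducible V
  have hϖ0 : algebraMap V K ϖ ≠ 0 := by simpa using hϖ.ne_zero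
  have hz0 : algebraMap V K ϖ ^ d ≠ 0 := zpow_ne_zero _ hϖ0
  have hzv : vord V (algebraMap V K ϖ ^ d) = d := by
    rw [vord_zpow hϖ0, vord_uniformizer hϖ, mul_one]
  -- The condition imposed by `Φ` is integrality after multiplication by `ϖ ^ d`; moved inside `Ψ`,
  -- this factor becomes its `p ^ e`-th power, whence the term `p ^ e * d`.
  have hmem : ∀ g : K, (∃ w : V, algebraMap V K w = algebraMap V K ϖ ^ d * g) ↔
      ∀ v : V, ∃ w : V, algebraMap V K w = Φ (algebraMap V K v * g) := by
    intro g
    by_cases hg : g = 0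
    · simp only [hg, mul_zero, map_zero]
      exact ⟨fun _ _ => ⟨0, map_zero _⟩, fun _ => ⟨0, map_zero _⟩⟩
    rw [hd g hg, ← vord_nonneg_iff (mul_ne_zero hz0 hg), vord_mul hz0 hg, hzv]
    constructor <;> intro h <;> linarith
  intro f hf
  have h1 : (∀ v : V, ∃ w : V, algebraMap V K w = (Φ.comp Ψ) (algebraMap V K v * f)) ↔
      ∀ v : V, ∃ w : V, algebraMap V K w =
        Ψ (algebraMap V K v * ((algebraMap V K ϖ ^ d) ^ p ^ e * f)) := by
    simp only [AddMonoidHom.comp_apply]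
    constructor
    · intro h v
      rw [mul_left_comm, pInv_pow_mul hΨ, hmem]
      intro u
      obtain ⟨w, hw⟩ := h (u ^ p ^ e * v)
      exact ⟨w, by
        rw [hw, map_mul (algebraMap V K), map_pow, mul_assoc, pInv_pow_mul hΨ]⟩
    · intro h v
      have := h v
      rw [mul_left_comm, pInv_pow_mul hΨ, hmem] at this
      simpa using this 1
  rw [h1, hd' _ (mul_ne_zero (pow_ne_zero _ hz0) hf), vord_mul (pow_ne_zero _ hz0) hf,
    vord_pow hz0, hzv]
  push_cast
  constructor <;> intro h <;> linarith

end HasDivisor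

/-! ### Extension of `p^{-e}`-linear maps along separable field extensions -/

section Extension

variable {K L : Type*} [Field K] [Field L] [Algebra K L] [FiniteDimensional K L]
  [Algebra.IsSeparable K L] [CharP K p]

/-- A `p^{-e}`-linear map extends along a finite separable field extension, and the extension is
compatible with the traces. -/
lemma exists_extension {e : ℕ} {Φ : K →+ K} (hΦ : Φ ∈ pInvLinearMaps p e K K K) :
    ∃ Ψ ∈ pInvLinearMaps p e L L L, (∀ k, Ψ (algebraMap K L k) = algebraMap K L (Φ k)) ∧
      ∀ l, Algebra.trace K L (Ψ l) = Φ (Algebra.trace K L l) := by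
  have hp := (Fact.out : p.Prime)
  have : ExpChar K p := ExpChar.prime hp
  have : CharP L p := charP_of_injective_algebraMap (algebraMap K L).injective p
  let b := Module.finBasis K L
  let b' := b.mapPowExpCharPowOfIsSeparable p e
  have hb' : ∀ i, b' i = b i ^ p ^ e := by
    intro i; simp [b', Module.Basis.mapPowExpCharPowOfIsSeparable]
  let Ψ : L →+ L :=
    { toFun := fun l => ∑ i, Φ (b'.repr l i) • b i
      map_zero' := by simp
      map_add' := by intro l m; simp [add_smul, Finset.sum_add_distrib] }
  have hΨ : ∀ l, Ψ l = ∑ i, Φ (b'.repr l i) • b i := fun _ => rfl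
  -- Elements `k • l ^ p ^ e` span `L` additively by separability, so this rule characterizes `Ψ`
  -- independently of the basis.
  have key : ∀ (k : K) (l : L), Ψ (k • l ^ p ^ e) = Φ k • l := by
    intro k l
    have h1 : k • l ^ p ^ e = ∑ i, (k * b.repr l i ^ p ^ e) • b' i := by
      conv_lhs => rw [← b.sum_repr l]
      rw [sum_pow_char_pow, Finset.smul_sum]
      refine Finset.sum_congr rfl fun i _ => ?_
      rw [hb', smul_pow, smul_smul]
    rw [h1, hΨ]
    conv_rhs => rw [← b.sum_repr l, Finset.smul_sum]
    refine Finset.sum_congr rfl fun i _ => ?_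
    rw [b'.repr_sum_self, mul_comm, pInv_pow_mul hΦ, smul_smul, mul_comm]
  have hind : ∀ {P : L → Prop} (_h0 : P 0) (_hadd : ∀ l m, P l → P m → P (l + m))
      (_hmono : ∀ (k : K) (l : L), P (k • l ^ p ^ e)) (l : L), P l := by
    intro P h0 hadd hmono l
    rw [← b'.sum_repr l]
    refine Finset.sum_induction _ P hadd h0 fun i _ => ?_
    rw [hb']
    exact hmono _ _
  refine ⟨Ψ, fun r l => ?_, fun k => ?_, fun l => ?_⟩
  · rw [smul_eq_mul, smul_eq_mul]
    induction l using hind with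
    | _h0 => simp
    | _hadd l m hl hm => rw [mul_add, map_add, hl, hm, map_add, mul_add]
    | _hmono k l =>
      rw [key, mul_smul_comm, ← mul_pow, key, mul_smul_comm]
  · have := key k 1
    rw [one_pow, Algebra.smul_def, mul_one, Algebra.smul_def, mul_one] at this
    exact this
  · induction l using hind with
    | _h0 => simp
    | _hadd l m hl hm => simp [hl, hm]
    | _hmono k l =>
      -- The trace is the sum of the conjugates, and Frobenius is additive.
      have htr : Algebra.trace K L (l ^ p ^ e) = Algebra.trace K L l ^ p ^ e := by
        apply (algebraMap K (AlgebraicClosure L)).injective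
        have : CharP (AlgebraicClosure L) p :=
          charP_of_injective_algebraMap (algebraMap L (AlgebraicClosure L)).injective p
        rw [map_pow (algebraMap K _), trace_eq_sum_embeddings (AlgebraicClosure L) (K := K),
          trace_eq_sum_embeddings (AlgebraicClosure L) (K := K), sum_pow_char_pow]
        simp
      rw [key, map_smul, map_smul, htr, smul_eq_mul, smul_eq_mul, mul_comm k, pInv_pow_mul hΦ,
        mul_comm]

/-- By separability `L` has a `K`-basis of `p ^ e`-th powers, which come out of any `p^{-e}`-linear
map. -/
lemma extension_unique {e : ℕ} {Ψ Ψ' : L →+ L} (hΨ : Ψ ∈ pInvLinearMaps p e L L L)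
    (hΨ' : Ψ' ∈ pInvLinearMaps p e L L L)
    (h : ∀ k, Ψ (algebraMap K L k) = Ψ' (algebraMap K L k)) : Ψ = Ψ' := by
  have : ExpChar K p := ExpChar.prime (Fact.out : p.Prime)
  let b := Module.finBasis K L
  let b' := b.mapPowExpCharPowOfIsSeparable p e
  have hb' : ∀ i, b' i = b i ^ p ^ e := by
    intro i; simp [b', Module.Basis.mapPowExpCharPowOfIsSeparable]
  ext l
  rw [← b'.sum_repr l, map_sum, map_sum]
  refine Finset.sum_congr rfl fun i _ => ?_
  rw [hb', Algebra.smul_def, mul_comm, pInv_pow_mul hΨ, pInv_pow_mul hΨ', h]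

end Extension

end PInv

/-! ### Ramification of discrete valuation rings -/

section Ramification

variable {p : ℕ} [Fact p.Prime]

/-! ### Relative differentials in terms of `p`-bases -/

section Kaehler

variable {A B : Type*} [CommRing A] [CommRing B] [Algebra A B] [CharP A p] [CharP B p]
  {ι : Type*} [Fintype ι] [DecidableEq ι] {κ : Type*} [Fintype κ] [DecidableEq κ]
  {x : κ → A} (hx : IsPBasis p x) {y : ι → B} (hy : IsPBasis p y)

variable (x) in
/-- The matrix of the differential of `A → B` with respect to `p`-bases. -/
def relJacobian : Matrix κ ι B := Matrix.of fun i j => hy.pderiv j (algebraMap A B (x i))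

lemma pderiv_algebraMap_mem_span (hx : IsPBasis p x) (hy : IsPBasis p y) (a : A) :
    (fun j => hy.pderiv j (algebraMap A B a)) ∈
      Submodule.span B (Set.range (relJacobian x hy).row) := by
  induction a using hx.induction with
  | zero =>
    have : (fun j => hy.pderiv j (algebraMap A B 0)) = 0 := by ext j; simp
    rw [this]; exact zero_mem _
  | add f g hf hg =>
    have := Submodule.add_mem _ hf hg
    convert this using 1
    ext j
    simp
  | mono c n =>
    have : (fun j => hy.pderiv j (algebraMap A B (c ^ p * pMonomial x n))) =
        ∑ i, (algebraMap A B c ^ p * ((n i : B) *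
          pMonomial (fun i => algebraMap A B (x i)) (lowerExp i n))) •
            (relJacobian x hy).row i := by
      ext j
      rw [map_mul, map_pow, map_pMonomial, Derivation.leibniz, derivation_pow_char (p := p),
        smul_zero, add_zero, derivation_pMonomial, Finset.smul_sum, Finset.sum_apply]
      refine Finset.sum_congr rfl fun i _ => ?_
      simp [relJacobian, mul_assoc]
    rw [this]
    exact Submodule.sum_mem _ fun i _ =>
      Submodule.smul_mem _ _ (Submodule.subset_span (Set.mem_range_self i))

/-- The differentials of `B` over `A` are the cokernel of the Jacobian matrix. -/
def kaehlerEquiv : KaehlerDifferential A B ≃ₗ[B]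
    (ι → B) ⧸ Submodule.span B (Set.range (relJacobian x hy).row) := by
  let N := Submodule.span B (Set.range (relJacobian x hy).row)
  -- The gradient is `A`-linear modulo the rows of the Jacobian matrix because gradients of elements
  -- of `A` lie in their span.
  let D : Derivation A B ((ι → B) ⧸ N) :=
    Derivation.mk'
      { toFun := fun b => N.mkQ (fun j => hy.pderiv j b)
        map_add' := fun b c => by
          rw [← map_add]; congr 1; ext j; simp
        map_smul' := fun a b => by
          have h1 : (fun j => hy.pderiv j (a • b)) =
              algebraMap A B a • (fun j => hy.pderiv j b) +
                b • (fun j => hy.pderiv j (algebraMap A B a)) := by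
            ext j
            rw [Algebra.smul_def, Derivation.leibniz]
            rfl
          have h2 : N.mkQ (b • (fun j => hy.pderiv j (algebraMap A B a))) = 0 := by
            rw [Submodule.mkQ_apply, Submodule.Quotient.mk_eq_zero]
            exact Submodule.smul_mem _ _ (pderiv_algebraMap_mem_span hx hy a)
          rw [h1, map_add, h2, add_zero, map_smul, algebraMap_smul]
          rfl }
      (by
        intro b c
        change N.mkQ _ = b • N.mkQ _ + c • N.mkQ _
        rw [← map_smul, ← map_smul, ← map_add]
        congr 1
        ext j
        simp)
  have hD : ∀ b, D b = N.mkQ (fun j => hy.pderiv j b) := fun _ => rfl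
  have hchain : ∀ b : B, KaehlerDifferential.D A B b =
      ∑ j, hy.pderiv j b • KaehlerDifferential.D A B (y j) := fun b =>
    hy.derivation_eq_sum ((KaehlerDifferential.D A B).restrictScalars ℤ) b
  let F := D.liftKaehlerDifferential
  let G : ((ι → B) ⧸ N) →ₗ[B] KaehlerDifferential A B :=
    N.liftQ (Fintype.linearCombination B (fun j => KaehlerDifferential.D A B (y j))) <| by
      rw [Submodule.span_le]
      rintro _ ⟨i, rfl⟩
      rw [SetLike.mem_coe, LinearMap.mem_ker, Fintype.linearCombination_apply]
      have := hchain (algebraMap A B (x i))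
      rw [Derivation.map_algebraMap] at this
      exact this.symm
  have hG : ∀ v, G (N.mkQ v) = ∑ j, v j • KaehlerDifferential.D A B (y j) := by
    intro v
    simp [G, Fintype.linearCombination_apply]
  refine LinearEquiv.ofLinearMap F G ?_ ?_
  · apply Submodule.linearMap_qext
    refine LinearMap.pi_ext' fun j => LinearMap.ext_ring ?_
    simp only [LinearMap.comp_apply, LinearMap.id_apply, LinearMap.single_apply]
    rw [hG, Finset.sum_eq_single j]
    · simp only [Pi.single_eq_same, one_smul, F, Derivation.liftKaehlerDifferential_comp_D, hD]
      congr 1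
      ext i
      by_cases hij : i = j
      · subst hij; simp [hy.pderiv_self]
      · simp [hy.pderiv_of_ne (Ne.symm hij), hij]
    · intro i _ hij
      simp [hij]
    · simp
  · apply Derivation.liftKaehlerDifferential_unique
    ext b
    change G (F (KaehlerDifferential.D A B b)) = KaehlerDifferential.D A B b
    simp only [F, Derivation.liftKaehlerDifferential_comp_D, hD]
    rw [hG, ← hchain]

end Kaehler

variable {V W : Type u} [CommRing V] [CommRing W] [IsDomain V] [IsDomain W]
  [IsDiscreteValuationRing V] [IsDiscreteValuationRing W] [Algebra V W]
  {K L : Type*} [Field K] [Field L] [Algebra V K] [IsFractionRing V K] [Algebra W L]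
  [IsFractionRing W L] [Algebra K L] [FiniteDimensional K L] [Algebra.IsSeparable K L] [CharP K p]

/-- The divisor of the extension of a `p^{-e}`-linear map to a finite separable extension. -/
theorem hasDivisor_extension
    (hc : ∀ v : V, algebraMap W L (algebraMap V W v) = algebraMap K L (algebraMap V K v))
    (hV : FrobeniusFinite p V) (hW : FrobeniusFinite p W) {ρ : ℤ}
    (hρ : ∀ f : K, f ≠ 0 → vord W (algebraMap K L f) = ρ * vord V f) {e : ℕ} {Φ : K →+ K}
    (hΦ : Φ ∈ pInvLinearMaps p e K K K) {Ψ : L →+ L} (hΨ : Ψ ∈ pInvLinearMaps p e L L L)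
    (hext : ∀ k, Ψ (algebraMap K L k) = algebraMap K L (Φ k)) {d : ℤ} (hd : HasDivisor V Φ d) :
    HasDivisor W Ψ (ρ * d -
      (p ^ e - 1) * ((Module.length W (KaehlerDifferential V W)).toNat : ℤ)) := by
  classical
  have hp := (Fact.out : p.Prime)
  have : CharP L p := charP_of_injective_algebraMap (algebraMap K L).injective p
  have : CharP V p := charP_of_isFractionRing (K := K)
  have : CharP W p := charP_of_isFractionRing (K := L)
  obtain ⟨κ, _, x₀, hx₀⟩ := exists_isPBasis_of_dvr hV
  obtain ⟨ι, _, y, hy⟩ := exists_isPBasis_of_dvr hW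
  have hyL : IsPBasis p (fun i => algebraMap W L (y i)) := hy.isFractionRing
  -- A `p`-basis of `V` remains a `p`-basis of `L`, so the relative Jacobian matrix is square.
  have hcard : Fintype.card ι = Fintype.card κ := by
    have h0 : IsPBasis p (fun i => algebraMap V K (x₀ i)) := hx₀.isFractionRing
    have h1 : IsPBasis p (fun i => algebraMap K L (algebraMap V K (x₀ i))) := h0.of_isSeparable
    exact hyL.card_eq h1
  obtain ⟨σ⟩ : Nonempty (ι ≃ κ) := Fintype.card_eq.mp hcard
  let x : ι → V := fun i => x₀ (σ i)
  have hx : IsPBasis p x := hx₀.reindex σ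
  have hxK : IsPBasis p (fun i => algebraMap V K (x i)) := hx.isFractionRing
  have hxL : IsPBasis p (fun i => algebraMap K L (algebraMap V K (x i))) := hxK.of_isSeparable
  let M := relJacobian x hy
  have hMJ : algebraMap W L M.det = (hyL.jacobian fun i => algebraMap K L (algebraMap V K (x i))).det := by
    rw [RingHom.map_det]
    congr 1
    ext i j
    simp only [RingHom.mapMatrix_apply, Matrix.map_apply, IsPBasis.jacobian, Matrix.of_apply, M,
      relJacobian]
    rw [← hy.pderiv_map (algebraMap W L) hyL, hc]
  set J := (hyL.jacobian fun i => algebraMap K L (algebraMap V K (x i))).det with hJ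
  have hJ0 : J ≠ 0 := hyL.det_jacobian_ne_zero hxL
  have hM0 : M.det ≠ 0 := by
    intro h0
    rw [h0, map_zero] at hMJ
    exact hJ0 hMJ.symm
  obtain ⟨n, hn1, hn2⟩ := length_quotient_span_range (K := L) M hM0
  rw [(kaehlerEquiv hx hy).length_eq, hn1, ENat.toNat_natCast]
  obtain ⟨g, hg⟩ := hxK.exists_eq_thetaPow_mul e Φ hΦ
  have hg0 : g ≠ 0 := by
    rintro rfl
    apply hd.ne_zero
    ext f
    simp [hg]
  have hdg : d = vord V g := by
    have h1 := (hasDivisor_thetaPow hx hxK e).comp_mul hg0 hg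
    rw [zero_add] at h1
    exact le_antisymm (h1.le fun f hf h => hd.apply_mem hf h)
      (hd.le fun f hf h => h1.apply_mem hf h)
  have hg0' : algebraMap K L g ≠ 0 := by simpa using hg0
  -- By uniqueness `Ψ` has the same expression over `L` as `Φ` over `K` in the `p`-basis of `V`.
  -- Passing to the `p`-basis of `W` costs `J ^ (1 - p ^ e)`, which is the ramification term.
  have hΨeq : ∀ f, Ψ f = hyL.thetaPow e ((J * (J ^ p ^ e)⁻¹ * algebraMap K L g) * f) := by
    have h1 : Ψ = (hxL.thetaPow e).comp (AddMonoidHom.mulLeft (algebraMap K L g)) := by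
      refine extension_unique (K := K) hΨ (pInv_comp_mulLeft (hxL.thetaPow_mem e) _) fun k => ?_
      rw [hext, hg, AddMonoidHom.comp_apply, AddMonoidHom.coe_mulLeft, ← map_mul,
        hxK.thetaPow_map (algebraMap K L) hxL]
    intro f
    have h2 := hyL.thetaPow_mul_det_jacobian hxL e (algebraMap K L g * f)
    rw [← hJ] at h2
    have h3 : J * (J ^ p ^ e)⁻¹ * algebraMap K L g * f =
        (J⁻¹) ^ p ^ e * (J * (algebraMap K L g * f)) := by
      rw [inv_pow]; ring
    rw [h3, IsPBasis.thetaPow_pow_mul, ← h2, h1]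
    simp only [AddMonoidHom.comp_apply, AddMonoidHom.coe_mulLeft]
    field_simp
  have hJp : J ^ p ^ e ≠ 0 := pow_ne_zero _ hJ0
  have h4 := (hasDivisor_thetaPow hy hyL e).comp_mul
    (mul_ne_zero (mul_ne_zero hJ0 (inv_ne_zero hJp)) hg0') hΨeq
  rw [vord_mul (mul_ne_zero hJ0 (inv_ne_zero hJp)) hg0', vord_mul hJ0 (inv_ne_zero hJp),
    vord_inv hJp, vord_pow hJ0, hρ g hg0, ← hdg, ← hMJ, hn2] at h4
  convert h4 using 1
  push_cast
  ring

/-- The order function of an extension of discrete valuation rings is a multiple of the order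
function of the smaller ring. -/
lemma vord_algebraMap_eq
    (hc : ∀ v : V, algebraMap W L (algebraMap V W v) = algebraMap K L (algebraMap V K v))
    {t : K} (ht : vord V t = 1) {f : K} (hf : f ≠ 0) :
    vord W (algebraMap K L f) = vord W (algebraMap K L t) * vord V f := by
  have ht0 : t ≠ 0 := by
    rintro rfl
    simp [vord, WithZero.unzeroD] at ht
  have key : ∀ g : K, g ≠ 0 → vord V g = 0 → vord W (algebraMap K L g) = 0 := by
    have h1 : ∀ g : K, g ≠ 0 → 0 ≤ vord V g → 0 ≤ vord W (algebraMap K L g) := by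
      intro g hg h
      obtain ⟨v, rfl⟩ := (vord_nonneg_iff hg).mp h
      rw [← hc]
      exact vord_algebraMap_nonneg _
    intro g hg h
    refine le_antisymm ?_ (h1 g hg h.ge)
    have h2 := h1 g⁻¹ (inv_ne_zero hg) (by rw [vord_inv hg, h, neg_zero])
    rw [map_inv₀, vord_inv (by simpa using hg)] at h2
    linarith
  have hz : t ^ (- vord V f) ≠ 0 := zpow_ne_zero _ ht0
  have h1 := key (f * t ^ (- vord V f)) (mul_ne_zero hf hz) (by
    rw [vord_mul hf hz, vord_zpow ht0, ht]; ring)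
  rw [map_mul, vord_mul (by simpa using hf) ((map_ne_zero _).mpr hz), map_zpow₀,
    vord_zpow (by simpa using ht0)] at h1
  linarith

end Ramification

/-! ### Regularity in codimension one -/

/-- A fraction that does not belong to a Noetherian normal domain fails to belong to the
localization at a prime of height one. -/
theorem exists_height_eq_one_of_not_mem {R K : Type*} [CommRing R] [IsDomain R]
    [IsNoetherianRing R] [IsIntegrallyClosed R] [Field K] [Algebra R K] [IsFractionRing R K]
    {f : K} (hf : ∀ r : R, algebraMap R K r ≠ f) :
    ∃ P : Ideal R, P.IsPrime ∧ P.height = 1 ∧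
      ∀ a s : R, s ∉ P → algebraMap R K s * f ≠ algebraMap R K a := by
  obtain ⟨a, b, hb, rfl⟩ := IsFractionRing.div_surjective (A := R) f
  have hb0 : b ≠ 0 := nonZeroDivisors.ne_zero hb
  have hbK : algebraMap R K b ≠ 0 := by simpa using hb0
  have hmem : ∀ c : R, (Ideal.Quotient.mk (Ideal.span {b}) c = 0) ↔ ∃ r, c = r * b := by
    intro c
    rw [Ideal.Quotient.eq_zero_iff_mem, Ideal.mem_span_singleton']
    exact exists_congr fun _ => eq_comm
  have ha : Ideal.Quotient.mk (Ideal.span {b}) a ≠ 0 := by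
    rw [Ne, hmem]
    rintro ⟨r, rfl⟩
    exact hf r (by rw [map_mul]; field_simp)
  obtain ⟨P, hP, hle⟩ := exists_le_isAssociatedPrime_of_isNoetherianRing R
    (M := R ⧸ Ideal.span {b}) _ ha
  obtain ⟨hprime, x, hx⟩ := isAssociatedPrime_iff.mp hP
  obtain ⟨c, rfl⟩ := Ideal.Quotient.mk_surjective x
  have hP' : ∀ r : R, r ∈ P ↔ ∃ w, r * c = w * b := by
    intro r
    rw [hx, Submodule.mem_colon_singleton, Submodule.mem_bot, ← hmem, map_mul]
    rfl
  have hbP : b ∈ P := (hP' b).2 ⟨c, mul_comm _ _⟩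
  have hPbot : P ≠ ⊥ := by
    rintro rfl
    exact hb0 (by simpa using hbP)
  refine ⟨P, hprime, le_antisymm ?_ ?_, ?_⟩
  -- Here `P` is the annihilator of the class of `c` modulo `b`. If `c / b` mapped `P` into itself,
  -- it would be integral, hence in `R`, and `1` would lie in `P`. The element `y` thus generates
  -- `P` after localization, and Krull's principal ideal theorem bounds the height.
  · obtain ⟨y, hy, u, hyu, hu⟩ : ∃ y ∈ P, ∃ u, y * c = u * b ∧ u ∉ P := by
      by_contra! hcon
      have hIntegral : IsIntegral R (algebraMap R K c / algebraMap R K b) := by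
        refine isIntegral_of_smul_mem_submodule (M := K)
          (Submodule.map (Algebra.linearMap R K) P) ?_
          ((IsNoetherian.noetherian P).map _) _ ?_
        · intro h
          have hmem : algebraMap R K b ∈ Submodule.map (Algebra.linearMap R K) P := ⟨b, hbP, rfl⟩
          rw [h] at hmem
          exact hbK hmem
        · rintro _ ⟨z, hz, rfl⟩
          obtain ⟨u, hu⟩ := (hP' z).1 hz
          refine ⟨u, hcon z hz u hu, ?_⟩
          have := congrArg (algebraMap R K) hu
          simp only [map_mul] at this
          simp only [Algebra.linearMap_apply, smul_eq_mul]
          field_simp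
          linear_combination -this
      obtain ⟨r, hr⟩ := IsIntegrallyClosed.isIntegral_iff.mp hIntegral
      have h1 : (1 : R) ∈ P := by
        rw [hP']
        refine ⟨r, IsFractionRing.injective R K ?_⟩
        rw [map_mul, map_mul, hr]
        field_simp
        simp
      exact hprime.ne_top ((Ideal.eq_top_iff_one _).2 h1)
    refine Ideal.height_le_one_of_isPrincipal_of_mem_minimalPrimes (Ideal.span {y}) P ?_
    refine ⟨⟨hprime, by simpa [Ideal.span_le] using hy⟩, ?_⟩
    rintro Q ⟨hQ, hyQ⟩ hQP w hw
    obtain ⟨v, hv⟩ := (hP' w).1 hw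
    have hkey : w * u = v * y := by
      apply mul_right_cancel₀ hb0
      calc w * u * b = w * (y * c) := by rw [hyu]; ring
        _ = (w * c) * y := by ring
        _ = v * y * b := by rw [hv]; ring
    have : w * u ∈ Q := hkey ▸ Q.mul_mem_left _ (by simpa [Ideal.span_le] using hyQ)
    exact (hQ.mem_or_mem this).resolve_right fun h => hu (hQP h)
  · rw [Order.one_le_iff_pos, pos_iff_ne_zero, Ne, Ideal.height_eq_zero_iff,
      IsDomain.minimalPrimes_eq_singleton_bot]
    exact hPbot
  · intro a' s hs h
    apply hs
    apply hle
    rw [Submodule.mem_colon_singleton, Submodule.mem_bot]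
    change Ideal.Quotient.mk (Ideal.span {b}) (s * a) = 0
    rw [hmem]
    refine ⟨a', IsFractionRing.injective R K ?_⟩
    rw [map_mul, map_mul, ← h]
    field_simp

/-! ### Stalks as subrings of the function field -/

section Schemes

variable {X : Scheme.{u}} [IsIntegral X]

/-- The rational functions that are regular at `x`. -/
def stalkSubring (x : X) : Subring X.functionField :=
  (algebraMap (X.presheaf.stalk x) X.functionField).range

lemma algebraMap_stalkSpecializes {x y : X} (h : x ⤳ y) (r : X.presheaf.stalk y) :
    algebraMap (X.presheaf.stalk x) X.functionField ((X.presheaf.stalkSpecializes h).hom r) =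
      algebraMap (X.presheaf.stalk y) X.functionField r := by
  change ((X.presheaf.stalkSpecializes h) ≫ (X.presheaf.stalkSpecializes _)).hom r = _
  rw [TopCat.Presheaf.stalkSpecializes_comp]
  rfl

lemma stalkSubring_anti {x y : X} (h : x ⤳ y) : stalkSubring y ≤ stalkSubring x := by
  rintro _ ⟨r, rfl⟩
  exact ⟨_, algebraMap_stalkSpecializes h r⟩

lemma mem_primeIdealOf_iff {U : X.Opens} (hU : IsAffineOpen U) (x : U) (s : Γ(X, U)) :
    s ∉ (hU.primeIdealOf x).asIdeal ↔ x.1 ∈ X.basicOpen s := by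
  have := hU.isLocalization_stalk x
  rw [X.mem_basicOpen s x.1 x.2]
  exact (IsLocalization.AtPrime.isUnit_to_map_iff (X.presheaf.stalk x.1)
    (hU.primeIdealOf x).asIdeal s).symm

lemma germToFunctionField_mem_stalkSubring {U : X.Opens} [Nonempty U] {x : X} (hx : x ∈ U)
    (a : Γ(X, U)) : algebraMap _ X.functionField a ∈ stalkSubring x :=
  ⟨X.presheaf.germ U x hx a, Scheme.algebraMap_germ_eq_germToFunctionField X hx a⟩

lemma inv_mem_stalkSubring {U : X.Opens} [Nonempty U] {x : X} {s : Γ(X, U)}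
    (hs : x ∈ X.basicOpen s) : (algebraMap _ X.functionField s)⁻¹ ∈ stalkSubring x := by
  have hx : x ∈ U := X.basicOpen_le s hs
  have hu := (X.mem_basicOpen s x hx).1 hs
  obtain ⟨v, hv⟩ := hu.exists_right_inv
  refine ⟨v, eq_inv_of_mul_eq_one_right ?_⟩
  have := congrArg (algebraMap _ X.functionField) hv
  rw [map_mul, map_one, Scheme.algebraMap_germ_eq_germToFunctionField] at this
  exact this

lemma mem_stalkSubring_iff {U : X.Opens} (hU : IsAffineOpen U) [Nonempty U] {x : X} (hx : x ∈ U)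
    {f : X.functionField} :
    f ∈ stalkSubring x ↔ ∃ a s : Γ(X, U), x ∈ X.basicOpen s ∧
      algebraMap _ X.functionField s * f = algebraMap _ X.functionField a := by
  constructor
  · rintro ⟨r, rfl⟩
    let : Algebra Γ(X, U) (X.presheaf.stalk x) := X.presheaf.algebra_section_stalk ⟨x, hx⟩
    have : IsLocalization.AtPrime (X.presheaf.stalk x) (hU.primeIdealOf ⟨x, hx⟩).asIdeal :=
      hU.isLocalization_stalk ⟨x, hx⟩
    obtain ⟨⟨a, s⟩, h⟩ := IsLocalization.surj (hU.primeIdealOf ⟨x, hx⟩).asIdeal.primeCompl r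
    refine ⟨a, s, (mem_primeIdealOf_iff hU ⟨x, hx⟩ s).1 s.2, ?_⟩
    have h' := congrArg (algebraMap _ X.functionField) h
    rw [map_mul] at h'
    have key : ∀ c : Γ(X, U), algebraMap (X.presheaf.stalk x) X.functionField
        (algebraMap Γ(X, U) (X.presheaf.stalk x) c) = algebraMap _ _ c :=
      fun c => Scheme.algebraMap_germ_eq_germToFunctionField X hx c
    rw [← key, ← key, mul_comm]
    exact h'
  · rintro ⟨a, s, hs, h⟩
    have hs0 : algebraMap _ X.functionField s ≠ 0 := by
      intro h0
      have h1 := (X.mem_basicOpen s x hx).1 hs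
      have := (h1.map (algebraMap _ X.functionField)).ne_zero
      rw [Scheme.algebraMap_germ_eq_germToFunctionField] at this
      exact this h0
    have : f = (algebraMap _ X.functionField s)⁻¹ * algebraMap _ X.functionField a := by
      rw [← h]; field_simp
    rw [this]
    exact (stalkSubring x).mul_mem (inv_mem_stalkSubring hs)
      (germToFunctionField_mem_stalkSubring hx a)

lemma coheight_eq_height {U : X.Opens} (hU : IsAffineOpen U) (x : U) :
    coheight x.1 = (hU.primeIdealOf x).asIdeal.height := by
  have := hU.isLocalization_stalk x
  have h := IsLocalization.AtPrime.ringKrullDim_eq_height (hU.primeIdealOf x).asIdeal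
    (X.presheaf.stalk x.1)
  rw [ringKrullDim_stalk_eq_coheight] at h
  exact_mod_cast h

lemma exists_primeIdealOf_eq {U : X.Opens} (hU : IsAffineOpen U) (P : PrimeSpectrum Γ(X, U)) :
    ∃ x : U, hU.primeIdealOf x = P := by
  have hmem : hU.fromSpec P ∈ U := by
    have : hU.fromSpec P ∈ Set.range hU.fromSpec := ⟨P, rfl⟩
    rwa [hU.range_fromSpec] at this
  refine ⟨⟨_, hmem⟩, hU.fromSpec.isOpenEmbedding.injective ?_⟩
  rw [hU.fromSpec_primeIdealOf]

lemma primeIdealOf_le_iff {U : X.Opens} (hU : IsAffineOpen U) (x y : U) :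
    (hU.primeIdealOf x).asIdeal ≤ (hU.primeIdealOf y).asIdeal ↔ x.1 ⤳ y.1 := by
  have h := hU.fromSpec.isOpenEmbedding.isInducing.specializes_iff
    (x := hU.primeIdealOf x) (y := hU.primeIdealOf y)
  rw [hU.fromSpec_primeIdealOf x, hU.fromSpec_primeIdealOf y] at h
  exact (PrimeSpectrum.le_iff_specializes _ _).trans h.symm

lemma primeIdealOf_injective {U : X.Opens} (hU : IsAffineOpen U) :
    Function.Injective hU.primeIdealOf := by
  intro x y h
  apply Subtype.ext
  rw [← hU.fromSpec_primeIdealOf x, h, hU.fromSpec_primeIdealOf y]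

/-- Every point has an affine neighbourhood. -/
lemma exists_isAffineOpen_mem (x : X) (V : X.Opens) (hx : x ∈ V) :
    ∃ U : X.Opens, IsAffineOpen U ∧ x ∈ U ∧ U ≤ V := by
  obtain ⟨_, ⟨A, hA, rfl⟩, hxA, hAU⟩ :=
    X.isBasis_affineOpens.exists_subset_of_mem_open hx V.isOpen
  exact ⟨A, hA, hxA, hAU⟩

variable [IsNoetherian X] [IsNormalScheme X]

lemma ord_eq_vord {E : X} (hE : coheight E = 1) [IsDiscreteValuationRing (X.presheaf.stalk E)]
    (f : X.functionField) : X.ord f E = vord (X.presheaf.stalk E) f :=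
  Scheme.ord_eq_ordHom_of_coheight_eq_one hE f

lemma ord_nonneg_iff {E : X} (hE : coheight E = 1) {f : X.functionField} (hf : f ≠ 0) :
    0 ≤ X.ord f E ↔ f ∈ stalkSubring E := by
  have := isDiscreteValuationRing_stalk hE
  rw [ord_eq_vord hE, vord_nonneg_iff hf]
  rfl

/-- A rational function that is regular at the points of codimension one is regular. -/
theorem mem_stalkSubring_of_codim_one {x : X} {f : X.functionField}
    (h : ∀ E : X, E ⤳ x → coheight E = 1 → f ∈ stalkSubring E) : f ∈ stalkSubring x := by
  by_contra hf
  have := IsNormalScheme.isIntegrallyClosed_stalk x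
  obtain ⟨P, hP, hht, hPf⟩ := exists_height_eq_one_of_not_mem
    (R := X.presheaf.stalk x) (f := f) (fun r hr => hf ⟨r, hr⟩)
  obtain ⟨U, hU, hx, -⟩ := exists_isAffineOpen_mem x ⊤ trivial
  have : Nonempty U := ⟨⟨x, hx⟩⟩
  let : Algebra Γ(X, U) (X.presheaf.stalk x) := X.presheaf.algebra_section_stalk ⟨x, hx⟩
  have : IsLocalization.AtPrime (X.presheaf.stalk x) (hU.primeIdealOf ⟨x, hx⟩).asIdeal :=
    hU.isLocalization_stalk ⟨x, hx⟩
  have hht' := IsLocalization.height_under (hU.primeIdealOf ⟨x, hx⟩).asIdeal.primeCompl P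
  obtain ⟨E, hE⟩ := exists_primeIdealOf_eq hU
    ⟨P.comap (X.presheaf.germ U x hx).hom, hP.comap _⟩
  have hEx : E.1 ⤳ x := by
    rw [← primeIdealOf_le_iff hU E ⟨x, hx⟩, hE]
    intro s hs
    by_contra hs'
    rw [mem_primeIdealOf_iff, X.mem_basicOpen s x hx] at hs'
    exact hP.ne_top (Ideal.eq_top_of_isUnit_mem _ hs hs')
  have hE1 : coheight E.1 = 1 := by
    rw [coheight_eq_height hU, hE, ← hht, ← hht']
    rfl
  obtain ⟨a, s, hs, has⟩ := (mem_stalkSubring_iff hU E.2).1 (h E.1 hEx hE1)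
  refine hPf (X.presheaf.germ U x hx a) (X.presheaf.germ U x hx s) ?_ ?_
  · rw [← mem_primeIdealOf_iff hU, hE] at hs
    exact hs
  · rw [Scheme.algebraMap_germ_eq_germToFunctionField, Scheme.algebraMap_germ_eq_germToFunctionField]
    exact has

end Schemes

variable {p : ℕ} [Fact p.Prime]

/-! ### Extending maps to the fraction field -/

/-- With `q = p ^ e`, the identity `a / s = (a * s ^ (q - 1)) / s ^ q` forces the value `φ (a * s ^
(q - 1)) / s`; `hF` shows that it does not depend on the fraction. -/
lemma exists_pInv_extension {R K : Type*} [CommRing R] [IsDomain R] [Field K] [Algebra R K]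
    [IsFractionRing R K] {e : ℕ} (φ : R →+ K)
    (hφ : ∀ r a : R, φ (r ^ p ^ e * a) = algebraMap R K r * φ a) :
    ∃ Φ ∈ pInvLinearMaps p e K K K, ∀ a, Φ (algebraMap R K a) = φ a := by
  have hq : 0 < p ^ e := pow_pos (Fact.out : p.Prime).pos e
  have hinj := IsFractionRing.injective R K
  have hfrac : ∀ f : K, ∃ a s : R, s ≠ 0 ∧ algebraMap R K s * f = algebraMap R K a := by
    intro f
    obtain ⟨a, s, hs, rfl⟩ := IsFractionRing.div_surjective (A := R) f
    have hs0 := nonZeroDivisors.ne_zero hs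
    have : algebraMap R K s ≠ 0 := by simpa using hs0
    exact ⟨a, s, hs0, by field_simp⟩
  choose num den hden hnum using hfrac
  let F : K → K := fun f => φ (num f * den f ^ (p ^ e - 1)) / algebraMap R K (den f)
  have hF : ∀ (f : K) (a s : R), s ≠ 0 → algebraMap R K s * f = algebraMap R K a →
      algebraMap R K s * F f = φ (a * s ^ (p ^ e - 1)) := by
    intro f a s hs h
    have hd : algebraMap R K (den f) ≠ 0 := by simpa using hden f
    have hcross : a * den f = num f * s := by
      apply hinj
      rw [map_mul, map_mul, ← h, ← hnum f]
      ring
    have h1 : algebraMap R K s * φ (num f * den f ^ (p ^ e - 1)) =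
        algebraMap R K (den f) * φ (a * s ^ (p ^ e - 1)) := by
      rw [← hφ, ← hφ]
      congr 1
      obtain ⟨k, hk⟩ : ∃ k, p ^ e = k + 1 := ⟨p ^ e - 1, by omega⟩
      rw [hk, Nat.add_sub_cancel]
      linear_combination -(s ^ k * den f ^ k) * hcross
    change _ * (_ / _) = _
    rw [← mul_div_assoc, h1]
    field_simp
  have hF0 : ∀ (f g : K) (s : R), s ≠ 0 → algebraMap R K s * g = algebraMap R K s * f → g = f := by
    intro f g s hs h
    exact mul_left_cancel₀ (by simpa using hs) h
  refine ⟨AddMonoidHom.mk' F ?_, ?_, ?_⟩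
  · intro f g
    apply hF0 _ _ (den f * den g) (mul_ne_zero (hden f) (hden g))
    rw [hF (f + g) (num f * den g + num g * den f) _ (mul_ne_zero (hden f) (hden g)) ?_, mul_add,
      hF f (num f * den g) _ (mul_ne_zero (hden f) (hden g)) ?_,
      hF g (num g * den f) _ (mul_ne_zero (hden f) (hden g)) ?_, ← map_add]
    · congr 1
      ring
    · simp only [map_mul]
      linear_combination (algebraMap R K (den f)) * hnum g
    · simp only [map_mul]
      linear_combination (algebraMap R K (den g)) * hnum f
    · simp only [map_mul, map_add]
      linear_combination (algebraMap R K (den g)) * hnum f + (algebraMap R K (den f)) * hnum g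
  · intro r f
    simp only [smul_eq_mul, AddMonoidHom.mk'_apply]
    have h0 : den r * den f ≠ 0 := mul_ne_zero (hden r) (hden f)
    apply hF0 _ _ _ h0
    have hk : p ^ e = (p ^ e - 1) + 1 := by omega
    have e1 : algebraMap R K (den r ^ p ^ e * den f) * (r ^ p ^ e * f) =
        algebraMap R K (num r ^ p ^ e * num f) := by
      simp only [map_mul, map_pow]
      rw [← hnum r, ← hnum f]
      ring
    have h1 := hF _ _ _ (mul_ne_zero (pow_ne_zero (p ^ e) (hden r)) (hden f)) e1
    have h2 := hF f _ _ (hden f) (hnum f)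
    have h3 : num r ^ p ^ e * num f * (den r ^ p ^ e * den f) ^ (p ^ e - 1) =
        (num r * den r ^ (p ^ e - 1)) ^ p ^ e * (num f * den f ^ (p ^ e - 1)) := by
      ring
    rw [h3, hφ, ← h2] at h1
    have hdr : algebraMap R K (den r) ≠ 0 := by simpa using hden r
    have h4 : algebraMap R K (den r ^ (p ^ e - 1)) ≠ 0 := by simpa using fun h => absurd h (hden r)
    apply mul_left_cancel₀ h4
    simp only [map_mul, map_pow] at h1 ⊢
    rw [← hnum r] at h1
    rw [hk, pow_succ] at h1
    rw [← hk] at h1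
    linear_combination h1
  · intro a
    have := hF (algebraMap R K a) a 1 one_ne_zero (by simp)
    simpa using this

lemma exists_lift_addMonoidHom {R K M : Type*} [CommRing R] [Field K] [Algebra R K]
    [IsFractionRing R K] [AddCommGroup M] (g : M →+ K)
    (hg : ∀ m, ∃ r : R, algebraMap R K r = g m) :
    ∃ h : M →+ R, ∀ m, algebraMap R K (h m) = g m := by
  choose h hh using hg
  refine ⟨AddMonoidHom.mk' h fun a b => IsFractionRing.injective R K ?_, hh⟩
  rw [map_add, hh, hh, hh, map_add]

lemma exists_generators_of_finite {A B : Type*} [CommRing A] [CommRing B] (f : A →+* B)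
    (hf : f.Finite) :
    ∃ (n : ℕ) (γ : Fin n → B), ∀ b, ∃ c : Fin n → A, b = ∑ i, f (c i) * γ i := by
  algebraize [f]
  obtain ⟨n, γ, hγ⟩ := Module.Finite.exists_fin (R := A) (M := B)
  refine ⟨n, γ, fun b => ?_⟩
  have hb : b ∈ Submodule.span A (Set.range γ) := hγ ▸ Submodule.mem_top
  obtain ⟨c, hc⟩ := (Submodule.mem_span_range_iff_exists_fun A).1 hb
  exact ⟨c, by rw [← hc]; exact Finset.sum_congr rfl fun i _ => Algebra.smul_def _ _⟩

/-! ### Stalks of `F`-finite schemes, orders of rational functions, multipliers -/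

section Schemes

variable {X : Scheme.{u}} [IsIntegral X]

lemma frobeniusFinite_section [IsFFinite p X] {U : X.Opens} (hU : IsAffineOpen U) :
    FrobeniusFinite p Γ(X, U) := by
  obtain ⟨F, hF, hfin⟩ := IsFFinite.finite_frobenius (p := p) ⟨U, hU⟩
  obtain ⟨n, γ, hγ⟩ := exists_generators_of_finite F hfin
  exact ⟨n, γ, fun a => (hγ a).imp fun c hc => by simpa only [hF] using hc⟩

lemma frobeniusFinite_stalk [IsFFinite p X] (x : X) : FrobeniusFinite p (X.presheaf.stalk x) := by
  obtain ⟨U, hU, hx, -⟩ := exists_isAffineOpen_mem x ⊤ trivial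
  let : Algebra Γ(X, U) (X.presheaf.stalk x) := X.presheaf.algebra_section_stalk ⟨x, hx⟩
  have : IsLocalization.AtPrime (X.presheaf.stalk x) (hU.primeIdealOf ⟨x, hx⟩).asIdeal :=
    hU.isLocalization_stalk ⟨x, hx⟩
  exact FrobeniusFinite.of_isLocalization (hU.primeIdealOf ⟨x, hx⟩).asIdeal.primeCompl
    (frobeniusFinite_section hU)

variable [IsNoetherian X] [IsNormalScheme X]

lemma algebraMap_section_ne_zero {U : X.Opens} [Nonempty U] {a : Γ(X, U)} (ha : a ≠ 0) :
    algebraMap _ X.functionField a ≠ 0 :=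
  (map_ne_zero_iff _ (X.germToFunctionField_injective U)).2 ha

lemma ord_section_nonneg {U : X.Opens} [Nonempty U] {E : X} (hE : E ∈ U) (a : Γ(X, U)) :
    0 ≤ X.ord (algebraMap _ X.functionField a) E := by
  by_cases h1 : coheight E = 1
  · by_cases ha : a = 0
    · simp [ha]
    · rw [ord_nonneg_iff h1 (algebraMap_section_ne_zero ha)]
      exact germToFunctionField_mem_stalkSubring hE a
  · simp [h1]

lemma ord_inv {f : X.functionField} (hf : f ≠ 0) (E : X) : X.ord f⁻¹ E = - X.ord f E := by
  by_cases h1 : coheight E = 1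
  · have := isDiscreteValuationRing_stalk h1
    rw [ord_eq_vord h1, ord_eq_vord h1, vord_inv hf]
  · simp [h1]

lemma ord_pow {f : X.functionField} (hf : f ≠ 0) (n : ℕ) (E : X) :
    X.ord (f ^ n) E = n * X.ord f E := by
  by_cases h1 : coheight E = 1
  · have := isDiscreteValuationRing_stalk h1
    rw [ord_eq_vord h1, ord_eq_vord h1, vord_pow hf]
  · simp [h1]

lemma ne_zero_of_mem_basicOpen {U : X.Opens} {s : Γ(X, U)} {x : X} (h : x ∈ X.basicOpen s) :
    s ≠ 0 := by
  rintro rfl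
  simp at h

lemma ord_eq_zero_of_mem_basicOpen {U : X.Opens} [Nonempty U] {E : X} {a : Γ(X, U)}
    (h : E ∈ X.basicOpen a) : X.ord (algebraMap _ X.functionField a) E = 0 := by
  have ha := algebraMap_section_ne_zero (ne_zero_of_mem_basicOpen h)
  refine le_antisymm ?_ (ord_section_nonneg (X.basicOpen_le a h) a)
  by_cases h1 : coheight E = 1
  · have := (ord_nonneg_iff h1 (inv_ne_zero ha)).2 (inv_mem_stalkSubring h)
    rw [ord_inv ha] at this
    linarith
  · simp [h1]

lemma ord_pos_of_not_mem_basicOpen {U : X.Opens} [Nonempty U] {E : X}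
    (hE : E ∈ U) (h1 : coheight E = 1) {a : Γ(X, U)} (ha0 : a ≠ 0)
    (h : E ∉ X.basicOpen a) : 0 < X.ord (algebraMap _ X.functionField a) E := by
  have ha := algebraMap_section_ne_zero ha0
  refine lt_of_le_of_ne (ord_section_nonneg hE a) fun h0 => h ?_
  have h2 : 0 ≤ X.ord (algebraMap _ X.functionField a)⁻¹ E := by
    rw [ord_inv ha]; linarith
  obtain ⟨v, hv⟩ := (ord_nonneg_iff h1 (inv_ne_zero ha)).1 h2
  rw [X.mem_basicOpen a E hE]
  refine IsUnit.of_mul_eq_one v (IsFractionRing.injective (X.presheaf.stalk E) X.functionField ?_)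
  rw [map_mul, hv, map_one, Scheme.algebraMap_germ_eq_germToFunctionField]
  exact mul_inv_cancel₀ ha

/-- Such divisors are height one primes containing `a`, hence minimal over `(a)`, and there are
finitely many of those. -/
lemma finite_ord_section_ne_zero {U : X.Opens} (hU : IsAffineOpen U) [Nonempty U] {a : Γ(X, U)}
    (ha : a ≠ 0) :
    {E : X | E ∈ U ∧ coheight E = 1 ∧ X.ord (algebraMap _ X.functionField a) E ≠ 0}.Finite := by
  have : IsNoetherianRing Γ(X, U) := IsLocallyNoetherian.component_noetherian ⟨U, hU⟩
  have hfin := Ideal.finite_minimalPrimes_of_isNoetherianRing Γ(X, U) (Ideal.span {a})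
  have : {E : U | (hU.primeIdealOf E).asIdeal ∈ (Ideal.span {a}).minimalPrimes}.Finite :=
    hfin.preimage fun x _ y _ h => primeIdealOf_injective hU (PrimeSpectrum.ext h)
  refine (this.image Subtype.val).subset ?_
  rintro E ⟨hEU, hE1, hE⟩
  have haE : a ∈ (hU.primeIdealOf ⟨E, hEU⟩).asIdeal := by
    by_contra h
    exact hE (ord_eq_zero_of_mem_basicOpen ((mem_primeIdealOf_iff hU ⟨E, hEU⟩ a).1 h))
  refine ⟨⟨E, hEU⟩, ⟨⟨(hU.primeIdealOf ⟨E, hEU⟩).2, by simpa [Ideal.span_le] using haE⟩, ?_⟩, rfl⟩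
  rintro Q ⟨hQ, haQ⟩ hle
  by_contra hne
  have hlt : Q < (hU.primeIdealOf ⟨E, hEU⟩).asIdeal := lt_of_le_not_ge hle hne
  have h1 := coheight_eq_height hU ⟨E, hEU⟩
  rw [hE1] at h1
  have hQ0 : Q.height ≠ 0 := by
    rw [Ne, Ideal.height_eq_zero_iff, IsDomain.minimalPrimes_eq_singleton_bot]
    rintro rfl
    exact ha (by simpa using haQ)
  have : Q.FiniteHeight := inferInstance
  have := Ideal.height_strict_mono_of_isPrime hlt
  rw [← h1, Order.lt_one_iff] at this
  exact hQ0 this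

lemma finite_ord_ne_zero {U : X.Opens} (hU : IsAffineOpen U) [Nonempty U] {f : X.functionField}
    (hf : f ≠ 0) : {E : X | E ∈ U ∧ coheight E = 1 ∧ X.ord f E ≠ 0}.Finite := by
  have := functionField_isFractionRing_of_isAffineOpen X U hU
  obtain ⟨a, b, hb, rfl⟩ := IsFractionRing.div_surjective (A := Γ(X, U)) f
  have hb0 := nonZeroDivisors.ne_zero hb
  have ha0 : a ≠ 0 := by
    rintro rfl
    simp at hf
  refine ((finite_ord_section_ne_zero hU ha0).union (finite_ord_section_ne_zero hU hb0)).subset ?_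
  rintro E ⟨hEU, hE1, hE⟩
  rw [div_eq_mul_inv, Scheme.ord_mul (algebraMap_section_ne_zero ha0)
    (inv_ne_zero (algebraMap_section_ne_zero hb0)), ord_inv (algebraMap_section_ne_zero hb0)] at hE
  by_cases h : X.ord (algebraMap _ X.functionField a) E = 0
  · exact Or.inr ⟨hEU, hE1, fun h' => hE (by rw [h, h']; simp)⟩
  · exact Or.inl ⟨hEU, hE1, h⟩

/-- A function on an affine open set that does not vanish at the prime divisor `E` and vanishes to
prescribed order along finitely many other prime divisors. -/
lemma exists_multiplier {U : X.Opens} (hU : IsAffineOpen U) [Nonempty U] {E : X} (hEU : E ∈ U)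
    (hE : coheight E = 1) (g : X → ℤ) (hg : {C : X | C ∈ U ∧ coheight C = 1 ∧ g C < 0}.Finite) :
    ∃ r : Γ(X, U), E ∈ X.basicOpen r ∧ ∀ C ∈ U, coheight C = 1 → C ≠ E →
      0 ≤ X.ord (algebraMap _ X.functionField r) C + g C := by
  classical
  have hr : ∀ C : X, ∃ r : Γ(X, U), E ∈ X.basicOpen r ∧ (C ∈ U → coheight C = 1 → C ≠ E →
      0 < X.ord (algebraMap _ X.functionField r) C) := by
    intro C
    by_cases hC : C ∈ U ∧ coheight C = 1 ∧ C ≠ E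
    · obtain ⟨hCU, hC1, hCE⟩ := hC
      have hnle : ¬ (hU.primeIdealOf ⟨C, hCU⟩).asIdeal ≤ (hU.primeIdealOf ⟨E, hEU⟩).asIdeal := by
        intro hle
        have hne : (hU.primeIdealOf ⟨C, hCU⟩).asIdeal ≠ (hU.primeIdealOf ⟨E, hEU⟩).asIdeal := by
          intro h
          have := primeIdealOf_injective hU (PrimeSpectrum.ext h)
          exact hCE (congrArg Subtype.val this)
        have h1 := coheight_eq_height hU ⟨C, hCU⟩
        have h2 := coheight_eq_height hU ⟨E, hEU⟩
        have : IsNoetherianRing Γ(X, U) := IsLocallyNoetherian.component_noetherian ⟨U, hU⟩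
        have := Ideal.height_strict_mono_of_isPrime (lt_of_le_of_ne hle hne)
        rw [← h1, ← h2, hC1, hE] at this
        exact lt_irrefl _ this
      obtain ⟨r, hrC, hrE⟩ := Set.not_subset.1 hnle
      have hrE' := (mem_primeIdealOf_iff hU ⟨E, hEU⟩ r).1 hrE
      refine ⟨r, hrE', fun _ _ _ => ord_pos_of_not_mem_basicOpen hCU hC1
        (ne_zero_of_mem_basicOpen hrE') fun h => ?_⟩
      exact (mem_primeIdealOf_iff hU ⟨C, hCU⟩ r).2 h hrC
    · refine ⟨1, ?_, fun h1 h2 h3 => absurd ⟨h1, h2, h3⟩ hC⟩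
      rw [X.basicOpen_of_isUnit isUnit_one]
      exact hEU
  choose r hrE hr using hr
  let n : X → ℕ := fun C => (- g C).toNat
  have hbasic : ∀ s : Finset X, E ∈ X.basicOpen (∏ C ∈ s, r C ^ n C) := by
    intro s
    rw [X.mem_basicOpen _ E hEU, map_prod]
    refine IsUnit.prod_iff.2 fun C _ => ?_
    rw [map_pow]
    exact ((X.mem_basicOpen _ E hEU).1 (hrE C)).pow _
  refine ⟨∏ C ∈ hg.toFinset, r C ^ n C, hbasic _, ?_⟩
  intro C hCU hC1 hCE
  by_cases hneg : g C < 0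
  · have hmem : C ∈ hg.toFinset := by simp [hCU, hC1, hneg]
    rw [← Finset.mul_prod_erase _ _ hmem, map_mul, map_pow, Scheme.ord_mul
      (pow_ne_zero _ (algebraMap_section_ne_zero (ne_zero_of_mem_basicOpen (hrE C))))
      (algebraMap_section_ne_zero (ne_zero_of_mem_basicOpen (hbasic _))),
      ord_pow (algebraMap_section_ne_zero (ne_zero_of_mem_basicOpen (hrE C)))]
    have h1 := ord_section_nonneg hCU (∏ C ∈ hg.toFinset.erase C, r C ^ n C)
    have h2 := hr C hCU hC1 hCE
    have h3 : ((n C : ℕ) : ℤ) = - g C := Int.toNat_of_nonneg (by linarith)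
    have h4 : ((n C : ℕ) : ℤ) ≤ n C * X.ord (algebraMap _ X.functionField (r C)) C :=
      le_mul_of_one_le_right (by positivity) h2
    linarith
  · have := ord_section_nonneg hCU (∏ C ∈ hg.toFinset, r C ^ n C)
    linarith

end Schemes

/-! ### Sharp `F`-purity in terms of maps on the function field -/

section Schemes

variable {X : Scheme.{u}} [IsIntegral X] [IsNoetherian X]

/-- The `p^{-e}`-linear map `Φ` on the function field sends `𝒪_X(⌈(p^e - 1)Δ⌉)` to `𝒪_X` at the
prime divisors through `x`. -/
def IsAlong (p : ℕ) (Δ : X → ℚ) (e : ℕ) (x : X) (Φ : X.functionField →+ X.functionField) : Prop :=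
  ∀ E : X, E ⤳ x → coheight E = 1 → ∀ f : X.functionField, f ≠ 0 →
    -⌈((p : ℚ) ^ e - 1) * Δ E⌉ ≤ X.ord f E → Φ f ∈ stalkSubring E

/-- Sharp `F`-purity at `x`, witnessed by a `p^{-e}`-linear map on the function field. -/
def IsFPureWith (p : ℕ) (Δ : X → ℚ) (𝔞 : X.IdealSheafData) (t : ℝ) (x : X) (e : ℕ) : Prop :=
  ∃ Φ ∈ pInvLinearMaps p e X.functionField X.functionField X.functionField,
    IsAlong p Δ e x Φ ∧ ∃ a ∈ idealStalk 𝔞 x ^ ⌈t * ((p : ℝ) ^ e - 1)⌉₊,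
      Φ (algebraMap _ X.functionField a) = 1

variable [IsNormalScheme X]

lemma ceil_nonneg_of_isEffective {Δ : X → ℚ} (hΔ : IsEffective Δ) (e : ℕ) {E : X}
    (hE : coheight E = 1) : 0 ≤ ⌈((p : ℚ) ^ e - 1) * Δ E⌉ := by
  have h1 : (1 : ℚ) ≤ (p : ℚ) ^ e :=
    one_le_pow₀ (by exact_mod_cast (Fact.out : p.Prime).one_lt.le)
  exact Int.ceil_nonneg (mul_nonneg (by linarith) (hΔ E hE))

lemma ord_stalk_nonneg {x E : X} (h : E ⤳ x) {f : X.functionField} (hf : f ∈ stalkSubring x) :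
    0 ≤ X.ord f E := by
  by_cases hE : coheight E = 1
  · by_cases hf0 : f = 0
    · simp [hf0]
    · exact (ord_nonneg_iff hE hf0).2 (stalkSubring_anti h hf)
  · simp [hE]

/-- The stalk of the divisorial sheaf constrains all prime divisors through `x` at once, `IsAlong`
only one at a time. A function with the right order along `E` alone is multiplied by `ρ ^ p ^ e`,
where `ρ` repairs the other divisors and does not vanish along `E`; then `ρ` leaves the map and is
divided out. -/
lemma exists_isAlong_of_mem_mapsAlong {Δ : X → ℚ} (hΔ : IsEffective Δ) {e : ℕ} {x : X}
    {φ : X.presheaf.stalk x →+ X.presheaf.stalk x} (hφ : φ ∈ mapsAlong p Δ e x) :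
    ∃ Φ ∈ pInvLinearMaps p e X.functionField X.functionField X.functionField,
      IsAlong p Δ e x Φ ∧ ∀ r, Φ (algebraMap _ X.functionField r) = algebraMap _ _ (φ r) := by
  obtain ⟨hφ, ψ, hψ, hφψ⟩ := hφ
  obtain ⟨Φ, hΦ, hext⟩ := exists_pInv_extension (p := p) (e := e) (K := X.functionField)
    ((algebraMap (X.presheaf.stalk x) X.functionField).toAddMonoidHom.comp φ) (by
      intro r a
      have := hφ r a
      simp only [smul_eq_mul] at this
      simp [this])
  have hq : p ^ e ≠ 0 := (pow_pos (Fact.out : p.Prime).pos e).ne'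
  have hmem : ∀ f ∈ divisorialStalk (fun E => ⌈((p : ℚ) ^ e - 1) * Δ E⌉) x,
      Φ f ∈ stalkSubring x := by
    intro f hf
    obtain ⟨a, s, hs, rfl⟩ := IsFractionRing.div_surjective (A := X.presheaf.stalk x) f
    have hs0 : algebraMap _ X.functionField s ≠ 0 := by simpa using nonZeroDivisors.ne_zero hs
    refine ⟨ψ ⟨_, hf⟩, mul_left_cancel₀ hs0 ?_⟩
    rw [← pInv_pow_mul hΦ, ← map_mul, ← smul_eq_mul, ← hψ s ⟨_, hf⟩]
    have h1 : algebraMap _ X.functionField s ^ p ^ e *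
        (algebraMap _ X.functionField a / algebraMap _ X.functionField s) =
        algebraMap _ X.functionField (s ^ (p ^ e - 1) * a) := by
      rw [map_mul, map_pow]
      nth_rewrite 1 [← Nat.sub_add_cancel (Nat.one_le_iff_ne_zero.2 hq)]
      rw [pow_succ]
      field_simp
    rw [h1, hext]
    obtain ⟨hr, hr'⟩ := hφψ (s ^ (p ^ e - 1) * a)
    change _ = algebraMap _ X.functionField (φ _)
    rw [hr']
    congr 2
    apply Subtype.ext
    refine Eq.trans ?_ h1
    change (s ^ p ^ e) • (_ / _ : X.functionField) = _
    rw [Algebra.smul_def, map_pow]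
  refine ⟨Φ, hΦ, ?_, hext⟩
  intro E hEx hE f hf hord
  obtain ⟨U, hU, hx, -⟩ := exists_isAffineOpen_mem x ⊤ trivial
  have : Nonempty U := ⟨⟨x, hx⟩⟩
  have hEU : E ∈ U := hEx.mem_open U.isOpen hx
  obtain ⟨r, hrE, hr⟩ := exists_multiplier hU hEU hE (fun C => X.ord f C)
    ((finite_ord_ne_zero hU hf).subset fun C hC => ⟨hC.1, hC.2.1, hC.2.2.ne⟩)
  set ρ := algebraMap _ X.functionField r with hρ
  have hρ0 : ρ ≠ 0 := algebraMap_section_ne_zero (ne_zero_of_mem_basicOpen hrE)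
  have hΦx : Φ (ρ ^ p ^ e * f) ∈ stalkSubring x := by
    apply hmem
    intro _ C hCx hC
    have hCU : C ∈ U := hCx.mem_open U.isOpen hx
    rw [Scheme.ord_mul (pow_ne_zero _ hρ0) hf, ord_pow hρ0]
    by_cases hCE : C = E
    · subst hCE
      rw [ord_eq_zero_of_mem_basicOpen hrE]
      linarith
    · have h1 := hr C hCU hC hCE
      have h2 := ord_section_nonneg hCU r
      have h3 := ceil_nonneg_of_isEffective (p := p) hΔ e hC
      have h4 : X.ord ρ C ≤ ((p ^ e : ℕ) : ℤ) * X.ord ρ C :=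
        le_mul_of_one_le_left h2 (by exact_mod_cast Nat.one_le_iff_ne_zero.2 hq)
      linarith
  rw [pInv_pow_mul hΦ] at hΦx
  have := (stalkSubring E).mul_mem (inv_mem_stalkSubring hrE) (stalkSubring_anti hEx hΦx)
  rwa [← hρ, inv_mul_cancel_left₀ hρ0] at this

/-- Values regular along every prime divisor through `x` are regular at `x` by normality. -/
lemma exists_mem_mapsAlong_of_isAlong {Δ : X → ℚ} (hΔ : IsEffective Δ) {e : ℕ} {x : X}
    {Φ : X.functionField →+ X.functionField}
    (hΦ : Φ ∈ pInvLinearMaps p e X.functionField X.functionField X.functionField)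
    (h : IsAlong p Δ e x Φ) :
    ∃ φ ∈ mapsAlong p Δ e x, ∀ r, algebraMap _ X.functionField (φ r) =
      Φ (algebraMap _ X.functionField r) := by
  have hle : ∀ r : X.presheaf.stalk x, algebraMap _ X.functionField r ∈
      divisorialStalk (fun E => ⌈((p : ℚ) ^ e - 1) * Δ E⌉) x := by
    intro r _ E hEx hE
    have h1 := ord_stalk_nonneg hEx (f := algebraMap _ X.functionField r) ⟨r, rfl⟩
    have h2 := ceil_nonneg_of_isEffective (p := p) hΔ e hE
    linarith
  have hmem : ∀ f : divisorialStalk (fun E => ⌈((p : ℚ) ^ e - 1) * Δ E⌉) x,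
      ∃ r, algebraMap (X.presheaf.stalk x) X.functionField r = Φ f.1 := by
    rintro ⟨f, hf⟩
    by_cases hf0 : f = 0
    · exact ⟨0, by simp [hf0]⟩
    refine mem_stalkSubring_of_codim_one fun E hEx hE => h E hEx hE f hf0 ?_
    have := hf hf0 E hEx hE
    linarith
  obtain ⟨ψ, hψ⟩ := exists_lift_addMonoidHom (R := X.presheaf.stalk x)
    (Φ.comp (divisorialStalk (fun E => ⌈((p : ℚ) ^ e - 1) * Δ E⌉) x).subtype.toAddMonoidHom) hmem
  obtain ⟨φ, hφ⟩ := exists_lift_addMonoidHom (R := X.presheaf.stalk x)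
    (Φ.comp (algebraMap (X.presheaf.stalk x) X.functionField).toAddMonoidHom)
    (fun r => hmem ⟨_, hle r⟩)
  have hinj := IsFractionRing.injective (X.presheaf.stalk x) X.functionField
  refine ⟨φ, ⟨?_, ψ, ?_, fun r => ⟨hle r, hinj ((hφ r).trans (hψ ⟨_, hle r⟩).symm)⟩⟩, hφ⟩
  · intro r y
    apply hinj
    rw [hφ, smul_eq_mul, smul_eq_mul, map_mul (algebraMap _ X.functionField), hφ]
    change Φ (algebraMap _ X.functionField _) = _ * Φ (algebraMap _ X.functionField _)
    rw [map_mul (algebraMap _ X.functionField), map_pow, pInv_pow_mul hΦ]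
  · intro r y
    apply hinj
    rw [hψ, smul_eq_mul, map_mul, hψ]
    change Φ ((r ^ p ^ e) • y.1) = _ * Φ y.1
    rw [Algebra.smul_def, map_pow, pInv_pow_mul hΦ]

lemma isSharplyFPureAt_iff {Δ : X → ℚ} (hΔ : IsEffective Δ) (𝔞 : X.IdealSheafData) (t : ℝ)
    (x : X) : IsSharplyFPureAt p Δ 𝔞 t x ↔ ∃ e, 0 < e ∧ IsFPureWith p Δ 𝔞 t x e := by
  constructor
  · rintro ⟨e, he, φ, hφ, a, ha, ha1⟩
    obtain ⟨Φ, hΦ, hal, hext⟩ := exists_isAlong_of_mem_mapsAlong hΔ hφ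
    exact ⟨e, he, Φ, hΦ, hal, a, ha, by rw [hext, ha1, map_one]⟩
  · rintro ⟨e, he, Φ, hΦ, hal, a, ha, ha1⟩
    obtain ⟨φ, hφ, hext⟩ := exists_mem_mapsAlong_of_isAlong hΔ hΦ hal
    refine ⟨e, he, φ, hφ, a, ha, IsFractionRing.injective (X.presheaf.stalk x) X.functionField ?_⟩
    rw [hext, ha1, map_one]

lemma exists_ord_eq_one {E : X} (hE : coheight E = 1) :
    ∃ f : X.functionField, f ≠ 0 ∧ X.ord f E = 1 := by
  have := isDiscreteValuationRing_stalk hE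
  obtain ⟨ϖ, hϖ⟩ := IsDiscreteValuationRing.exists_irreducible (X.presheaf.stalk E)
  refine ⟨algebraMap _ _ ϖ, by simpa using hϖ.ne_zero, ?_⟩
  rw [ord_eq_vord hE, vord_uniformizer hϖ]

lemma ord_zpow {f : X.functionField} (hf : f ≠ 0) (n : ℤ) (E : X) :
    X.ord (f ^ n) E = n * X.ord f E := by
  by_cases h1 : coheight E = 1
  · have := isDiscreteValuationRing_stalk h1
    rw [ord_eq_vord h1, ord_eq_vord h1, vord_zpow hf]
  · simp [h1]

/-- This rests on `p ^ (e + e') - 1 = p ^ e' * (p ^ e - 1) + (p ^ e' - 1)`, with rounding up going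
in the favourable direction. -/
lemma IsAlong.comp {Δ : X → ℚ} {e e' : ℕ} {x : X} {Φ Ψ : X.functionField →+ X.functionField}
    (hΨ : Ψ ∈ pInvLinearMaps p e' X.functionField X.functionField X.functionField)
    (h : IsAlong p Δ e x Φ) (h' : IsAlong p Δ e' x Ψ) : IsAlong p Δ (e + e') x (Φ.comp Ψ) := by
  intro E hEx hE f hf hord
  change Φ (Ψ f) ∈ _
  obtain ⟨ϖ, hϖ, hϖ1⟩ := exists_ord_eq_one hE
  set c := ⌈((p : ℚ) ^ e - 1) * Δ E⌉ with hc
  set c' := ⌈((p : ℚ) ^ e' - 1) * Δ E⌉ with hc'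
  have hceil : ⌈((p : ℚ) ^ (e + e') - 1) * Δ E⌉ ≤ (p ^ e' : ℕ) * c + c' := by
    rw [Int.ceil_le]
    have h1 := Int.le_ceil (((p : ℚ) ^ e - 1) * Δ E)
    have h2 := Int.le_ceil (((p : ℚ) ^ e' - 1) * Δ E)
    have h3 : (0 : ℚ) ≤ (p : ℚ) ^ e' := by positivity
    have h4 := mul_le_mul_of_nonneg_left h1 h3
    push_cast
    rw [← hc] at h4
    rw [← hc'] at h2
    rw [pow_add]
    linarith
  by_cases hz : Ψ f = 0
  · rw [hz, map_zero]
    exact zero_mem _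
  apply h E hEx hE _ hz
  have h1 : Ψ ((ϖ ^ c) ^ p ^ e' * f) ∈ stalkSubring E := by
    apply h' E hEx hE _ (mul_ne_zero (pow_ne_zero _ (zpow_ne_zero _ hϖ)) hf)
    rw [Scheme.ord_mul (pow_ne_zero _ (zpow_ne_zero _ hϖ)) hf, ord_pow (zpow_ne_zero _ hϖ),
      ord_zpow hϖ, hϖ1, ← hc']
    linarith
  rw [pInv_pow_mul hΨ, ← ord_nonneg_iff hE (mul_ne_zero (zpow_ne_zero _ hϖ) hz),
    Scheme.ord_mul (zpow_ne_zero _ hϖ) hz, ord_zpow hϖ, hϖ1] at h1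
  linarith

lemma pInv_comp {K : Type*} [Field K] {e e' : ℕ} {Φ Ψ : K →+ K}
    (hΦ : Φ ∈ pInvLinearMaps p e K K K) (hΨ : Ψ ∈ pInvLinearMaps p e' K K K) :
    Φ.comp Ψ ∈ pInvLinearMaps p (e + e') K K K := by
  intro r f
  simp only [smul_eq_mul, AddMonoidHom.comp_apply]
  rw [pow_add, pow_mul, pInv_pow_mul hΨ, pInv_pow_mul hΦ]

/-- Since `Ψ b = 1`, the composite sends `a ^ p ^ e' * b` to `Φ a = 1`. This is what allows one
exponent `e` to serve a whole fibre. -/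
lemma IsFPureWith.add {Δ : X → ℚ} {𝔞 : X.IdealSheafData} {t : ℝ} {x : X} {e e' : ℕ}
    (h : IsFPureWith p Δ 𝔞 t x e) (h' : IsFPureWith p Δ 𝔞 t x e') :
    IsFPureWith p Δ 𝔞 t x (e + e') := by
  obtain ⟨Φ, hΦ, hal, a, ha, ha1⟩ := h
  obtain ⟨Ψ, hΨ, hal', b, hb, hb1⟩ := h'
  refine ⟨Φ.comp Ψ, pInv_comp hΦ hΨ, hal.comp hΨ hal', a ^ p ^ e' * b, ?_, ?_⟩
  · have h1 := Ideal.mul_mem_mul (Ideal.pow_mem_pow ha (p ^ e')) hb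
    rw [← pow_mul, ← pow_add] at h1
    refine Ideal.pow_le_pow_right ?_ h1
    rw [Nat.ceil_le]
    have h1 := Nat.le_ceil (t * ((p : ℝ) ^ e - 1))
    have h2 := Nat.le_ceil (t * ((p : ℝ) ^ e' - 1))
    have h3 : (0 : ℝ) ≤ (p : ℝ) ^ e' := by positivity
    have h4 := mul_le_mul_of_nonneg_left h1 h3
    push_cast
    rw [pow_add]
    linarith
  · simp only [AddMonoidHom.comp_apply, map_mul, map_pow]
    rw [pInv_pow_mul hΨ, hb1, mul_one, ha1]

lemma IsFPureWith.mul {Δ : X → ℚ} {𝔞 : X.IdealSheafData} {t : ℝ} {x : X} {e : ℕ}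
    (h : IsFPureWith p Δ 𝔞 t x e) {n : ℕ} (hn : 0 < n) : IsFPureWith p Δ 𝔞 t x (n * e) := by
  induction n, hn using Nat.le_induction with
  | base => simpa using h
  | succ n _ ih => rw [add_mul, one_mul]; exact ih.add h

end Schemes

/-! ### Maps with prescribed divisor -/

lemma pInv_surjective {K : Type*} [Field K] {e : ℕ} {Φ : K →+ K}
    (hΦ : Φ ∈ pInvLinearMaps p e K K K) (h0 : Φ ≠ 0) : Function.Surjective Φ := by
  obtain ⟨f, hf⟩ := DFunLike.ne_iff.1 h0
  exact fun g => ⟨(g / Φ f) ^ p ^ e * f, by rw [pInv_pow_mul hΦ, div_mul_cancel₀ _ hf]⟩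

section Schemes

variable {X : Scheme.{u}} [IsIntegral X] [IsNoetherian X]

/-- The coefficient along `E` of the divisor attached to the `p^{-e}`-linear map `Φ` is `d`. -/
def HasDivisorAt (E : X) (Φ : X.functionField →+ X.functionField) (d : ℤ) : Prop :=
  ∀ f : X.functionField, f ≠ 0 →
    ((∀ v ∈ stalkSubring E, Φ (v * f) ∈ stalkSubring E) ↔ -d ≤ X.ord f E)

variable [IsNormalScheme X]

lemma hasDivisorAt_iff {E : X} (hE : coheight E = 1)
    [IsDiscreteValuationRing (X.presheaf.stalk E)] {Φ : X.functionField →+ X.functionField}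
    {d : ℤ} : HasDivisorAt E Φ d ↔ HasDivisor (X.presheaf.stalk E) Φ d := by
  refine forall_congr' fun f => forall_congr' fun _ => ?_
  rw [ord_eq_vord hE]
  refine iff_congr ⟨fun h v => h _ ⟨v, rfl⟩, ?_⟩ Iff.rfl
  rintro h _ ⟨v, rfl⟩
  exact h v

lemma WeilDivisor.finite_support {A : Type*} [Zero A] (D : WeilDivisor X A) :
    {E : X | D E ≠ 0}.Finite := by
  choose t ht hfin using fun x : X => D.cycle.supportLocallyFiniteWithinDomain' x trivial
  obtain ⟨s, -, hs⟩ := isCompact_univ.elim_nhds_subcover t fun x _ => ht x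
  refine (s.finite_toSet.biUnion fun x _ => hfin x).subset fun E hE => ?_
  obtain ⟨x, hx, hEx⟩ := Set.mem_iUnion₂.1 (hs (Set.mem_univ E))
  exact Set.mem_iUnion₂.2 ⟨x, hx, hEx, hE⟩

/-- A multiplier takes care of all prime divisors but one, a power of a function vanishing on that
one does the rest. -/
lemma exists_divisorialSections_ne_zero (D : WeilDivisor X ℤ) {U : X.Opens} (hU : IsAffineOpen U)
    [Nonempty U] : ∃ s ∈ divisorialSections D U, s ≠ 0 := by
  by_cases h : ∃ E ∈ U, coheight E = 1
  · obtain ⟨E, hEU, hE⟩ := h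
    obtain ⟨r, hrE, hr⟩ := exists_multiplier hU hEU hE D
      (D.finite_support.subset fun C hC => hC.2.2.ne)
    have hP : (hU.primeIdealOf ⟨E, hEU⟩).asIdeal ≠ ⊥ := by
      intro h0
      have h1 := coheight_eq_height hU ⟨E, hEU⟩
      have : Nontrivial Γ(X, U) := ⟨⟨_, _, ne_zero_of_mem_basicOpen hrE⟩⟩
      rw [h0, hE, Ideal.height_bot] at h1
      exact one_ne_zero h1
    obtain ⟨a, haE, ha0⟩ := Submodule.exists_mem_ne_zero_of_ne_bot hP
    have haE' : E ∉ X.basicOpen a := fun h' =>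
      (mem_primeIdealOf_iff hU ⟨E, hEU⟩ a).2 h' haE
    have h1 := ord_pos_of_not_mem_basicOpen hEU hE ha0 haE'
    have ha := algebraMap_section_ne_zero ha0
    have hr0 := algebraMap_section_ne_zero (ne_zero_of_mem_basicOpen hrE)
    refine ⟨algebraMap _ X.functionField a ^ (-D E).toNat * algebraMap _ X.functionField r, ?_,
      mul_ne_zero (pow_ne_zero _ ha) hr0⟩
    intro _ C hCU hC
    rw [Scheme.ord_mul (pow_ne_zero _ ha) hr0, ord_pow ha]
    have h2 := ord_section_nonneg hCU a
    have h3 := ord_section_nonneg hCU r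
    by_cases hCE : C = E
    · subst hCE
      have h4 := Int.self_le_toNat (-D C)
      have h5 : (((-D C).toNat : ℕ) : ℤ) ≤
          ((-D C).toNat : ℕ) * X.ord (algebraMap _ X.functionField a) C :=
        le_mul_of_one_le_right (by positivity) h1
      linarith
    · have h4 := hr C hCU hC hCE
      have h5 : 0 ≤ ((-D E).toNat : ℤ) * X.ord (algebraMap _ X.functionField a) C :=
        mul_nonneg (by positivity) h2
      linarith
  · push Not at h
    exact ⟨1, fun _ E hEU hE => absurd hE (h E hEU), one_ne_zero⟩

/-- The isomorphism `F^! ω ≃ ω` is induced by a `p^{-1}`-linear map on the function field. -/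
lemma FrobeniusShriekIso.exists_pInv {D : WeilDivisor X ℤ} (hF : FrobeniusShriekIso p D)
    {U : X.Opens} (hU : IsAffineOpen U) [Nonempty U] :
    ∃ Ψ ∈ pInvLinearMaps p 1 X.functionField X.functionField X.functionField, Ψ ≠ 0 ∧
      (∀ s ∈ divisorialSections D U, Ψ s ∈ divisorialSections D U) ∧
      ∀ g : X.functionField,
        (∀ a : Γ(X, U), Ψ (algebraMap _ _ a * g) ∈ divisorialSections D U) →
          g ∈ divisorialSections D U := by
  obtain ⟨θ', hlin, -⟩ := hF
  have hne : Nonempty (⟨U, hU⟩ : X.affineOpens).1 := ‹Nonempty U›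
  let θ : divisorialSections D U ≃+ pInvLinearMaps p 1 Γ(X, U) Γ(X, U) (divisorialSections D U) :=
    @θ' ⟨U, hU⟩ hne
  have hθ : ∀ (r a : Γ(X, U)) (s : divisorialSections D U),
      (θ (r • s)).1 a = (θ s).1 (r * a) := @hlin ⟨U, hU⟩ hne
  have hfr := functionField_isFractionRing_of_isAffineOpen X U hU
  let ι : divisorialSections D U →+ X.functionField :=
    (divisorialSections D U).subtype.toAddMonoidHom
  have hlift : ∀ s : divisorialSections D U, ∃ Φ ∈ pInvLinearMaps p 1 X.functionField
      X.functionField X.functionField, ∀ a, Φ (algebraMap Γ(X, U) _ a) = ((θ s).1 a : _) := by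
    intro s
    refine exists_pInv_extension (ι.comp (θ s).1) fun r a => ?_
    have h := congrArg ι ((θ s).2 r a)
    rw [smul_eq_mul] at h
    refine h.trans ?_
    change ((r • (θ s).1 a : divisorialSections D U) : X.functionField) = _
    rw [Submodule.coe_smul, Algebra.smul_def]
    rfl
  choose Φ hΦ hΦθ using hlift
  obtain ⟨s₀, hs₀, hs₀0⟩ := exists_divisorialSections_ne_zero D hU
  have huniq : ∀ {e : ℕ} (Φ Φ' : X.functionField →+ X.functionField),
      Φ ∈ pInvLinearMaps p e X.functionField X.functionField X.functionField →
      Φ' ∈ pInvLinearMaps p e X.functionField X.functionField X.functionField →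
      (∀ a : Γ(X, U), Φ (algebraMap _ _ a) = Φ' (algebraMap _ _ a)) → ∀ f, Φ f = Φ' f := by
    intro e Φ Φ' h h' heq f
    obtain ⟨a, b, hb, rfl⟩ := IsFractionRing.div_surjective (A := Γ(X, U)) f
    have hb0 := algebraMap_section_ne_zero (nonZeroDivisors.ne_zero hb)
    have hq : p ^ e ≠ 0 := (pow_pos (Fact.out : p.Prime).pos e).ne'
    have h1 : algebraMap _ X.functionField b ^ p ^ e *
        (algebraMap _ X.functionField a / algebraMap _ X.functionField b) =
        algebraMap _ X.functionField (b ^ (p ^ e - 1) * a) := by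
      rw [map_mul, map_pow]
      nth_rewrite 1 [← Nat.sub_add_cancel (Nat.one_le_iff_ne_zero.2 hq)]
      rw [pow_succ]
      field_simp
    apply mul_left_cancel₀ hb0
    rw [← pInv_pow_mul h, ← pInv_pow_mul h', h1, heq]
  let Ψ : X.functionField →+ X.functionField :=
    (Φ ⟨s₀, hs₀⟩).comp (AddMonoidHom.mulLeft s₀⁻¹)
  have hΨ : Ψ ∈ pInvLinearMaps p 1 X.functionField X.functionField X.functionField :=
    pInv_comp_mulLeft (hΦ _) _
  -- Two sections have proportional multiples over `Γ(X, U)`, so by linearity of `θ` the single map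
  -- `Ψ` built from `s₀` accounts for every section.
  have hΨΦ : ∀ (s : divisorialSections D U) (f : X.functionField), Ψ (s.1 * f) = Φ s f := by
    intro s f
    obtain ⟨a, b, hb, hab⟩ := IsFractionRing.div_surjective (A := Γ(X, U)) (s.1 / s₀)
    have hb0 := algebraMap_section_ne_zero (nonZeroDivisors.ne_zero hb)
    have hbs : b • s = a • (⟨s₀, hs₀⟩ : divisorialSections D U) := by
      apply Subtype.ext
      rw [Submodule.coe_smul, Submodule.coe_smul, Algebra.smul_def, Algebra.smul_def]
      rw [div_eq_div_iff hb0 hs₀0] at hab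
      rw [mul_comm, ← hab]
    have hk := huniq ((Φ s).comp (AddMonoidHom.mulLeft (algebraMap _ _ b)))
      ((Φ ⟨s₀, hs₀⟩).comp (AddMonoidHom.mulLeft (algebraMap _ _ a)))
      (pInv_comp_mulLeft (hΦ _) _) (pInv_comp_mulLeft (hΦ _) _) (by
        intro c
        simp only [AddMonoidHom.comp_apply, AddMonoidHom.coe_mulLeft]
        rw [← map_mul, ← map_mul, hΦθ, hΦθ, ← hθ, ← hθ, hbs]) ((algebraMap _ _ b)⁻¹ * f)
    simp only [AddMonoidHom.comp_apply, AddMonoidHom.coe_mulLeft] at hk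
    rw [mul_inv_cancel_left₀ hb0] at hk
    rw [hk]
    change Φ _ (s₀⁻¹ * (s.1 * f)) = _
    congr 1
    rw [← mul_assoc, ← mul_assoc, ← div_eq_mul_inv, hab, div_eq_mul_inv, mul_comm s₀⁻¹]
  have hΨθ : ∀ (s : divisorialSections D U) (a : Γ(X, U)),
      Ψ (algebraMap _ _ a * s.1) = ((θ s).1 a : _) := by
    intro s a
    rw [mul_comm, hΨΦ, hΦθ]
  have hΨ0 : Ψ ≠ 0 := by
    intro h0
    have : θ ⟨s₀, hs₀⟩ = 0 := by
      apply Subtype.ext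
      ext a
      rw [← hΨθ, h0]
      rfl
    rw [map_eq_zero_iff θ θ.injective] at this
    exact hs₀0 (congrArg Subtype.val this)
  refine ⟨Ψ, hΨ, hΨ0, ?_, ?_⟩
  · intro s hs
    have := hΨθ ⟨s, hs⟩ 1
    rw [map_one, one_mul] at this
    change Ψ s = _ at this
    rw [this]
    exact ((θ ⟨s, hs⟩).1 1).2
  · intro g hg
    -- Surjectivity of `θ` yields a section `s` with the same map as `g`, and `Ψ ≠ 0` forces `g =
    -- s`.
    let φ : Γ(X, U) →+ divisorialSections D U :=
      AddMonoidHom.mk' (fun a => ⟨_, hg a⟩) fun a b => by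
        apply Subtype.ext
        simp [add_mul]
    have hφ : φ ∈ pInvLinearMaps p 1 Γ(X, U) Γ(X, U) (divisorialSections D U) := by
      intro r a
      apply Subtype.ext
      rw [Submodule.coe_smul, Algebra.smul_def]
      change Ψ (algebraMap _ _ (r ^ p ^ 1 * a) * g) = algebraMap _ _ r * Ψ (algebraMap _ _ a * g)
      rw [map_mul (algebraMap _ X.functionField), map_pow, mul_assoc, pInv_pow_mul hΨ]
    obtain ⟨s, hs⟩ := θ.surjective ⟨φ, hφ⟩
    have hgs : ∀ f, Ψ (g * f) = Ψ (s.1 * f) := by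
      refine huniq (Ψ.comp (AddMonoidHom.mulLeft g)) (Ψ.comp (AddMonoidHom.mulLeft s.1))
        (pInv_comp_mulLeft hΨ _) (pInv_comp_mulLeft hΨ _) fun a => ?_
      simp only [AddMonoidHom.comp_apply, AddMonoidHom.coe_mulLeft]
      rw [mul_comm s.1, hΨθ, hs, mul_comm]
      rfl
    have hg' : g = s.1 := by
      by_contra hne
      obtain ⟨f, hf⟩ := DFunLike.ne_iff.1 hΨ0
      apply hf
      have h1 := hgs ((g - s.1)⁻¹ * f)
      rw [← sub_eq_zero, ← map_sub, ← sub_mul, mul_inv_cancel_left₀ (sub_ne_zero.2 hne)] at h1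
      exact h1
    rw [hg']
    exact s.2

/-- The map on the function field attached to `F^! ω ≃ ω` has divisor `(1 - p)D`. -/
lemma FrobeniusShriekIso.exists_hasDivisorAt [IsFFinite p X] {D : WeilDivisor X ℤ}
    (hF : FrobeniusShriekIso p D) {U : X.Opens} (hU : IsAffineOpen U) [Nonempty U] :
    ∃ Ψ ∈ pInvLinearMaps p 1 X.functionField X.functionField X.functionField, Ψ ≠ 0 ∧
      ∀ E ∈ U, coheight E = 1 → HasDivisorAt E Ψ ((1 - p) * D E) := by
  have hchar : CharP X.functionField p := IsFFinite.charP
  obtain ⟨Ψ, hΨ, hΨ0, hmaps, hsurj⟩ := hF.exists_pInv hU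
  have hfin : ∀ f : X.functionField, f ≠ 0 →
      {C : X | C ∈ U ∧ coheight C = 1 ∧ X.ord f C + D C < 0}.Finite := by
    intro f hf
    refine ((finite_ord_ne_zero hU hf).union D.finite_support).subset ?_
    rintro C ⟨hCU, hC, h⟩
    by_cases h0 : X.ord f C = 0
    · exact Or.inr fun h1 => by rw [h0, h1] at h; simp at h
    · exact Or.inl ⟨hCU, hC, h0⟩
  have hlocal : ∀ E ∈ U, coheight E = 1 → ∀ f, f ≠ 0 → -D E ≤ X.ord f E → Ψ f ≠ 0 →
      -D E ≤ X.ord (Ψ f) E := by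
    intro E hEU hE f hf hfE hΨf
    obtain ⟨r, hrE, hr⟩ := exists_multiplier hU hEU hE (fun C => X.ord f C + D C) (hfin f hf)
    set ρ := algebraMap _ X.functionField r with hρ
    have hρ0 : ρ ≠ 0 := algebraMap_section_ne_zero (ne_zero_of_mem_basicOpen hrE)
    have hmem : ρ ^ p ^ 1 * f ∈ divisorialSections D U := by
      intro _ C hCU hC
      rw [Scheme.ord_mul (pow_ne_zero _ hρ0) hf, ord_pow hρ0, pow_one]
      by_cases hCE : C = E
      · subst hCE
        rw [ord_eq_zero_of_mem_basicOpen hrE]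
        linarith
      · have h1 := hr C hCU hC hCE
        have h4 : X.ord ρ C ≤ (p : ℤ) * X.ord ρ C :=
          le_mul_of_one_le_left (ord_section_nonneg hCU r)
            (by exact_mod_cast (Fact.out : p.Prime).one_lt.le)
        linarith
    have h1 := hmaps _ hmem
    rw [pInv_pow_mul hΨ] at h1
    have h2 := h1 (mul_ne_zero hρ0 hΨf) E hEU hE
    rw [Scheme.ord_mul hρ0 hΨf, ord_eq_zero_of_mem_basicOpen hrE] at h2
    linarith
  refine ⟨Ψ, hΨ, hΨ0, fun E hEU hE => ?_⟩
  have := isDiscreteValuationRing_stalk hE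
  obtain ⟨d, hd⟩ := exists_hasDivisor (V := X.presheaf.stalk E) (frobeniusFinite_stalk E) hΨ hΨ0
  obtain ⟨ϖ, hϖ, hϖ1⟩ := exists_ord_eq_one hE
  suffices hdd : d = (1 - p) * D E by rwa [hasDivisorAt_iff hE, ← hdd]
  apply le_antisymm
  · by_contra! hlt
    -- A divisor larger than `(1 - p) * D E` would let this function, with a pole one order too high
    -- along `E`, pass the test `hsurj` after multiplication by `ρ`.
    set g₀ := ϖ ^ (-D E - 1) with hg₀
    have hg₀0 : g₀ ≠ 0 := zpow_ne_zero _ hϖ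
    have hg₀E : X.ord g₀ E = -D E - 1 := by rw [hg₀, ord_zpow hϖ, hϖ1, mul_one]
    obtain ⟨r, hrE, hr⟩ := exists_multiplier hU hEU hE (fun C => X.ord g₀ C + D C) (hfin g₀ hg₀0)
    set ρ := algebraMap _ X.functionField r with hρ
    have hρ0 : ρ ≠ 0 := algebraMap_section_ne_zero (ne_zero_of_mem_basicOpen hrE)
    have hmem : ρ * g₀ ∈ divisorialSections D U := by
      apply hsurj
      intro a hne C hCU hC
      have ha0 : algebraMap _ X.functionField a ≠ 0 := by
        intro h0
        rw [h0, zero_mul, map_zero] at hne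
        exact hne rfl
      have hprod : algebraMap _ X.functionField a * (ρ * g₀) ≠ 0 :=
        mul_ne_zero ha0 (mul_ne_zero hρ0 hg₀0)
      have hord : X.ord (algebraMap _ X.functionField a * (ρ * g₀)) C =
          X.ord (algebraMap _ X.functionField a) C + (X.ord ρ C + X.ord g₀ C) := by
        rw [Scheme.ord_mul ha0 (mul_ne_zero hρ0 hg₀0), Scheme.ord_mul hρ0 hg₀0]
      have haC := ord_section_nonneg hCU a
      by_cases hCE : C = E
      · subst hCE
        have hz : ϖ ^ D C ≠ 0 := zpow_ne_zero _ hϖ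
        have h1 : Ψ ((ϖ ^ D C) ^ p ^ 1 * (algebraMap _ X.functionField a * (ρ * g₀))) ∈
            stalkSubring C := by
          refine hd.apply_mem (mul_ne_zero (pow_ne_zero _ hz) hprod) ?_
          rw [← ord_eq_vord hE, Scheme.ord_mul (pow_ne_zero _ hz) hprod, hord, ord_pow hz,
            ord_zpow hϖ, hϖ1, hg₀E, ord_eq_zero_of_mem_basicOpen hrE]
          push_cast
          linarith
        rw [pInv_pow_mul hΨ, ← ord_nonneg_iff hE (mul_ne_zero hz hne), Scheme.ord_mul hz hne,
          ord_zpow hϖ, hϖ1] at h1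
        linarith
      · have h1 := hr C hCU hC hCE
        have h2 := hlocal C hCU hC _ hprod (by rw [hord]; linarith) hne
        linarith
    have h1 := hmem (mul_ne_zero hρ0 hg₀0) E hEU hE
    rw [Scheme.ord_mul hρ0 hg₀0, ord_eq_zero_of_mem_basicOpen hrE, hg₀E] at h1
    linarith
  · refine hd.le fun f hf hord => ?_
    rw [← ord_eq_vord hE] at hord
    by_cases h0 : Ψ f = 0
    · exact ⟨0, by rw [h0, map_zero]⟩
    have hz : ϖ ^ (-D E) ≠ 0 := zpow_ne_zero _ hϖ
    have h1 := hlocal E hEU hE ((ϖ ^ (-D E)) ^ p ^ 1 * f) (mul_ne_zero (pow_ne_zero _ hz) hf) (by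
      rw [Scheme.ord_mul (pow_ne_zero _ hz) hf, ord_pow hz, ord_zpow hϖ, hϖ1]
      push_cast
      linarith) (by rw [pInv_pow_mul hΨ]; exact mul_ne_zero hz h0)
    rw [pInv_pow_mul hΨ, Scheme.ord_mul hz h0, ord_zpow hϖ, hϖ1] at h1
    exact (ord_nonneg_iff hE h0).1 (by linarith)

/-- If `K + Δ` has index prime to `p`, then near every point the divisor `(p^e - 1)Δ` is the
divisor of a `p^{-e}`-linear map, for all sufficiently divisible `e`. -/
theorem exists_hasDivisorAt_eq [IsFFinite p X] {D : WeilDivisor X ℤ} (hF : FrobeniusShriekIso p D)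
    {Δ : X → ℚ} (hQ : IsQCartier (fun E => (D E : ℚ) + Δ E))
    (hindex : ¬ p ∣ cartierIndex (fun E => (D E : ℚ) + Δ E)) :
    ∃ e₀, 0 < e₀ ∧ ∀ e, 0 < e → e₀ ∣ e → ∀ x : X,
      ∃ Φ ∈ pInvLinearMaps p e X.functionField X.functionField X.functionField, Φ ≠ 0 ∧
        ∀ E, E ⤳ x → coheight E = 1 →
          ∃ d : ℤ, (d : ℚ) = ((p : ℚ) ^ e - 1) * Δ E ∧ HasDivisorAt E Φ d := by
  have hp := (Fact.out : p.Prime)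
  obtain ⟨hm0, hm⟩ := Nat.sInf_mem (s := {m : ℕ | 0 < m ∧ IsCartier fun E =>
    (m : ℚ) * ((D E : ℚ) + Δ E)}) hQ
  change 0 < cartierIndex (fun E => (D E : ℚ) + Δ E) at hm0
  change IsCartier fun E => (cartierIndex (fun E => (D E : ℚ) + Δ E) : ℚ) * _ at hm
  set m := cartierIndex (fun E => (D E : ℚ) + Δ E)
  have hcop : p.Coprime m := (Nat.Prime.coprime_iff_not_dvd hp).2 hindex
  -- By Euler's theorem the index `m`, being prime to `p`, divides `p ^ e - 1` for all multiples `e`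
  -- of its totient.
  refine ⟨m.totient, Nat.totient_pos.2 hm0, fun e he hdvd x => ?_⟩
  have hmod : p ^ e ≡ 1 [MOD m] := by
    obtain ⟨k, rfl⟩ := hdvd
    rw [pow_mul]
    simpa using (Nat.ModEq.pow_totient hcop).pow k
  have h1e : 1 ≤ p ^ e := Nat.one_le_pow _ _ hp.pos
  obtain ⟨N, hN⟩ := (Nat.modEq_iff_dvd' h1e).1 hmod.symm
  have hNQ : ((p : ℚ) ^ e - 1) = m * N := by
    have : p ^ e = m * N + 1 := by omega
    have : ((p ^ e : ℕ) : ℚ) = ((m * N + 1 : ℕ) : ℚ) := by rw [this]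
    push_cast at this
    linarith
  obtain ⟨V, hxV, f, hf, hfV⟩ := hm x
  obtain ⟨U, hU, hxU, hUV⟩ := exists_isAffineOpen_mem x V hxV
  have : Nonempty U := ⟨⟨x, hxU⟩⟩
  obtain ⟨Ψ, hΨ, hΨ0, hdiv⟩ := hF.exists_hasDivisorAt hU
  have hiter : ∀ n : ℕ, ∃ Φ ∈ pInvLinearMaps p n X.functionField X.functionField X.functionField,
      Φ ≠ 0 ∧ ∀ E ∈ U, coheight E = 1 → HasDivisorAt E Φ ((1 - p ^ n) * D E) := by
    intro n
    induction n with
    | zero =>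
      refine ⟨AddMonoidHom.id _, by intro r f; simp, fun h => one_ne_zero (DFunLike.congr_fun h (1 : X.functionField)), fun E hEU hE g hg => ?_⟩
      have := isDiscreteValuationRing_stalk hE
      simp only [AddMonoidHom.id_apply, pow_zero, sub_self, zero_mul, neg_zero]
      rw [ord_nonneg_iff hE hg]
      exact ⟨fun h => by simpa using h 1 (one_mem _), fun h v hv => mul_mem hv h⟩
    | succ n ih =>
      obtain ⟨Φ, hΦ, hΦ0, hΦd⟩ := ih
      refine ⟨Φ.comp Ψ, pInv_comp hΦ hΨ, fun h => hΦ0 (AddMonoidHom.ext fun g => ?_), fun E hEU hE => ?_⟩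
      · obtain ⟨f, rfl⟩ := pInv_surjective hΨ hΨ0 g
        exact DFunLike.congr_fun h f
      have := isDiscreteValuationRing_stalk hE
      have h1 := (hasDivisorAt_iff hE).1 (hΦd E hEU hE)
      have h2 := (hasDivisorAt_iff hE).1 (hdiv E hEU hE)
      have h3 := h1.comp hΨ h2
      rw [hasDivisorAt_iff hE]
      convert h3 using 1
      rw [pow_succ]
      ring
  obtain ⟨Φ, hΦ, hΦ0, hΦd⟩ := hiter e
  -- The function `f` is a local equation of `m(K + Δ)` and `m * N = p ^ e - 1`, so the divisor
  -- becomes `(1 - p ^ e)K + (p ^ e - 1)(K + Δ) = (p ^ e - 1)Δ`.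
  refine ⟨Φ.comp (AddMonoidHom.mulLeft (f ^ N)), pInv_comp_mulLeft hΦ _,
    fun h => hΦ0 (AddMonoidHom.ext fun g => ?_), fun E hEx hE => ?_⟩
  · have := DFunLike.congr_fun h ((f ^ N)⁻¹ * g)
    rwa [AddMonoidHom.comp_apply, AddMonoidHom.coe_mulLeft,
      mul_inv_cancel_left₀ (pow_ne_zero _ hf)] at this
  have hEU : E ∈ U := hEx.mem_open U.isOpen hxU
  refine ⟨(1 - p ^ e) * D E + N * X.ord f E, ?_, ?_⟩
  · have h1 := hfV E (hUV hEU) hE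
    push_cast
    rw [← h1, hNQ]
    have : (1 - (p : ℚ) ^ e) = - (m * N) := by rw [← hNQ]; ring
    rw [this]
    ring
  · have := isDiscreteValuationRing_stalk hE
    have h1 := ((hasDivisorAt_iff hE).1 (hΦd E hEU hE)).comp_mul (g := f ^ N)
      (Ψ := Φ.comp (AddMonoidHom.mulLeft (f ^ N))) (pow_ne_zero _ hf) fun _ => rfl
    rw [hasDivisorAt_iff hE]
    rwa [← ord_eq_vord hE, ord_pow hf] at h1

end Schemes

/-! ### Stalks of ideal sheaves -/

lemma idealStalk_eq {X : Scheme.{u}} (𝔞 : X.IdealSheafData) {x : X} (U : X.affineOpens)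
    (hx : x ∈ U.1) : idealStalk 𝔞 x = (𝔞.ideal U).map (X.presheaf.germ U.1 x hx).hom := by
  apply le_antisymm
  · refine iSup₂_le fun W hxW => ?_
    obtain ⟨_, ⟨V, hV, rfl⟩, hxV, hVU⟩ := X.isBasis_affineOpens.exists_subset_of_mem_open
      (a := x) (u := (U.1 ⊓ W.1 : X.Opens)) ⟨hx, hxW⟩ (U.1 ⊓ W.1).isOpen
    have key : ∀ (W : X.affineOpens) (hxW : x ∈ W.1) (h : V ≤ W.1),
        (𝔞.ideal W).map (X.presheaf.germ W.1 x hxW).hom =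
          (𝔞.ideal ⟨V, hV⟩).map (X.presheaf.germ V x hxV).hom := by
      intro W hxW h
      rw [← 𝔞.map_ideal (U := ⟨V, hV⟩) (V := W) h, Ideal.map_map, ← CommRingCat.hom_comp]
      exact (congrArg (fun f => Ideal.map (CommRingCat.Hom.hom f) (𝔞.ideal W))
        (X.presheaf.germ_res (homOfLE h) x hxV)).symm
    have hVW : V ≤ W.1 := le_trans (b := U.1 ⊓ W.1) hVU inf_le_right
    have hVU : V ≤ U.1 := le_trans (b := U.1 ⊓ W.1) hVU inf_le_left
    rw [key W hxW hVW, key U hx hVU]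
  · exact le_iSup₂_of_le U hx le_rfl

lemma appLE_fromSpec {Y : Scheme.{u}} {V : Y.Opens} (hV : IsAffineOpen V) {S : CommRingCat.{u}}
    (q : Γ(Y, V) ⟶ S) (hle : (⊤ : (Spec S).Opens) ≤ (Spec.map q ≫ hV.fromSpec) ⁻¹ᵁ V) :
    (Spec.map q ≫ hV.fromSpec).appLE V ⊤ hle = q ≫ (Scheme.ΓSpecIso S).inv := by
  rw [Scheme.Hom.comp_appLE, IsAffineOpen.fromSpec_app_self, Scheme.ΓSpecIso_inv_naturality,
    Category.assoc]
  exact congrArg _ ((Scheme.Hom.map_appLE (Spec.map q) (V := ⊤) (U := hV.fromSpec ⁻¹ᵁ V) hle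
    (eqToHom hV.fromSpec_preimage_self).op).trans (Scheme.Hom.appLE_eq_app _))

/-- Vanishing is tested on stalks of `Z`, where any one affine neighbourhood of the image point
computes the stalk of the ideal sheaf. -/
lemma le_ker_of_germ_eq_zero {X Z : Scheme.{u}} (h : Z ⟶ X) [QuasiCompact h]
    {𝔞 : X.IdealSheafData}
    (hz : ∀ z : Z, ∃ (U : X.affineOpens) (hU : h z ∈ U.1), ∀ s ∈ 𝔞.ideal U,
      (X.presheaf.germ U.1 (h z) hU ≫ h.stalkMap z).hom s = 0) : 𝔞 ≤ h.ker := by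
  intro W s hs
  rw [Scheme.Hom.ker_apply]
  change h.app W.1 s = 0
  refine TopCat.Presheaf.section_ext Z.sheaf _ _ _ fun z hzW => ?_
  refine Eq.trans ?_ (map_zero (Z.presheaf.germ _ z hzW).hom).symm
  change (h.app W.1 ≫ Z.presheaf.germ _ z hzW).hom s = 0
  refine (congrArg (fun f => f.hom s) (Scheme.Hom.germ_stalkMap h W.1 z hzW)).symm.trans ?_
  obtain ⟨U, hU, hs0⟩ := hz z
  have h1 : (X.presheaf.germ W.1 (h z) hzW).hom s ∈ idealStalk 𝔞 (h z) := by
    rw [idealStalk_eq 𝔞 W hzW]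
    exact Ideal.mem_map_of_mem _ hs
  rw [idealStalk_eq 𝔞 U hU] at h1
  have h2 : (𝔞.ideal U).map (X.presheaf.germ U.1 (h z) hU).hom ≤
      RingHom.ker (h.stalkMap z).hom := by
    rw [Ideal.map_le_iff_le_comap]
    exact fun s hs => hs0 s hs
  exact h2 h1

/-- For `≤`, the spectrum of the quotient by the extended ideal maps to `Y` by some `g`, and `𝔞`
dies on it. The adjunction between `comap` and `map` then puts `𝔞.comap π` into the kernel of `g`.
-/
lemma ideal_comap_eq {X Y : Scheme.{u}} [IsNoetherian X] [IsNoetherian Y] (π : Y ⟶ X) [IsAffineHom π] (𝔞 : X.IdealSheafData)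
    (U : X.affineOpens) : (𝔞.comap π).ideal ⟨π ⁻¹ᵁ U.1, U.2.preimage π⟩ =
      (𝔞.ideal U).map (π.app U.1).hom := by
  have hV := U.2.preimage π
  apply le_antisymm
  · let 𝔟 := (𝔞.ideal U).map (π.app U.1).hom
    let q : Γ(Y, π ⁻¹ᵁ U.1) ⟶ CommRingCat.of (Γ(Y, π ⁻¹ᵁ U.1) ⧸ 𝔟) :=
      CommRingCat.ofHom (Ideal.Quotient.mk 𝔟)
    let g := Spec.map q ≫ hV.fromSpec
    have hle : ⊤ ≤ g ⁻¹ᵁ (π ⁻¹ᵁ U.1) := by simp [g]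
    have hzU : ∀ z, (g ≫ π) z ∈ U.1 := fun z => hle (TopologicalSpace.Opens.mem_top z)
    have h1 : 𝔞 ≤ (g ≫ π).ker := by
      refine le_ker_of_germ_eq_zero _ fun z => ⟨U, hzU z, fun s hs => ?_⟩
      have h2 : g.appLE (π ⁻¹ᵁ U.1) ⊤ hle (π.app U.1 s) = 0 := by
        have h3 : q (π.app U.1 s) = 0 :=
          Ideal.Quotient.eq_zero_iff_mem.2 (Ideal.mem_map_of_mem _ hs)
        rw [appLE_fromSpec hV q hle]
        change (Scheme.ΓSpecIso _).inv.hom (q (π.app U.1 s)) = 0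
        rw [h3, map_zero]
      rw [Scheme.Hom.germ_stalkMap (g ≫ π) U.1 z (hzU z)]
      have h4 := congrArg ((Spec _).presheaf.germ ⊤ z (TopologicalSpace.Opens.mem_top z)).hom h2
      rw [map_zero] at h4
      refine Eq.trans ?_ h4
      have h5 : g.appLE (π ⁻¹ᵁ U.1) ⊤ hle ≫
          (Spec _).presheaf.germ ⊤ z (TopologicalSpace.Opens.mem_top z) =
          g.app (π ⁻¹ᵁ U.1) ≫ (Spec _).presheaf.germ _ z (hzU z) := by
        rw [Scheme.Hom.appLE, Category.assoc]
        exact congrArg _ (TopCat.Presheaf.germ_res _ (homOfLE hle) z _)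
      exact congrArg (fun f => f.hom (π.app U.1 s)) h5.symm
    rw [← Scheme.IdealSheafData.map_ker, Scheme.IdealSheafData.le_map_iff_comap_le] at h1
    intro s hs
    have h2 := h1 ⟨_, hV⟩ hs
    rw [Scheme.Hom.ker_apply] at h2
    have h3 : g.appLE (π ⁻¹ᵁ U.1) ⊤ hle s = 0 := by
      change (Spec _).presheaf.map _ (g.app _ s) = 0
      have : g.app (π ⁻¹ᵁ U.1) s = 0 := h2
      rw [this, map_zero]
    rw [appLE_fromSpec hV q hle] at h3
    have h4 : (Scheme.ΓSpecIso _).inv (q s) = 0 := h3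
    have h5 := congrArg (Scheme.ΓSpecIso _).hom h4
    rw [map_zero] at h5
    have h6 : q s = 0 := by simpa using h5
    exact Ideal.Quotient.eq_zero_iff_mem.1 h6
  · have := 𝔞.le_map_comap π U
    rw [Scheme.IdealSheafData.ideal_map_of_isAffineHom] at this
    exact Ideal.map_le_iff_le_comap.2 this

lemma idealStalk_comap {X Y : Scheme.{u}} [IsNoetherian X] [IsNoetherian Y] (π : Y ⟶ X) [IsAffineHom π] (𝔞 : X.IdealSheafData)
    (y : Y) : idealStalk (𝔞.comap π) y = (idealStalk 𝔞 (π y)).map (π.stalkMap y).hom := by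
  obtain ⟨_, ⟨U, hU, rfl⟩, hxU, -⟩ := X.isBasis_affineOpens.exists_subset_of_mem_open
    (a := π y) (u := (⊤ : X.Opens)) trivial (⊤ : X.Opens).isOpen
  rw [idealStalk_eq 𝔞 ⟨U, hU⟩ hxU, idealStalk_eq (𝔞.comap π) ⟨π ⁻¹ᵁ U, hU.preimage π⟩ hxU,
    ideal_comap_eq π 𝔞 ⟨U, hU⟩, Ideal.map_map, Ideal.map_map, ← CommRingCat.hom_comp,
    ← CommRingCat.hom_comp, Scheme.Hom.germ_stalkMap]

/-! ### Finite morphisms and function fields -/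

/-- The finite `K`-algebra generated by the module generators of `B` contains `B` and, by
integrality over a field, the inverses of its elements; so it is all of `L`. -/
lemma finiteDimensional_of_finite {A B K L : Type*} [CommRing A] [CommRing B] [IsDomain B]
    [Field K] [Field L] [Algebra A K] [Algebra B L] [IsFractionRing B L] [Algebra K L]
    (f : A →+* B) (hf : f.Finite)
    (hc : ∀ a, algebraMap B L (f a) = algebraMap K L (algebraMap A K a)) :
    FiniteDimensional K L := by
  obtain ⟨n, γ, hγ⟩ := exists_generators_of_finite f hf
  have hIntegral : ∀ b : B, _root_.IsIntegral K (algebraMap B L b) := by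
    intro b
    obtain ⟨P, hP, hPb⟩ := hf.to_isIntegral b
    refine ⟨P.map (algebraMap A K), hP.map _, ?_⟩
    rw [Polynomial.eval₂_map]
    have : (algebraMap K L).comp (algebraMap A K) = (algebraMap B L).comp f :=
      RingHom.ext fun a => (hc a).symm
    rw [this, ← Polynomial.hom_eval₂, hPb, map_zero]
  let s : Set L := Set.range fun i => algebraMap B L (γ i)
  have hfin := Algebra.finite_adjoin_of_finite_of_isIntegral (R := K) (s := s) (Set.finite_range _)
    (by rintro _ ⟨i, rfl⟩; exact hIntegral _)
  have hB : ∀ b : B, algebraMap B L b ∈ Algebra.adjoin K s := by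
    intro b
    obtain ⟨c, rfl⟩ := hγ b
    rw [map_sum]
    refine sum_mem fun i _ => ?_
    rw [map_mul, hc]
    exact mul_mem (Subalgebra.algebraMap_mem _ _) (Algebra.subset_adjoin ⟨i, rfl⟩)
  have htop : Algebra.adjoin K s = ⊤ := by
    rw [eq_top_iff]
    rintro l -
    obtain ⟨a, b, -, rfl⟩ := IsFractionRing.div_surjective (A := B) l
    rw [div_eq_mul_inv]
    exact mul_mem (hB a) ((hIntegral b).inv_mem (hB b))
  rw [htop] at hfin
  exact Module.Finite.equiv Subalgebra.topEquiv.toLinearEquiv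

section Schemes

variable {X Y : Scheme.{u}} [IsIntegral X] [IsIntegral Y] (π : Y ⟶ X)

lemma functionFieldMap_algebraMap [IsDominant π] (y : Y) (r : X.presheaf.stalk (π y)) :
    functionFieldMap π (algebraMap _ X.functionField r) =
      algebraMap _ Y.functionField ((π.stalkMap y).hom r) := by
  have key : X.presheaf.stalkSpecializes ((genericPoint_spec X).specializes trivial) ≫
      (X.presheaf.stalkSpecializes (map_genericPoint_specializes π (genericPoint X)) ≫
        π.stalkMap (genericPoint Y)) =
      π.stalkMap y ≫ Y.presheaf.stalkSpecializes ((genericPoint_spec Y).specializes trivial) := by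
    rw [TopCat.Presheaf.stalkSpecializes_comp_assoc, ← Scheme.Hom.stalkSpecializes_stalkMap]
  exact DFunLike.congr_fun (congrArg CommRingCat.Hom.hom key) r

lemma functionFieldMap_section [IsDominant π] (U : X.Opens) [Nonempty U]
    [Nonempty (π ⁻¹ᵁ U : Y.Opens)] (a : Γ(X, U)) :
    functionFieldMap π (algebraMap _ X.functionField a) =
      algebraMap _ Y.functionField ((π.app U).hom a) := by
  obtain ⟨y, hy⟩ := ‹Nonempty (π ⁻¹ᵁ U : Y.Opens)›
  have h1 : algebraMap _ X.functionField a =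
      algebraMap (X.presheaf.stalk (π y)) X.functionField (X.presheaf.germ U (π y) hy a) :=
    (Scheme.algebraMap_germ_eq_germToFunctionField X hy a).symm
  have h2 : algebraMap _ Y.functionField ((π.app U).hom a) =
      algebraMap (Y.presheaf.stalk y) Y.functionField
        (Y.presheaf.germ (π ⁻¹ᵁ U) y hy ((π.app U).hom a)) :=
    (Scheme.algebraMap_germ_eq_germToFunctionField Y (U := π ⁻¹ᵁ U) hy ((π.app U).hom a)).symm
  rw [h1, h2, functionFieldMap_algebraMap]
  congr 1
  exact congrArg (fun f => f.hom a) (Scheme.Hom.germ_stalkMap π U y hy)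

lemma functionFieldMap_mem_stalkSubring [IsDominant π] {y : Y} {f : X.functionField}
    (hf : f ∈ stalkSubring (π y)) : functionFieldMap π f ∈ stalkSubring y := by
  obtain ⟨r, rfl⟩ := hf
  exact ⟨_, (functionFieldMap_algebraMap π y r).symm⟩

lemma nonempty_preimage [IsDominant π] (U : X.Opens) [Nonempty U] :
    Nonempty (π ⁻¹ᵁ U : Y.Opens) := by
  obtain ⟨x, hx⟩ := ‹Nonempty U›
  exact ⟨⟨genericPoint Y, (map_genericPoint_specializes π x).mem_open U.isOpen hx⟩⟩

lemma finiteDimensional_functionField [IsDominant π] [IsFinite π] :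
    letI := (functionFieldMap π).toAlgebra
    FiniteDimensional X.functionField Y.functionField := by
  let := (functionFieldMap π).toAlgebra
  obtain ⟨U, hU, hx, -⟩ := exists_isAffineOpen_mem (genericPoint X) ⊤ trivial
  have : Nonempty U := ⟨⟨_, hx⟩⟩
  have := nonempty_preimage π U
  have := functionField_isFractionRing_of_isAffineOpen Y (π ⁻¹ᵁ U) (hU.preimage π)
  exact finiteDimensional_of_finite (π.app U).hom (IsFinite.finite_app π U hU)
    fun a => (functionFieldMap_section π U a).symm

lemma isIntegrallyClosed_section [IsNormalScheme X] {U : X.Opens} (hU : IsAffineOpen U)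
    [Nonempty U] : IsIntegrallyClosed Γ(X, U) := by
  refine IsIntegrallyClosed.of_localization_maximal fun P _ hP => ?_
  obtain ⟨x, hx⟩ := exists_primeIdealOf_eq hU ⟨P, hP.isPrime⟩
  have := hU.isLocalization_stalk x
  have : IsLocalization.AtPrime (X.presheaf.stalk x.1) P := by rwa [hx] at this
  have := IsNormalScheme.isIntegrallyClosed_stalk x.1
  exact IsIntegrallyClosed.of_equiv
    (IsLocalization.algEquiv P.primeCompl (X.presheaf.stalk x.1) (Localization.AtPrime P)).toRingEquiv

variable [IsNoetherian X] [IsNoetherian Y] [IsNormalScheme X]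

/-- Going down over a normal domain bounds the height of the contracted prime from above; it is
nonzero because only the zero ideal contracts to zero. -/
lemma coheight_map_eq_one [IsDominant π] [IsFinite π] {C : Y} (hC : coheight C = 1) :
    coheight (π C) = 1 := by
  obtain ⟨U, hU, hx, -⟩ := exists_isAffineOpen_mem (π C) ⊤ trivial
  have : Nonempty U := ⟨⟨_, hx⟩⟩
  have := nonempty_preimage π U
  have hV := hU.preimage π
  let := (π.app U).hom.toAlgebra
  have hP : (hV.primeIdealOf ⟨C, hx⟩).asIdeal.comap (algebraMap Γ(X, U) Γ(Y, π ⁻¹ᵁ U)) =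
      (hU.primeIdealOf ⟨π C, hx⟩).asIdeal := by
    have := IsAffineOpen.comap_primeIdealOf_appLE (f := π) U hU (π ⁻¹ᵁ U) hV le_rfl (x := C) hx
    rw [← Scheme.Hom.app_eq_appLE] at this
    exact congrArg PrimeSpectrum.asIdeal this
  have := isIntegrallyClosed_section hU
  have : IsNoetherianRing Γ(X, U) := IsLocallyNoetherian.component_noetherian ⟨U, hU⟩
  have : IsNoetherianRing Γ(Y, π ⁻¹ᵁ U) := IsLocallyNoetherian.component_noetherian ⟨_, hV⟩
  have : Algebra.IsIntegral Γ(X, U) Γ(Y, π ⁻¹ᵁ U) :=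
    ⟨(IsFinite.finite_app π U hU).to_isIntegral⟩
  have hinj : Function.Injective (algebraMap Γ(X, U) Γ(Y, π ⁻¹ᵁ U)) := by
    intro a b hab
    apply X.germToFunctionField_injective U
    apply (functionFieldMap π).injective
    have h1 := functionFieldMap_section π U a
    have h2 := functionFieldMap_section π U b
    exact h1.trans ((congrArg _ hab).trans h2.symm)
  have : FaithfulSMul Γ(X, U) Γ(Y, π ⁻¹ᵁ U) := (faithfulSMul_iff_algebraMap_injective _ _).2 hinj
  have hlies : (hV.primeIdealOf ⟨C, hx⟩).asIdeal.LiesOver (hU.primeIdealOf ⟨π C, hx⟩).asIdeal :=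
    ⟨hP.symm⟩
  have h1 := Ideal.height_eq_height_add_of_liesOver_of_hasGoingDown
    (hU.primeIdealOf ⟨π C, hx⟩).asIdeal (hV.primeIdealOf ⟨C, hx⟩).asIdeal
  have h2 := coheight_eq_height hV ⟨C, hx⟩
  have h3 := coheight_eq_height hU ⟨π C, hx⟩
  rw [← h2, hC, ← h3] at h1
  refine le_antisymm (h1 ▸ le_self_add) ?_
  change 1 ≤ coheight (π C)
  rw [Order.one_le_iff_pos, pos_iff_ne_zero]
  intro h0
  have h0' : (hU.primeIdealOf ⟨π C, hx⟩).asIdeal.height = 0 := h3.symm.trans h0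
  rw [Ideal.height_eq_zero_iff, IsDomain.minimalPrimes_eq_singleton_bot] at h0'
  have h4 : (hV.primeIdealOf ⟨C, hx⟩).asIdeal = ⊥ :=
    Ideal.eq_bot_of_comap_eq_bot (R := Γ(X, U)) (hP.trans h0')
  rw [h4, Ideal.height_bot, hC] at h2
  exact one_ne_zero h2

variable [IsNormalScheme Y] [IsFFinite p X] [IsFFinite p Y]

/-- The divisor of the extension to `K(Y)` of a `p^{-e}`-linear map on `K(X)`. -/
theorem hasDivisorAt_extension [IsDominant π] [IsFinite π] (hsep : IsSeparableMorphism π) {e : ℕ}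
    {Φ : X.functionField →+ X.functionField}
    (hΦ : Φ ∈ pInvLinearMaps p e X.functionField X.functionField X.functionField)
    {Ψ : Y.functionField →+ Y.functionField}
    (hΨ : Ψ ∈ pInvLinearMaps p e Y.functionField Y.functionField Y.functionField)
    (hext : ∀ k, Ψ (functionFieldMap π k) = functionFieldMap π (Φ k)) {C : Y}
    (hC : coheight C = 1) {d : ℤ} (hd : HasDivisorAt (π C) Φ d) :
    HasDivisorAt C Ψ (ramificationIndex π C * d - (p ^ e - 1) * (ramificationCoeff π C : ℤ)) := by
  have hchar : CharP X.functionField p := IsFFinite.charP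
  have hE := coheight_map_eq_one π hC
  have := isDiscreteValuationRing_stalk hC
  have := isDiscreteValuationRing_stalk hE
  let := (functionFieldMap π).toAlgebra
  let := (π.stalkMap C).hom.toAlgebra
  have := finiteDimensional_functionField π
  have : Algebra.IsSeparable X.functionField Y.functionField := hsep
  have hc : ∀ v : X.presheaf.stalk (π C), algebraMap (Y.presheaf.stalk C) Y.functionField
      (algebraMap (X.presheaf.stalk (π C)) (Y.presheaf.stalk C) v) =
      algebraMap X.functionField Y.functionField (algebraMap _ _ v) :=
    fun v => (functionFieldMap_algebraMap π C v).symm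
  have ht : ∃ t : X.functionField, X.ord t (π C) = 1 :=
    (exists_ord_eq_one hE).imp fun _ h => h.2
  have hρ : ∀ f : X.functionField, f ≠ 0 → vord (Y.presheaf.stalk C)
      (algebraMap X.functionField Y.functionField f) =
      ramificationIndex π C * vord (X.presheaf.stalk (π C)) f := by
    intro f hf
    rw [ramificationIndex, dif_pos ht, ord_eq_vord hC]
    exact vord_algebraMap_eq hc ((ord_eq_vord hE _).symm.trans ht.choose_spec) hf
  rw [hasDivisorAt_iff hE] at hd
  rw [hasDivisorAt_iff hC]
  exact hasDivisor_extension hc (frobeniusFinite_stalk (π C)) (frobeniusFinite_stalk C) hρ hΦ hΨ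
    hext hd

end Schemes

/-! ### Sharp `F`-purity and finite morphisms -/

/-- The trace maps the extension of an ideal into the ideal. -/
lemma exists_mem_trace_eq {A B K L : Type*} [CommRing A] [IsDomain A] [IsIntegrallyClosed A]
    [CommRing B] [Field K] [Field L] [Algebra A K] [IsFractionRing A K] [Algebra B L]
    [Algebra K L] [FiniteDimensional K L] (f : A →+* B) (hf : f.IsIntegral)
    (hc : ∀ a, algebraMap B L (f a) = algebraMap K L (algebraMap A K a)) {I : _root_.Ideal A}
    {c : B} (h : c ∈ I.map f) :
    ∃ a ∈ I, algebraMap A K a = Algebra.trace K L (algebraMap B L c) := by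
  have htr : ∀ b : B, ∃ a, algebraMap A K a = Algebra.trace K L (algebraMap B L b) := by
    intro b
    let : Algebra A L := ((algebraMap K L).comp (algebraMap A K)).toAlgebra
    have : IsScalarTower A K L := IsScalarTower.of_algebraMap_eq fun _ => rfl
    refine IsIntegrallyClosed.isIntegral_iff.1 (Algebra.isIntegral_trace ?_)
    obtain ⟨P, hP, hPb⟩ := hf b
    refine ⟨P, hP, ?_⟩
    have : algebraMap A L = (algebraMap B L).comp f := RingHom.ext fun a => (hc a).symm
    rw [this, ← Polynomial.hom_eval₂, hPb, map_zero]
  -- The statement for all multiples of `c` is the one stable under span induction.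
  suffices h : ∀ b : B, ∃ a ∈ I, algebraMap A K a =
      Algebra.trace K L (algebraMap B L (b * c)) by simpa using h 1
  refine Submodule.span_induction ?_ ?_ ?_ ?_ h
  · rintro _ ⟨a, ha, rfl⟩ b
    obtain ⟨r, hr⟩ := htr b
    refine ⟨a * r, I.mul_mem_right _ ha, ?_⟩
    rw [map_mul, map_mul, hc, hr, mul_comm (algebraMap B L b),
      ← Algebra.smul_def (algebraMap A K a), map_smul, smul_eq_mul]
  · intro b
    exact ⟨0, I.zero_mem, by simp⟩
  · intro c c' _ _ hc hc' b
    obtain ⟨a, ha, h1⟩ := hc b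
    obtain ⟨a', ha', h2⟩ := hc' b
    exact ⟨a + a', I.add_mem ha ha', by rw [map_add, h1, h2, mul_add, map_add, map_add]⟩
  · intro b' c _ hc b
    obtain ⟨a, ha, h1⟩ := hc (b * b')
    exact ⟨a, ha, by rw [h1, smul_eq_mul, mul_assoc]⟩

section Schemes

variable {X Y : Scheme.{u}} [IsIntegral X] [IsIntegral Y] [IsNoetherian X] [IsNoetherian Y]
  [IsNormalScheme X] [IsNormalScheme Y]

lemma HasDivisorAt.apply_mem {E : X} {Φ : X.functionField →+ X.functionField} {d : ℤ}
    (h : HasDivisorAt E Φ d) {f : X.functionField} (hf : f ≠ 0) (hd : -d ≤ X.ord f E) :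
    Φ f ∈ stalkSubring E := by
  simpa using (h f hf).2 hd 1 (one_mem _)

lemma isAlong_of_hasDivisorAt {Δ : X → ℚ} {e : ℕ} {x : X}
    {Φ : X.functionField →+ X.functionField} (h : ∀ E, E ⤳ x → coheight E = 1 →
      ∃ d : ℤ, ((p : ℚ) ^ e - 1) * Δ E ≤ d ∧ HasDivisorAt E Φ d) : IsAlong p Δ e x Φ := by
  intro E hEx hE f hf hord
  obtain ⟨d, hd, hΦ⟩ := h E hEx hE
  have := Int.ceil_le.2 hd
  exact hΦ.apply_mem hf (by linarith)

lemma IsAlong.le {Δ : X → ℚ} {e : ℕ} {x : X} {Φ : X.functionField →+ X.functionField}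
    (h : IsAlong p Δ e x Φ) {E : X} (hEx : E ⤳ x) (hE : coheight E = 1) {d : ℤ}
    (hd : HasDivisorAt E Φ d) : ((p : ℚ) ^ e - 1) * Δ E ≤ d := by
  have := isDiscreteValuationRing_stalk hE
  refine Int.ceil_le.1 (((hasDivisorAt_iff hE).1 hd).le fun f hf hord => ?_)
  exact h E hEx hE f hf (by rwa [ord_eq_vord hE])

variable [IsFFinite p X] [IsFFinite p Y] (π : Y ⟶ X) [IsFinite π]

lemma exists_functionField_extension [IsDominant π] (hsep : IsSeparableMorphism π) {e : ℕ}
    {Φ : X.functionField →+ X.functionField}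
    (hΦ : Φ ∈ pInvLinearMaps p e X.functionField X.functionField X.functionField) :
    ∃ Ψ ∈ pInvLinearMaps p e Y.functionField Y.functionField Y.functionField,
      (∀ k, Ψ (functionFieldMap π k) = functionFieldMap π (Φ k)) ∧
      ∀ l, traceMap π (Ψ l) = Φ (traceMap π l) := by
  have hchar : CharP X.functionField p := IsFFinite.charP
  let := (functionFieldMap π).toAlgebra
  have := finiteDimensional_functionField π
  have : Algebra.IsSeparable X.functionField Y.functionField := hsep
  exact exists_extension hΦ

lemma ramificationIndex_nonneg [IsDominant π] {C : Y} (hC : coheight C = 1) :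
    0 ≤ ramificationIndex π C := by
  rw [ramificationIndex]
  split_ifs with h
  · have hE := coheight_map_eq_one π hC
    have h0 : h.choose ≠ 0 := by
      intro h0
      have := h.choose_spec
      rw [h0] at this
      simp at this
    have h1 := (ord_nonneg_iff hE h0).1 (by rw [h.choose_spec]; exact zero_le_one)
    exact (ord_nonneg_iff hC ((map_ne_zero _).2 h0)).2 (functionFieldMap_mem_stalkSubring π h1)
  · exact le_rfl

/-- Sharp `F`-purity ascends along `π`. -/
theorem IsFPureWith.comap [IsDominant π] (hsep : IsSeparableMorphism π) {Δ : X → ℚ}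
    {𝔞 : X.IdealSheafData} {t : ℝ} {y : Y} {e : ℕ} (h : IsFPureWith p Δ 𝔞 t (π y) e) :
    IsFPureWith p (pullbackSubRam π Δ) (𝔞.comap π) t y e := by
  have hchar : CharP X.functionField p := IsFFinite.charP
  obtain ⟨Φ, hΦ, hal, a, ha, ha1⟩ := h
  obtain ⟨Ψ, hΨ, hext, -⟩ := exists_functionField_extension π hsep hΦ
  have hΦ0 : Φ ≠ 0 := by
    rintro rfl
    simp at ha1
  refine ⟨Ψ, hΨ, isAlong_of_hasDivisorAt fun C hCy hC => ?_, (π.stalkMap y).hom a, ?_, ?_⟩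
  · have hE := coheight_map_eq_one π hC
    have := isDiscreteValuationRing_stalk hE
    obtain ⟨d, hd⟩ := exists_hasDivisor (V := X.presheaf.stalk (π C))
      (frobeniusFinite_stalk (π C)) hΦ hΦ0
    rw [← hasDivisorAt_iff hE] at hd
    have hle := hal.le (hCy.map π.continuous) hE hd
    refine ⟨_, ?_, hasDivisorAt_extension π hsep hΦ hΨ hext hC hd⟩
    have hρ : (0 : ℚ) ≤ ramificationIndex π C := by exact_mod_cast ramificationIndex_nonneg π hC
    have h1 := mul_le_mul_of_nonneg_left hle hρ
    rw [pullbackSubRam]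
    push_cast
    linarith
  · rw [idealStalk_comap, ← Ideal.map_pow]
    exact Ideal.mem_map_of_mem _ ha
  · rw [← functionFieldMap_algebraMap, hext, ha1, map_one]

lemma comap_primeIdealOf {U : X.Opens} (hU : IsAffineOpen U) {y : Y} (hy : π y ∈ U) :
    ((hU.preimage π).primeIdealOf ⟨y, hy⟩).asIdeal.comap (π.app U).hom =
      (hU.primeIdealOf ⟨π y, hy⟩).asIdeal := by
  have := IsAffineOpen.comap_primeIdealOf_appLE (f := π) U hU (π ⁻¹ᵁ U) (hU.preimage π) le_rfl
    (x := y) hy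
  rw [← Scheme.Hom.app_eq_appLE] at this
  exact congrArg PrimeSpectrum.asIdeal this

/-- Primes over a maximal ideal are maximal in an integral extension, and specializations of `y`
stay in the fibre. -/
lemma isClosed_singleton_of_map {y : Y} (h : IsClosed {π y}) : IsClosed {y} := by
  obtain ⟨U, hU, hx, -⟩ := exists_isAffineOpen_mem (π y) ⊤ trivial
  have hV := hU.preimage π
  let := (π.app U).hom.toAlgebra
  have : Algebra.IsIntegral Γ(X, U) Γ(Y, π ⁻¹ᵁ U) :=
    ⟨(IsFinite.finite_app π U hU).to_isIntegral⟩
  have hmax : (hV.primeIdealOf ⟨y, hx⟩).asIdeal.IsMaximal := by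
    refine Ideal.isMaximal_of_isIntegral_of_isMaximal_comap (R := Γ(X, U)) _ ?_
    have := hU.primeIdealOf_isMaximal_of_isClosed ⟨π y, hx⟩ h
    rwa [← comap_primeIdealOf π hU hx] at this
  rw [← closure_eq_iff_isClosed]
  refine Set.Subset.antisymm (fun y' hy' => ?_) subset_closure
  have hs : y ⤳ y' := specializes_iff_mem_closure.2 hy'
  have h1 : π y' ∈ ({π y} : Set X) := by
    rw [← h.closure_eq]
    exact specializes_iff_mem_closure.1 (hs.map π.continuous)
  have hy'U : π y' ∈ U := by
    rw [Set.mem_singleton_iff.1 h1]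
    exact hx
  have hle := (primeIdealOf_le_iff hV ⟨y, hx⟩ ⟨y', hy'U⟩).2 hs
  have heq := hmax.eq_of_le (hV.primeIdealOf ⟨y', hy'U⟩).2.ne_top hle
  have := primeIdealOf_injective hV (PrimeSpectrum.ext heq)
  exact (congrArg Subtype.val this).symm

/-- Sharp `F`-purity descends along `π`, given a map whose divisor is `(p^e - 1)Δ`. -/
theorem isFPureWith_of_comap [IsDominant π] (hsep : IsSeparableMorphism π) {Δ : X → ℚ}
    (htr : IsTraceSurjective π) {𝔞 : X.IdealSheafData} {t : ℝ} {x : X} {e : ℕ}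
    {Φ : X.functionField →+ X.functionField}
    (hΦ : Φ ∈ pInvLinearMaps p e X.functionField X.functionField X.functionField)
    (hΦ0 : Φ ≠ 0) (hdiv : ∀ E, E ⤳ x → coheight E = 1 →
      ∃ d : ℤ, (d : ℚ) = ((p : ℚ) ^ e - 1) * Δ E ∧ HasDivisorAt E Φ d)
    (h : ∀ y, π y = x → IsFPureWith p (pullbackSubRam π Δ) (𝔞.comap π) t y e) :
    IsFPureWith p Δ 𝔞 t x e := by
  have hcharY : CharP Y.functionField p := IsFFinite.charP
  set N := ⌈t * ((p : ℝ) ^ e - 1)⌉₊ with hN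
  obtain ⟨Ψ, hΨ, hext, hΨtr⟩ := exists_functionField_extension π hsep hΦ
  have hΨ0 : Ψ ≠ 0 := by
    rintro rfl
    refine hΦ0 (AddMonoidHom.ext fun k => (functionFieldMap π).injective ?_)
    rw [← hext]
    simp
  have hfib : ∀ y, π y = x → ∃ c ∈ idealStalk (𝔞.comap π) y ^ N,
      Ψ (algebraMap _ Y.functionField c) = 1 := by
    rintro y rfl
    obtain ⟨Θ, hΘ, hal, a, ha, ha1⟩ := h y rfl
    obtain ⟨s, hs⟩ := exists_eq_mul_of_pInv (frobeniusFinite_stalk (genericPoint Y)) hΨ hΨ0 hΘ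
    have hs0 : s ≠ 0 := by
      rintro rfl
      rw [hs] at ha1
      simp at ha1
    -- Here `Ψ` has divisor exactly `(p ^ e - 1)Δ_Y` while that of `Θ` is at least as large; the
    -- difference is the order of `s`, so `s` has no poles through `y`.
    have hsy : s ∈ stalkSubring y := by
      refine mem_stalkSubring_of_codim_one fun C hCy hC => ?_
      have hE := coheight_map_eq_one π hC
      obtain ⟨d, hd, hdΦ⟩ := hdiv (π C) (hCy.map π.continuous) hE
      have hdΨ := hasDivisorAt_extension π hsep hΦ hΨ hext hC hdΦ
      have := isDiscreteValuationRing_stalk hC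
      have hdΘ := ((hasDivisorAt_iff hC).1 hdΨ).comp_mul hs0 hs
      rw [← hasDivisorAt_iff hC, ← ord_eq_vord hC] at hdΘ
      have hle := hal.le hCy hC hdΘ
      rw [← ord_nonneg_iff hC hs0]
      rw [pullbackSubRam] at hle
      push_cast at hle
      rw [hd] at hle
      have h0 : (0 : ℚ) ≤ (Y.ord s C : ℚ) := by linarith
      exact_mod_cast h0
    obtain ⟨s', rfl⟩ := hsy
    refine ⟨s' * a, Ideal.mul_mem_left _ _ ha, ?_⟩
    rw [map_mul, ← hs, ha1]
  obtain ⟨V', _, hxV', _, _, b', hb'⟩ := htr ⊤ 1 x trivial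
  obtain ⟨U, hU, hxU, hUV⟩ := exists_isAffineOpen_mem x V' hxV'
  have : Nonempty U := ⟨⟨x, hxU⟩⟩
  have := nonempty_preimage π U
  have hV := hU.preimage π
  have hUfr := functionField_isFractionRing_of_isAffineOpen X U hU
  have := isIntegrallyClosed_section hU
  have hIntegral := (IsFinite.finite_app π U hU).to_isIntegral
  have hp := (Fact.out : p.Prime)
  have hq : p ^ e = (p ^ e - 1) + 1 := (Nat.sub_add_cancel (Nat.one_le_pow _ _ hp.pos)).symm
  let I := 𝔞.ideal ⟨U, hU⟩ ^ N
  -- The regular values of `Ψ` on the extended power form an ideal, since multiplying a value by `r`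
  -- multiplies the argument by `r ^ p ^ e`.
  let J : _root_.Ideal Γ(Y, π ⁻¹ᵁ U) :=
    { carrier := {b | ∃ c ∈ I.map (π.app U).hom, Ψ (algebraMap _ Y.functionField c) =
        algebraMap _ Y.functionField b}
      add_mem' := by
        rintro b b' ⟨c, hc, h1⟩ ⟨c', hc', h2⟩
        exact ⟨c + c', Ideal.add_mem _ hc hc', by
          rw [map_add (algebraMap _ Y.functionField), map_add Ψ, h1, h2,
            map_add (algebraMap _ Y.functionField)]⟩
      zero_mem' := ⟨0, Ideal.zero_mem _, by
        rw [map_zero (algebraMap _ Y.functionField), map_zero Ψ]⟩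
      smul_mem' := by
        rintro r b ⟨c, hc, h1⟩
        refine ⟨r ^ p ^ e * c, Ideal.mul_mem_left _ _ hc, ?_⟩
        rw [map_mul (algebraMap _ Y.functionField), map_pow, pInv_pow_mul hΨ, h1, smul_eq_mul,
          map_mul (algebraMap _ Y.functionField)] }
  have hJ : ∀ y, π y = x → ∃ hy : y ∈ π ⁻¹ᵁ U, ¬ J ≤ (hV.primeIdealOf ⟨y, hy⟩).asIdeal := by
    rintro y rfl
    refine ⟨hxU, fun hle => ?_⟩
    obtain ⟨c, hc, hc1⟩ := hfib y rfl
    rw [idealStalk_eq (𝔞.comap π) ⟨_, hV⟩ hxU, ideal_comap_eq π 𝔞 ⟨U, hU⟩, ← Ideal.map_pow,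
      ← Ideal.map_pow] at hc
    let : Algebra Γ(Y, π ⁻¹ᵁ U) (Y.presheaf.stalk y) :=
      Y.presheaf.algebra_section_stalk ⟨y, hxU⟩
    have : IsLocalization.AtPrime (Y.presheaf.stalk y) (hV.primeIdealOf ⟨y, hxU⟩).asIdeal :=
      hV.isLocalization_stalk ⟨y, hxU⟩
    obtain ⟨⟨c', s⟩, hcs⟩ := (IsLocalization.mem_map_algebraMap_iff
      (hV.primeIdealOf ⟨y, hxU⟩).asIdeal.primeCompl (Y.presheaf.stalk y)).1 hc
    -- With `c = c' / s`, this argument equals `s ^ p ^ e * c`, and its value is `s`, which does not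
    -- vanish at `y`.
    refine s.2 (hle ⟨s.1 ^ (p ^ e - 1) * c'.1, Ideal.mul_mem_left _ _ c'.2, ?_⟩)
    have key : ∀ b : Γ(Y, π ⁻¹ᵁ U), algebraMap (Y.presheaf.stalk y) Y.functionField
        (algebraMap Γ(Y, π ⁻¹ᵁ U) (Y.presheaf.stalk y) b) = algebraMap _ _ b :=
      fun b => Scheme.algebraMap_germ_eq_germToFunctionField Y (U := π ⁻¹ᵁ U) hxU b
    have hcs' := congrArg (algebraMap _ Y.functionField) hcs
    rw [map_mul, key, key] at hcs'
    have : algebraMap _ Y.functionField (s.1 ^ (p ^ e - 1) * c'.1) =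
        algebraMap _ Y.functionField s.1 ^ p ^ e * algebraMap _ Y.functionField c := by
      rw [map_mul, map_pow, ← hcs', hq, pow_succ, ← hq]
      ring
    rw [this, pInv_pow_mul hΨ, hc1, mul_one]
  -- Otherwise lying over would give a prime over `x` containing `J`.
  obtain ⟨r, hrJ, hrx⟩ : ∃ r : Γ(X, U), (π.app U).hom r ∈ J ∧ x ∈ X.basicOpen r := by
    by_contra! hcon
    let := (π.app U).hom.toAlgebra
    have : Algebra.IsIntegral Γ(X, U) Γ(Y, π ⁻¹ᵁ U) := ⟨hIntegral⟩
    obtain ⟨Q, hJQ, hQ, hQx⟩ := Ideal.exists_ideal_over_prime_of_isIntegral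
      (S := Γ(Y, π ⁻¹ᵁ U)) (hU.primeIdealOf ⟨x, hxU⟩).asIdeal J (by
        intro r hr
        by_contra hrx
        exact hcon r hr ((mem_primeIdealOf_iff hU ⟨x, hxU⟩ r).1 hrx))
    obtain ⟨y, hy⟩ := exists_primeIdealOf_eq hV ⟨Q, hQ⟩
    have hyx : π y.1 = x := by
      have h1 := comap_primeIdealOf π hU y.2
      have h2 : (hV.primeIdealOf ⟨y.1, y.2⟩).asIdeal = Q := congrArg PrimeSpectrum.asIdeal hy
      rw [h2] at h1
      have h3 := primeIdealOf_injective hU (PrimeSpectrum.ext (h1.symm.trans hQx))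
      exact congrArg Subtype.val h3
    obtain ⟨_, hnle⟩ := hJ y.1 hyx
    apply hnle
    have h2 : (hV.primeIdealOf ⟨y.1, y.2⟩).asIdeal = Q := congrArg PrimeSpectrum.asIdeal hy
    rw [h2]
    exact hJQ
  obtain ⟨c, hc, hcr⟩ := hrJ
  have hUV' : (π ⁻¹ᵁ U : Y.Opens) ≤ π ⁻¹ᵁ V' := fun _ hy => hUV hy
  let b : Γ(Y, π ⁻¹ᵁ U) := Y.presheaf.map (homOfLE hUV').op b'
  have hb : traceMap π (algebraMap _ Y.functionField b) = 1 := by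
    have h1 : algebraMap _ Y.functionField b = Y.germToFunctionField (π ⁻¹ᵁ V') b' :=
      TopCat.Presheaf.germ_res_apply Y.presheaf (homOfLE hUV') _ _ b'
    rw [h1, hb', map_one, map_one]
  -- The `p ^ e`-th power lets `b` leave `Ψ` as itself, so that the trace of `b * r` is `r`.
  obtain ⟨a₀, ha₀, ha₀tr⟩ : ∃ a ∈ I, algebraMap Γ(X, U) X.functionField a =
      traceMap π (algebraMap _ Y.functionField (b ^ p ^ e * c)) := by
    let := (functionFieldMap π).toAlgebra
    have := finiteDimensional_functionField π
    exact exists_mem_trace_eq (π.app U).hom hIntegral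
      (fun a => (functionFieldMap_section π U a).symm) (Ideal.mul_mem_left _ _ hc)
  have hΦa₀ : Φ (algebraMap _ X.functionField a₀) = algebraMap _ X.functionField r := by
    rw [ha₀tr, ← hΨtr, map_mul, map_pow, pInv_pow_mul hΨ, hcr,
      ← functionFieldMap_section π U r]
    let := (functionFieldMap π).toAlgebra
    have h1 : traceMap π (algebraMap _ Y.functionField b *
        functionFieldMap π (algebraMap _ X.functionField r)) =
        algebraMap _ X.functionField r * traceMap π (algebraMap _ Y.functionField b) := by
      change Algebra.trace X.functionField Y.functionField (_ * algebraMap _ _ _) =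
        _ * Algebra.trace X.functionField Y.functionField _
      rw [mul_comm, ← Algebra.smul_def, map_smul, smul_eq_mul]
    rw [h1, hb, mul_one]
  obtain ⟨v, hv⟩ := ((X.mem_basicOpen r x hxU).1 hrx).exists_left_inv
  refine ⟨Φ, hΦ, isAlong_of_hasDivisorAt fun E hEx hE => ?_,
    v ^ p ^ e * X.presheaf.germ U x hxU a₀, ?_, ?_⟩
  · obtain ⟨d, hd, hdΦ⟩ := hdiv E hEx hE
    exact ⟨d, hd.ge, hdΦ⟩
  · refine Ideal.mul_mem_left _ _ ?_
    rw [idealStalk_eq 𝔞 ⟨U, hU⟩ hxU, ← Ideal.map_pow]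
    exact Ideal.mem_map_of_mem _ ha₀
  · have h1 := congrArg (algebraMap _ X.functionField) hv
    rw [map_mul, Scheme.algebraMap_germ_eq_germToFunctionField, map_one] at h1
    rw [map_mul, map_pow, pInv_pow_mul hΦ, Scheme.algebraMap_germ_eq_germToFunctionField]
    exact (congrArg _ hΦa₀).trans h1

/-- Sharp `F`-purity of a triple and of its pullback under a finite separable morphism with
surjective trace. -/
theorem isSharplyFPure_iff_comap [Surjective π] (hsep : IsSeparableMorphism π)
    {D : WeilDivisor X ℤ} (hF : FrobeniusShriekIso p D) {Δ : X → ℚ} (𝔞 : X.IdealSheafData) (t : ℝ)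
    (hΔX : IsEffective Δ) (hΔY : IsEffective (pullbackSubRam π Δ))
    (hQ : IsQCartier (fun E => (D E : ℚ) + Δ E))
    (hindex : ¬ p ∣ cartierIndex (fun E => (D E : ℚ) + Δ E)) (htr : IsTraceSurjective π) :
    IsSharplyFPure p Δ 𝔞 t ↔ IsSharplyFPure p (pullbackSubRam π Δ) (𝔞.comap π) t := by
  constructor
  · intro h y hy
    have hx : IsClosed {π y} := by simpa using π.isClosedMap _ hy
    obtain ⟨e, he, hpure⟩ := (isSharplyFPureAt_iff hΔX 𝔞 t (π y)).1 (h (π y) hx)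
    exact (isSharplyFPureAt_iff hΔY _ t y).2 ⟨e, he, hpure.comap π hsep⟩
  · intro h x hx
    obtain ⟨e₀, he₀, hdiv⟩ := exists_hasDivisorAt_eq hF hQ hindex
    have hfib : ∀ y : π ⁻¹' {x}, ∃ e, 0 < e ∧
        IsFPureWith p (pullbackSubRam π Δ) (𝔞.comap π) t y.1 e := by
      rintro ⟨y, rfl⟩
      exact (isSharplyFPureAt_iff hΔY _ t y).1 (h y (isClosed_singleton_of_map π hx))
    choose e he hpure using hfib
    have : Fintype (π ⁻¹' {x}) := (π.finite_preimage_singleton x).fintype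
    -- The fibre is finite, so one exponent is a multiple of `e₀` and of the exponents at all its
    -- points.
    have hprod : 0 < e₀ * ∏ y, e y := Nat.mul_pos he₀ (Finset.prod_pos fun y _ => he y)
    obtain ⟨Φ, hΦ, hΦ0, hΦd⟩ := hdiv _ hprod (dvd_mul_right _ _) x
    refine (isSharplyFPureAt_iff hΔX 𝔞 t x).2 ⟨_, hprod, isFPureWith_of_comap π hsep htr hΦ hΦ0
      hΦd fun y hy => ?_⟩
    obtain ⟨k, hk⟩ : e ⟨y, hy⟩ ∣ e₀ * ∏ y, e y :=
      (Finset.dvd_prod_of_mem e (Finset.mem_univ _)).mul_left _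
    rw [hk, mul_comm]
    refine (hpure ⟨y, hy⟩).mul (Nat.pos_of_ne_zero ?_)
    rintro rfl
    rw [mul_zero] at hk
    exact hprod.ne' hk

end Schemes

end FPure

end

theorem mainTheorem5 (p : ℕ) [Fact p.Prime]
    {X Y : Scheme.{u}} [IsIntegral X] [IsIntegral Y] [IsNoetherian X] [IsNoetherian Y]
    [IsNormalScheme X] [IsNormalScheme Y] [IsFFinite p X] [IsFFinite p Y]
    (π : Y ⟶ X) [IsFinite π] [Surjective π] (hsep : IsSeparableMorphism π)
    (K_X : WeilDivisor X ℤ) (hK : IsCanonicalDivisor K_X) (hF : FrobeniusShriekIso p K_X)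
    (Δ_X : WeilDivisor X ℚ) (𝔞 : X.IdealSheafData) (h𝔞 : 𝔞 ≠ ⊥) (t : ℝ) (ht : 0 ≤ t)
    (hΔX : IsEffective Δ_X) (hΔY : IsEffective (pullbackSubRam π Δ_X))
    (hQ : IsQCartier (fun E => (K_X E : ℚ) + Δ_X E))
    (hindex : ¬ p ∣ cartierIndex (fun E => (K_X E : ℚ) + Δ_X E))
    (htr : IsTraceSurjective π) :
    IsSharplyFPure p Δ_X 𝔞 t ↔ IsSharplyFPure p (pullbackSubRam π Δ_X) (𝔞.comap π) t := by
  exact isSharplyFPure_iff_comap π hsep hF 𝔞 t hΔX hΔY hQ hindex htr
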